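/- Let $\mathcal{T}$ be a locally compact metric space with a Radon measure $m$, and let $\mathcal{A}$ be an indexing collection of subsets of $\mathcal{T}$, that is, a class of compact connected sets (the empty set counting as connected) such that: (1) $\emptyset\in\mathcal{A}$; $A^\circ\neq A$ for $A\in\mathcal{A}\setminus\{\emptyset,\mathcal{T}\}$; and there is an increasing sequence $(B_n)$ in $\mathcal{A}(u)$ with $\mathcal{T}=\bigcup_n B_n^\circ$, where $\mathcal{D}(u)$ denotes the class of finite unions of elements of $\mathcal{D}$; (2) $\mathcal{A}$ is closed under intersections of nonempty subfamilies, two nonempty elements of $\mathcal{A}$ have nonempty intersection, and $\overline{\bigcup_i A_i}\in\mathcal{A}$ for every increasing sequence $(A_i)$ in $\mathcal{A}$ contained in some $B_n$; (3) $\mathcal{A}$ generates the Borel $\sigma$-algebra of $\mathcal{T}$; (4) (separability from above) there are an increasing sequence of finite subclasses $\mathcal{A}_n\subseteq\mathcal{A}$, closed under intersections, with $\emptyset,B_n\in\mathcal{A}_n(u)$, and maps $g_n:\mathcal{A}\to\mathcal{A}_n(u)\cup\{\mathcal{T}\}$ such that $g_n$ preserves arbitrary intersections and finite unions, $A\subseteq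 g_n(A)^\circ$, $g_n(A)\subseteq g_k(A)$ for $k\le n$, $A=\bigcap_n g_n(A)$, $g_n(A)\cap A'\in\mathcal{A}$ for $A,A'\in\mathcal{A}$, $g_n(A)\cap A'\in\mathcal{A}_n$ for $A\in\mathcal{A}$, $A'\in\mathcal{A}_n$, and $g_n(\emptyset)=\emptyset$; (5) every countable intersection of sets in $\mathcal{A}(u)$ is the closure of a countable union of sets in $\mathcal{A}$. Put $\emptyset'=\bigcap_{U\in\mathcal{A}\setminus\{\emptyset\}}U$ and assume $m(\emptyset')=0$. Let $\mathcal{C}$ be the class of sets $C=U_0\setminus\bigcup_{i=1}^nU_i$ with $U_0,\dots,U_n\in\mathcal{A}$. For a real-valued process $X=\{X_U;\,U\in\mathcal{A}\}$ on a probability space, put $$\Delta X_C=X_{U_0}-\sum_{i=1}^n\sum_{j_1<\dots<j_i}(-1)^{i-1}X_{U_0\cap U_{j_1}\cap\dots\cap U_{j_i}};$$ $X$ has definite increments if $X_\emptyset=0$ a.s. and, up to null events, $\Delta X_C$ does not depend on the representation of $C$. For $V=\bigcup_{i=1}^nV_i\in\mathcal{A}(u)$ with $V_i\in\mathcal{A}$,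 put $\Delta X_V=\sum_{i=1}^n\sum_{j_1<\dots<j_i}(-1)^{i-1}X_{V_{j_1}\cap\dots\cap V_{j_i}}$. For $U\in\mathcal{A}(u)$ let $\mathcal{F}_U=\sigma(X_V;\,V\in\mathcal{A},V\subseteq U)$. A process $X$ with definite increments is a set-indexed Lévy process if: (a) $X_{\emptyset'}=0$ a.s.; (b) $\Delta X_{C_1},\dots,\Delta X_{C_n}$ are independent for pairwise disjoint $C_1,\dots,C_n\in\mathcal{C}$; (c) for all $n$, all $V\in\mathcal{A}$ and all increasing $(U_i)_{i\le n}$, $(A_i)_{i\le n}$ in $\mathcal{A}$ with $m(U_i\setminus V)=m(A_i)$ for all $i$, the vectors $(\Delta X_{U_i\setminus V})_{i\le n}$ and $(X_{A_i})_{i\le n}$ have the same law; (d) $X_{U_n}\to X_A$ in probability whenever $U_n,A\in\mathcal{A}$ and $\overline{\bigcup_n\bigcap_{k\ge n}U_k}=\bigcap_n\overline{\bigcup_{k\ge n}U_k}=A$. A transition system $\mathcal{Q}$ is a family of Markov kernels $Q_{U,V}$ on $\mathbf{R}$, for $U\subseteq V$ in $\mathcal{A}(u)$, with $Q_{U,U}(x,\cdot)=\delta_x$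 and $\int Q_{U,V}(x,dy)\,Q_{V,W}(y,B)=Q_{U,W}(x,B)$ for $U\subseteq V\subseteq W$. It is spatially homogeneous if $Q_{U,V}(x,B)=Q_{U,V}(0,B-x)$ for all $U\subsetneq V$, all $x$ and all Borel $B$, and $m$-homogeneous if $Q_{U,V}=Q_{U',V'}$ whenever $U\subsetneq V$, $U'\subsetneq V'$ and $m(V\setminus U)=m(V'\setminus U')$. A process $X$ with definite increments is $\mathcal{Q}$-Markov if $P(\Delta X_V\in B\mid\mathcal{F}_U)=Q_{U,V}(\Delta X_U,B)$ a.s. for all $U\subseteq V$ in $\mathcal{A}(u)$ and all Borel $B$. Theorem. (A) Suppose that $m$ is continuous along increasing sequences of $\mathcal{A}$: if $A_0\subseteq A_1\subseteq\cdots$ are in $\mathcal{A}$ and $\overline{\bigcup_iA_i}\in\mathcal{A}$, then $m(A_i)\to m\big(\overline{\bigcup_iA_i}\big)$. Let $X=\{X_U;\,U\in\mathcal{A}\}$ be a set-indexed process with definite increments. Then the following are equivalent: (i) $X$ is a set-indexed Lévy process; (ii) $X_{\emptyset'}=0$ a.s. and $X$ is a $\mathcal{Q}$-Markov process for some transition system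 $\mathcal{Q}$ which is spatially homogeneous and $m$-homogeneous with measurable dependence on $m$, i.e. such that for all $x$ and all Borel $B$, $Q_{U,V}(x,B)$ (for $U\subsetneq V$) is a Borel function of $m(V\setminus U)$. (B) For every transition system $\mathcal{Q}$ which is both spatially homogeneous and $m$-homogeneous, there exists a set-indexed process with definite increments which is $\mathcal{Q}$-Markov (no symmetry, measurability in $m$ or continuity assumption is needed here). -/

import Mathlib

open Set Filter Topology MeasureTheory ProbabilityTheory

universe u v

noncomputable section

namespace SetIndexed

variable {T : Type u} {Ω : Type v}

/-- The class `D(u)` of finite (nonempty) unions of elements of `D`. -/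
def finUnions (D : Set (Set T)) : Set (Set T) :=
  {S | ∃ (n : ℕ) (U : Fin (n + 1) → Set T), (∀ i, U i ∈ D) ∧ S = ⋃ i, U i}

/-- Separability from above of `A`, relative to the exhausting sequence `B` of `T`:
`D n` are the finite subclasses and `g n` the discretization maps (only their values on `A`
matter). -/
def SeparableFromAbove [TopologicalSpace T] (A : Set (Set T)) (B : ℕ → Set T) : Prop :=
  ∃ (D : ℕ → Set (Set T)) (g : ℕ → Set T → Set T),
    Monotone D ∧
    (∀ n, (D n).Finite ∧ D n ⊆ A) ∧
    (∀ n, ∀ S ∈ D n, ∀ R ∈ D n, S ∩ R ∈ D n) ∧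
    (∀ n, ∅ ∈ finUnions (D n) ∧ B n ∈ finUnions (D n)) ∧
    (∀ n, ∀ S ∈ A, g n S ∈ finUnions (D n) ∨ g n S = univ) ∧
    -- `g n` preserves arbitrary intersections and finite unions
    (∀ n, ∀ F ⊆ A, F.Nonempty → g n (⋂₀ F) = ⋂ S ∈ F, g n S) ∧
    (∀ n, ∀ (k l : ℕ) (U : Fin k → Set T) (V : Fin l → Set T),
      (∀ i, U i ∈ A) → (∀ j, V j ∈ A) → (⋃ i, U i) = (⋃ j, V j) →
        (⋃ i, g n (U i)) = ⋃ j, g n (V j)) ∧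
    (∀ n, ∀ S ∈ A, S ⊆ interior (g n S)) ∧
    (∀ k n, k ≤ n → ∀ S ∈ A, g n S ⊆ g k S) ∧
    (∀ S ∈ A, S = ⋂ n, g n S) ∧
    (∀ n, ∀ S ∈ A, ∀ R ∈ A, g n S ∩ R ∈ A) ∧
    (∀ n, ∀ S ∈ A, ∀ R ∈ D n, g n S ∩ R ∈ D n) ∧
    (∀ n, g n ∅ = ∅)

/-- Indexing collections of compact connected subsets of `T`
(the empty set counts as connected). -/
structure IsIndexingCollection [TopologicalSpace T] (A : Set (Set T)) : Prop where
  isCompact : ∀ S ∈ A, IsCompact S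
  isPreconnected : ∀ S ∈ A, IsPreconnected S
  empty_mem : ∅ ∈ A
  interior_ne : ∀ S ∈ A, S ≠ ∅ → S ≠ univ → interior S ≠ S
  sInter_mem : ∀ F ⊆ A, F.Nonempty → ⋂₀ F ∈ A
  inter_nonempty : ∀ S ∈ A, ∀ R ∈ A, S.Nonempty → R.Nonempty → (S ∩ R).Nonempty
  generateFrom_eq : MeasurableSpace.generateFrom A = borel T
  /-- The exhausting sequence, the stability of `A` under closures of bounded increasing unions,
  and separability from above. -/
  exists_exhaustion : ∃ B : ℕ → Set T,
    Monotone B ∧ (∀ n, B n ∈ finUnions A) ∧ (⋃ n, interior (B n)) = univ ∧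
    (∀ S : ℕ → Set T, Monotone S → (∀ i, S i ∈ A) → (∃ n, ∀ i, S i ⊆ B n) →
      closure (⋃ i, S i) ∈ A) ∧
    SeparableFromAbove A B
  iInter_eq_closure : ∀ S : ℕ → Set T, (∀ i, S i ∈ finUnions A) →
    ∃ R : ℕ → Set T, (∀ i, R i ∈ A) ∧ (⋂ i, S i) = closure (⋃ i, R i)

/-- The minimal set `∅'`: the intersection of all nonempty elements of `A`. -/
def minimalSet (A : Set (Set T)) : Set T := ⋂₀ {U ∈ A | U ≠ ∅}

/-- Continuity of `m` along increasing sequences of `A`: if `A_0 ⊆ A_1 ⊆ ...` are in `A` and the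
closure of their union is in `A`, then `m (A_i)` tends to the measure of this closure. -/
def IsInnerContinuous [TopologicalSpace T] [MeasurableSpace T] (A : Set (Set T))
    (m : Measure T) : Prop :=
  ∀ S : ℕ → Set T, Monotone S → (∀ i, S i ∈ A) → closure (⋃ i, S i) ∈ A →
    Tendsto (fun i => m (S i)) atTop (𝓝 (m (closure (⋃ i, S i))))

/-! ### Set-indexed processes

A set-indexed process is a family of functions `X U : Ω → ℝ`; only the sets `U ∈ A` matter. -/

/-- The increment `ΔX_C` computed from the representation `C = U₀ \ ⋃ i, U i`, that is
`X_{U₀}` minus the inclusion-exclusion formula for `U₀ ∩ ⋃ i, U i`. -/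
def increment (X : Set T → Ω → ℝ) {n : ℕ} (U₀ : Set T) (U : Fin n → Set T) (ω : Ω) : ℝ :=
  X U₀ ω - ∑ s : Finset (Fin n) with s.Nonempty,
    (-1 : ℝ) ^ (s.card - 1) * X (U₀ ∩ ⋂ i ∈ s, U i) ω

/-- The value `ΔX_V` computed from the representation `V = ⋃ i, U i` by inclusion-exclusion. -/
def unionIncrement (X : Set T → Ω → ℝ) {n : ℕ} (U : Fin n → Set T) (ω : Ω) : ℝ :=
  ∑ s : Finset (Fin n) with s.Nonempty, (-1 : ℝ) ^ (s.card - 1) * X (⋂ i ∈ s, U i) ω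

/-- `X` is a process with definite increments: `X_∅ = 0` and `ΔX_C` does not depend, up to null
events, on the representation of `C`. -/
def HasDefiniteIncrements [MeasurableSpace Ω] (A : Set (Set T)) (P : Measure Ω)
    (X : Set T → Ω → ℝ) : Prop :=
  X ∅ =ᵐ[P] 0 ∧
  ∀ (k l : ℕ) (U₀ V₀ : Set T) (U : Fin k → Set T) (V : Fin l → Set T),
    U₀ ∈ A → V₀ ∈ A → (∀ i, U i ∈ A) → (∀ i, V i ∈ A) →
    U₀ \ (⋃ i, U i) = V₀ \ (⋃ i, V i) →
    increment X U₀ U =ᵐ[P] increment X V₀ V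

/-- Independence of the increments over pairwise disjoint elements
`C i = U₀ i \ ⋃ j, U i j` of the class `𝒞`. -/
def HasIndependentIncrements [MeasurableSpace Ω] (A : Set (Set T)) (P : Measure Ω)
    (X : Set T → Ω → ℝ) : Prop :=
  ∀ (n : ℕ) (U₀ : Fin n → Set T) (k : Fin n → ℕ) (U : ∀ i, Fin (k i) → Set T),
    (∀ i, U₀ i ∈ A) → (∀ i j, U i j ∈ A) →
    Pairwise (fun i j => Disjoint (U₀ i \ ⋃ a, U i a) (U₀ j \ ⋃ a, U j a)) →
    iIndepFun (fun i => increment X (U₀ i) (U i)) P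

/-- `m`-stationarity of the `𝒞₀`-increments `ΔX_{U \ V} = X_U - X_{U ∩ V}`. -/
def HasStationaryIncrements [MeasurableSpace T] [MeasurableSpace Ω] (A : Set (Set T))
    (m : Measure T) (P : Measure Ω) (X : Set T → Ω → ℝ) : Prop :=
  ∀ (n : ℕ) (V : Set T) (U W : Fin n → Set T), V ∈ A → (∀ i, U i ∈ A) → (∀ i, W i ∈ A) →
    Monotone U → Monotone W → (∀ i, m (U i \ V) = m (W i)) →
    IdentDistrib (fun ω i => X (U i) ω - X (U i ∩ V) ω) (fun ω i => X (W i) ω) P P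

/-- Continuity in probability. -/
def IsContinuousInProbability [TopologicalSpace T] [MeasurableSpace Ω] (A : Set (Set T))
    (P : Measure Ω) (X : Set T → Ω → ℝ) : Prop :=
  ∀ (U : ℕ → Set T) (S : Set T), (∀ n, U n ∈ A) → S ∈ A →
    closure (⋃ n, ⋂ k ≥ n, U k) = S → (⋂ n, closure (⋃ k ≥ n, U k)) = S →
    TendstoInMeasure P (fun n => X (U n)) atTop (X S)

/-- Set-indexed Lévy processes. -/
structure IsLevy [TopologicalSpace T] [MeasurableSpace T] [MeasurableSpace Ω] (A : Set (Set T))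
    (m : Measure T) (P : Measure Ω) (X : Set T → Ω → ℝ) : Prop where
  minimal : X (minimalSet A) =ᵐ[P] 0
  independent : HasIndependentIncrements A P X
  stationary : HasStationaryIncrements A m P X
  continuous : IsContinuousInProbability A P X

/-! ### Transition systems and the Markov property -/

/-- Transition systems; only `Q U V` with `U ⊆ V` in `A(u)` matters. -/
structure IsTransitionSystem (A : Set (Set T)) (Q : Set T → Set T → Kernel ℝ ℝ) : Prop where
  markov : ∀ U ∈ finUnions A, ∀ V ∈ finUnions A, U ⊆ V → IsMarkovKernel (Q U V)
  refl : ∀ U ∈ finUnions A, ∀ x, Q U U x = Measure.dirac x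
  chapman_kolmogorov : ∀ U ∈ finUnions A, ∀ V ∈ finUnions A, ∀ W ∈ finUnions A,
    U ⊆ V → V ⊆ W → ∀ (x : ℝ) (B : Set ℝ), MeasurableSet B →
      ∫⁻ y, Q V W y B ∂(Q U V x) = Q U W x B

/-- Spatial homogeneity: `Q_{U,V}(x, B) = Q_{U,V}(0, B - x)`. -/
def IsSpatiallyHomogeneous (A : Set (Set T)) (Q : Set T → Set T → Kernel ℝ ℝ) : Prop :=
  ∀ U ∈ finUnions A, ∀ V ∈ finUnions A, U ⊂ V → ∀ (x : ℝ) (B : Set ℝ), MeasurableSet B →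
    Q U V x B = Q U V 0 {y | y + x ∈ B}

/-- `m`-homogeneity: `Q_{U,V}` depends only on `m (V \ U)`. -/
def IsMHomogeneous [MeasurableSpace T] (A : Set (Set T)) (m : Measure T)
    (Q : Set T → Set T → Kernel ℝ ℝ) : Prop :=
  ∀ U ∈ finUnions A, ∀ V ∈ finUnions A, ∀ U' ∈ finUnions A, ∀ V' ∈ finUnions A,
    U ⊂ V → U' ⊂ V' → m (V \ U) = m (V' \ U') → Q U V = Q U' V'

/-- The dependence of `Q_{U,V}(x, B)` on `m (V \ U)` is Borel measurable. -/
def IsMMeasurable [MeasurableSpace T] (A : Set (Set T)) (m : Measure T)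
    (Q : Set T → Set T → Kernel ℝ ℝ) : Prop :=
  ∀ (x : ℝ) (B : Set ℝ), MeasurableSet B → ∃ q : ENNReal → ENNReal, Measurable q ∧
    ∀ U ∈ finUnions A, ∀ V ∈ finUnions A, U ⊂ V → Q U V x B = q (m (V \ U))

/-- The minimal filtration: `ℱ_U` is generated by the `X_V` with `V ∈ A`, `V ⊆ U`. -/
abbrev minimalFiltration (A : Set (Set T)) (X : Set T → Ω → ℝ) (U : Set T) : MeasurableSpace Ω :=
  ⨆ V ∈ {V | V ∈ A ∧ V ⊆ U}, MeasurableSpace.comap (X V) (borel ℝ)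

/-- The `𝒬`-Markov property: `P(ΔX_V ∈ B | ℱ_U) = Q_{U,V}(ΔX_U, B)` almost surely, for all
`U = ⋃ i, a i ⊆ V = ⋃ j, b j` in `A(u)`. -/
def IsQMarkov [MeasurableSpace Ω] (A : Set (Set T)) (P : Measure Ω) (X : Set T → Ω → ℝ)
    (Q : Set T → Set T → Kernel ℝ ℝ) : Prop :=
  ∀ (k l : ℕ) (a : Fin k → Set T) (b : Fin l → Set T), (∀ i, a i ∈ A) → (∀ j, b j ∈ A) →
    (⋃ i, a i) ⊆ (⋃ j, b j) → ∀ B : Set ℝ, MeasurableSet B →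
      P⟦unionIncrement X b ⁻¹' B | minimalFiltration A X (⋃ i, a i)⟧
        =ᵐ[P] fun ω => (Q (⋃ i, a i) (⋃ j, b j) (unionIncrement X a ω)).real B

end SetIndexed

end

/-!
Set-indexed Lévy processes are the set-indexed Markov processes with homogeneous transition
systems, and every homogeneous transition system has a Markov process.

All increments of a process `X` are values of the linear extension of `X` to simple functions,
which is encoded by the linear relation `incrGraph` spanned by the pairs `(1_U, X_U)`. A finite
family of sets decomposes the union of its members into atoms, and linear combinations of values of
`X` are combinations of the increments over the atoms (`sum_smul_ae_eq_sum_atomIncr`). If the atoms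
are ordered by decreasing number of members containing them, the initial segments are finite unions
of elements of `A`. Hence a function of sets which is multiplicative along chains of finite unions
(`IsChainMul`), such as the characteristic functions of a homogeneous transition system, is
determined on differences of finite unions by its values on the atoms (`IsChainMul.diff_eq_prod`).

*Existence.* The laws of finite families with independent atomic increments prescribed by the
transition system are consistent (`isProjectiveMeasureFamily_familyLaw`), and Kolmogorov's extension
theorem, proved here for families of real variables by the compactness of products, provides the
process. The Markov property then follows from the independence of the increments
(`isQMarkov_of_hasIndependentIncrements`).

*From Markov to Lévy.* Translation invariance of the kernels makes increments independent of the
past, so that the atomic increments are independent (`IsQMarkov.hasAtomFormula`). Stationarity is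
obtained by telescoping along chains. For the continuity in probability, the measures of the
differences `U_n \ S` and `S \ U_n` tend to zero
(`IsIndexingCollection.tendsto_measure_diff`). Every value below `m U` is the measure of an element
of `A` contained in `U` (`IsIndexingCollection.exists_measure_eq`), because the elements of `A` are
connected and a jump of the measure would disconnect them. Therefore the characteristic functions of the increments form, as a
function of the measure, a measurable multiplicative function on an interval, which is continuous
(`tendsto_one_of_multiplicative_of_measurable`).

*From Lévy to Markov.* By the same flows, the characteristic function of `X_U` is multiplicative in
`m U` and continuous at `0`, hence an exponential `exp (m U * w)` (`IsLevy.exists_exponent`).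
Dividing exponentials extends this to increments over differences of finite unions
(`charFun_diff_eq_exp`), and the translation kernels of their laws form the transition system. They
depend measurably on the measure by Lévy's continuity theorem.
-/


noncomputable section

namespace SetIndexed

/-! ### Kolmogorov's extension theorem for real coordinates -/

section Kolmogorov

variable {ι : Type*} {P : ∀ J : Finset ι, Measure (∀ _ : J, ℝ)}

/-- A sequence of cylinders with compact bases all of whose finite subfamilies have a common point
has a common point: truncated to the coordinates that occur, the points of the finite intersections
stay in a product of compact sets, which is compact by Tychonoff's theorem. -/
lemma nonempty_iInter_cylinder_of_isCompact {J : ℕ → Finset ι} {K : ∀ n, Set (∀ _ : J n, ℝ)}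
    (hK : ∀ n, IsCompact (K n)) {x : ℕ → ι → ℝ}
    (hx : ∀ n, ∀ k ≤ n, (J k).restrict (x n) ∈ K k) :
    (⋂ n, cylinder (α := fun _ => ℝ) (J n) (K n)).Nonempty := by
  classical
  -- The coordinates outside all `J n` are irrelevant, so they are set to zero.
  let y : ℕ → ι → ℝ := fun n i => if ∃ k, i ∈ J k then x n i else 0
  have hy : ∀ n k, k ≤ n → (J k).restrict (y n) ∈ K k := by
    intro n k hk
    convert! hx n k hk using 1
    ext i
    simp only [Finset.restrict, y]
    rw [if_pos ⟨k, i.2⟩]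
  have hC : ∀ i, ∃ C : Set ℝ, IsCompact C ∧ ∀ n, y n i ∈ C := by
    intro i
    by_cases hi : ∃ k, i ∈ J k
    · obtain ⟨k, hk⟩ := hi
      refine ⟨((fun z : (∀ _ : J k, ℝ) => z ⟨i, hk⟩) '' K k) ∪ ((fun n => y n i) '' Set.Iio k),
        ((hK k).image (by fun_prop)).union ((Set.finite_Iio k).image _).isCompact, fun n => ?_⟩
      rcases lt_or_ge n k with h | h
      · exact Or.inr ⟨n, h, rfl⟩
      · exact Or.inl ⟨_, hy n k h, rfl⟩
    · refine ⟨{0}, isCompact_singleton, fun n => ?_⟩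
      simp [y, hi]
  choose C hCc hCy using hC
  obtain ⟨z, -, hz⟩ := (isCompact_univ_pi hCc).exists_mapClusterPt (u := y) (f := atTop)
    (tendsto_principal.2 (Eventually.of_forall fun n => fun i _ => hCy i n))
  refine ⟨z, mem_iInter.2 fun k => ?_⟩
  have hclosed : IsClosed (cylinder (α := fun _ => ℝ) (J k) (K k)) :=
    (hK k).isClosed.preimage (by fun_prop)
  refine hclosed.mem_of_mapClusterPt hz ?_
  filter_upwards [eventually_ge_atTop k] with n hn using hy n k hn

variable [∀ J, IsProbabilityMeasure (P J)]

/-- The content of decreasing cylinders with empty intersection tends to zero. Otherwise, after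
replacing the bases by compact subsets at a small total cost, the cylinders would still have the
finite intersection property. -/
lemma tendsto_projectiveFamilyContent_zero
    (hP : IsProjectiveMeasureFamily (α := fun _ => ℝ) P) {s : ℕ → Set (ι → ℝ)}
    (hs : ∀ n, s n ∈ measurableCylinders (fun _ : ι => ℝ)) (hanti : Antitone s)
    (hempty : ⋂ n, s n = ∅) :
    Tendsto (fun n => projectiveFamilyContent hP (s n)) atTop (𝓝 0) := by
  by_contra hnot
  have hmono : ∀ m n, m ≤ n →
      projectiveFamilyContent hP (s n) ≤ projectiveFamilyContent hP (s m) := fun m n hmn =>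
    projectiveFamilyContent_mono hP (hs n) (hs m) (hanti hmn)
  obtain ⟨ε, hε, hle⟩ : ∃ ε > 0, ∀ n, ε < projectiveFamilyContent hP (s n) := by
    rw [ENNReal.tendsto_atTop_zero] at hnot
    push Not at hnot
    obtain ⟨ε, hε, h⟩ := hnot
    refine ⟨ε, hε, fun n => ?_⟩
    obtain ⟨m, hm, h'⟩ := h n
    exact h'.trans_le (hmono n m hm)
  choose J S hS hsJ using fun n => (mem_measurableCylinders _).1 (hs n)
  obtain ⟨δ, hδ, hsum⟩ := ENNReal.exists_pos_sum_of_countable' hε.ne' ℕ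
  have hK : ∀ n, ∃ K ⊆ S n, IsCompact K ∧ P (J n) (S n \ K) < δ n := fun n =>
    (hS n).exists_isCompact_sdiff_lt (measure_ne_top _ _) (hδ n).ne'
  choose K hKS hKc hKδ using hK
  have hx : ∀ n, ∃ x : ι → ℝ, ∀ k ≤ n, (J k).restrict x ∈ K k := by
    intro n
    by_contra hcon
    push Not at hcon
    have hsub : s n ⊆ ⋃ k ≤ n,
        cylinder (α := fun _ => ℝ) (J k) (S k \ K k) := by
      intro x hx
      obtain ⟨k, hk, hxk⟩ := hcon x
      have hxs : x ∈ s k := hanti hk hx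
      rw [hsJ k] at hxs
      exact mem_biUnion (show k ∈ {k | k ≤ n} from hk) ⟨hxs, hxk⟩
    have hmem : ∀ k, cylinder (α := fun _ => ℝ) (J k) (S k \ K k) ∈
        measurableCylinders (fun _ : ι => ℝ) := fun k =>
      cylinder_mem_measurableCylinders _ _ ((hS k).diff (hKc k).measurableSet)
    have h1 : projectiveFamilyContent hP (s n) ≤ ∑ k ∈ Finset.range (n + 1), δ k :=
      calc projectiveFamilyContent hP (s n)
          ≤ projectiveFamilyContent hP (⋃ k ≤ n,
              cylinder (α := fun _ => ℝ) (J k) (S k \ K k)) := by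
            refine projectiveFamilyContent_mono hP (hs n) ?_ hsub
            simpa only [Finset.mem_range_succ_iff] using
              isSetRing_measurableCylinders.biUnion_mem (Finset.range (n + 1)) fun k _ => hmem k
        _ ≤ ∑ k ∈ Finset.range (n + 1), projectiveFamilyContent hP
              (cylinder (α := fun _ => ℝ) (J k) (S k \ K k)) :=
            projectiveFamilyContent_iUnion_le hP hmem n
        _ ≤ ∑ k ∈ Finset.range (n + 1), δ k := by
            refine Finset.sum_le_sum fun k _ => ?_
            rw [projectiveFamilyContent_cylinder hP ((hS k).diff (hKc k).measurableSet)]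
            exact (hKδ k).le
    exact absurd (h1.trans (ENNReal.sum_le_tsum _)) (not_le.2 (hsum.trans (hle n)))
  choose x hx using hx
  obtain ⟨z, hz⟩ := nonempty_iInter_cylinder_of_isCompact hKc hx
  have : z ∈ ⋂ n, s n := by
    refine mem_iInter.2 fun n => ?_
    rw [hsJ n]
    exact hKS n (mem_iInter.1 hz n)
  simp [hempty] at this

/-- **Kolmogorov's extension theorem** for families of real random variables: a projective family
of probability measures on the spaces `J → ℝ`, for `J` a finite set of indices, is the family of
finite-dimensional marginals of a measure on `ι → ℝ`. -/
theorem exists_isProjectiveLimit (hP : IsProjectiveMeasureFamily (α := fun _ => ℝ) P) :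
    ∃ μ : Measure (ι → ℝ), IsProjectiveLimit (α := fun _ => ℝ) μ P := by
  have hsub : (projectiveFamilyContent hP).IsSigmaSubadditive :=
    isSigmaSubadditive_of_addContent_iUnion_eq_tsum isSetRing_measurableCylinders
      fun f hf hf_Union hf' => addContent_iUnion_eq_sum_of_tendsto_zero
        isSetRing_measurableCylinders (projectiveFamilyContent hP)
        (fun s hs => projectiveFamilyContent_ne_top hP)
        (fun _ hs hanti hempty => tendsto_projectiveFamilyContent_zero hP hs hanti hempty)
        hf hf_Union hf'
  refine ⟨(projectiveFamilyContent hP).measure isSetSemiring_measurableCylinders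
    generateFrom_measurableCylinders.ge hsub, fun I => ?_⟩
  ext s hs
  rw [Measure.map_apply (by fun_prop) hs, AddContent.measure_eq, ← cylinder,
    projectiveFamilyContent_cylinder hP hs]
  · exact generateFrom_measurableCylinders.symm
  · exact cylinder_mem_measurableCylinders _ _ hs

end Kolmogorov
end SetIndexed

namespace SetIndexed

/-! ### Local multiplicative semigroups of complex numbers -/

/-- A bounded function which is additive on `[0, δ]` and vanishes at `δ` is zero: its values at
`t` and at `2 t` or `2 t - δ` show that any bound can be halved. -/
lemma eq_zero_of_additive_of_bounded {G : ℝ → ℂ} {δ K : ℝ} (hδ : 0 < δ)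
    (hadd : ∀ s t, 0 ≤ s → 0 ≤ t → s + t ≤ δ → G (s + t) = G s + G t) (hGδ : G δ = 0)
    (hK : ∀ t, 0 ≤ t → t ≤ δ → ‖G t‖ ≤ K) {t : ℝ} (ht : 0 ≤ t) (htδ : t ≤ δ) : G t = 0 := by
  have hhalf : G (δ / 2) = 0 := by
    have h := hadd (δ / 2) (δ / 2) (by linarith) (by linarith) (by linarith)
    rw [add_halves, hGδ] at h
    have h2 : (2 : ℂ) * G (δ / 2) = 0 := by rw [two_mul, ← h]
    simpa using h2
  have key : ∀ n : ℕ, ∀ t, 0 ≤ t → t ≤ δ → ‖G t‖ ≤ K / 2 ^ n := by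
    intro n
    induction n with
    | zero => simpa using hK
    | succ n ih =>
      have small : ∀ t, 0 ≤ t → t ≤ δ / 2 → ‖G t‖ ≤ K / 2 ^ (n + 1) := by
        intro t ht ht2
        have h := ih (t + t) (by linarith) (by linarith)
        rw [hadd t t ht ht (by linarith), ← two_mul, norm_mul] at h
        rw [pow_succ, ← div_div, le_div_iff₀ two_pos]
        simpa [mul_comm] using h
      intro t ht htδ
      rcases le_total t (δ / 2) with h | h
      · exact small t ht h
      · have h' := hadd (t - δ / 2) (δ / 2) (by linarith) (by linarith) (by linarith)
        rw [sub_add_cancel, hhalf, add_zero] at h'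
        rw [h']
        exact small _ (by linarith) (by linarith)
  have hlim : Tendsto (fun n : ℕ => K / 2 ^ n) atTop (𝓝 0) := by
    have h := (tendsto_pow_atTop_nhds_zero_of_lt_one (r := (1 / 2 : ℝ)) (by norm_num)
      (by norm_num)).const_mul K
    simpa [div_eq_mul_inv] using h
  exact norm_le_zero_iff.1 (ge_of_tendsto hlim (Eventually.of_forall fun n => key n t ht htδ))

/-- A multiplicative function on `[0, s₀]` with limit `1` at `0` is an exponential: its logarithm is
additive and bounded near `0`, hence linear there, and powers give the remaining values. -/
lemma exists_eq_exp_of_multiplicative {φ : ℝ → ℂ} {s₀ : ℝ} (hs₀ : 0 < s₀) (h0 : φ 0 = 1)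
    (hmul : ∀ s t, 0 ≤ s → 0 ≤ t → s + t ≤ s₀ → φ (s + t) = φ s * φ t)
    (hlim : Tendsto φ (𝓝[>] 0) (𝓝 1)) :
    ∃ w : ℂ, ∀ t, 0 ≤ t → t ≤ s₀ → φ t = Complex.exp (t * w) := by
  obtain ⟨δ, hδ, hδs, hclose⟩ : ∃ δ > 0, δ ≤ s₀ ∧ ∀ t, 0 ≤ t → t ≤ δ → ‖φ t - 1‖ < 1 / 2 := by
    have h := hlim.eventually (Metric.ball_mem_nhds (1 : ℂ) (ε := 1 / 2) (by norm_num))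
    obtain ⟨b, hb, hsub⟩ := (mem_nhdsGT_iff_exists_Ioc_subset).1 h
    refine ⟨min b s₀, lt_min hb hs₀, min_le_right _ _, fun t ht htb => ?_⟩
    rcases ht.eq_or_lt with rfl | ht
    · simp [h0]
    · have := hsub ⟨ht, htb.trans (min_le_left _ _)⟩
      simpa [dist_eq_norm] using this
  have hre : ∀ t, 0 ≤ t → t ≤ δ → 0 < (φ t).re := by
    intro t ht htδ
    have h := (Complex.abs_re_le_norm (φ t - 1)).trans_lt (hclose t ht htδ)
    rw [Complex.sub_re, Complex.one_re, abs_lt] at h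
    linarith [h.1]
  have hne : ∀ t, 0 ≤ t → t ≤ δ → φ t ≠ 0 := by
    intro t ht htδ h
    have := hre t ht htδ
    simp [h] at this
  -- The values have positive real parts, so the principal logarithms add without a winding term.
  have hlog : ∀ s t, 0 ≤ s → 0 ≤ t → s + t ≤ δ →
      Complex.log (φ (s + t)) = Complex.log (φ s) + Complex.log (φ t) := by
    intro s t hs ht hst
    rw [hmul s t hs ht (hst.trans hδs)]
    refine (Complex.log_mul_eq_add_log_iff (hne s hs (by linarith)) (hne t ht (by linarith))).2 ?_
    have h1 := abs_lt.1 (Complex.abs_arg_lt_pi_div_two_iff.2 (Or.inl (hre s hs (by linarith))))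
    have h2 := abs_lt.1 (Complex.abs_arg_lt_pi_div_two_iff.2 (Or.inl (hre t ht (by linarith))))
    constructor <;> linarith [h1.1, h1.2, h2.1, h2.2]
  have hbound : ∀ t, 0 ≤ t → t ≤ δ → ‖Complex.log (φ t)‖ ≤ 1 := by
    intro t ht htδ
    have h := Complex.norm_log_one_add_half_le_self (hclose t ht htδ).le
    rw [add_sub_cancel] at h
    linarith [hclose t ht htδ]
  have hδC : (δ : ℂ) ≠ 0 := by exact_mod_cast hδ.ne'
  set w : ℂ := Complex.log (φ δ) / δ with hw
  have hlin : ∀ t, 0 ≤ t → t ≤ δ → φ t = Complex.exp (t * w) := by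
    intro t ht htδ
    have h := eq_zero_of_additive_of_bounded (G := fun t => Complex.log (φ t) - t * w) (K := 2) hδ
      (fun s t hs ht hst => by
        rw [hlog s t hs ht hst]
        push_cast
        ring)
      (by
        simp only [hw]
        rw [mul_div_cancel₀ _ hδC, sub_self])
      (fun t ht htδ => by
        refine (norm_sub_le _ _).trans ?_
        have h1 := hbound t ht htδ
        have h2 : ‖(t : ℂ) * w‖ ≤ 1 := by
          rw [hw, norm_mul, norm_div, Complex.norm_real, Complex.norm_real,
            Real.norm_of_nonneg ht, Real.norm_of_nonneg hδ.le]
          have h3 := hbound δ hδ.le le_rfl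
          rw [← mul_div_assoc, div_le_one hδ]
          nlinarith [norm_nonneg (Complex.log (φ δ))]
        linarith) ht htδ
    rw [← sub_eq_zero.1 h, Complex.exp_log (hne t ht htδ)]
  refine ⟨w, fun t ht hts => ?_⟩
  obtain ⟨n, hn⟩ := exists_nat_gt (t / δ)
  have hn0 : (0 : ℝ) < n := (div_nonneg ht hδ.le).trans_lt hn
  have htn : t / n ≤ δ := by
    rw [div_le_iff₀ hn0]
    rw [div_lt_iff₀ hδ] at hn
    linarith
  have hpow : ∀ k : ℕ, k ≤ n → φ (k * (t / n)) = φ (t / n) ^ k := by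
    intro k
    induction k with
    | zero => simp [h0]
    | succ k ih =>
      intro hk
      have hk' : ((k : ℝ) + 1) ≤ n := by exact_mod_cast hk
      have hle : (k : ℝ) * (t / n) + t / n ≤ s₀ := by
        calc (k : ℝ) * (t / n) + t / n = (k + 1) * (t / n) := by ring
          _ ≤ n * (t / n) := mul_le_mul_of_nonneg_right hk' (by positivity)
          _ = t := by field_simp
          _ ≤ s₀ := hts
      rw [pow_succ, ← ih (by omega), ← hmul _ _ (by positivity) (by positivity) hle]
      congr 1
      push_cast
      ring
  have h := hpow n le_rfl
  have hnC : (n : ℂ) ≠ 0 := by exact_mod_cast hn0.ne'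
  rw [mul_div_cancel₀ _ hn0.ne', hlin _ (by positivity) htn, ← Complex.exp_nat_mul] at h
  rw [h]
  congr 1
  push_cast
  field_simp

/-- A measurable multiplicative function without zeros on `[0, s₀]` tends to `1` at `0`: up to a
nonzero constant it is a difference of values of its primitive, which is continuous. -/
lemma tendsto_one_of_multiplicative_of_measurable {φ : ℝ → ℂ} {s₀ : ℝ} (hs₀ : 0 < s₀)
    (hmeas : Measurable φ) (hbdd : ∀ t, ‖φ t‖ ≤ 1)
    (hmul : ∀ s t, 0 ≤ s → 0 ≤ t → s + t ≤ s₀ → φ (s + t) = φ s * φ t)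
    (hne : ∀ t, 0 ≤ t → t ≤ s₀ → φ t ≠ 0) :
    Tendsto φ (𝓝[>] 0) (𝓝 1) := by
  have hint : ∀ a b, IntervalIntegrable φ volume a b := fun a b =>
    (intervalIntegrable_const (c := (1 : ℝ))).mono_fun hmeas.aestronglyMeasurable
      (Eventually.of_forall fun t => by simpa using hbdd t)
  -- If all primitives vanished, then so would `φ`, at almost every point of `(0, s₀)`.
  obtain ⟨a, ha0, has, hane⟩ : ∃ a, 0 < a ∧ a < s₀ ∧ ∫ s in (0 : ℝ)..a, φ s ≠ 0 := by
    by_contra hcon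
    push Not at hcon
    have hder := (hint 0 s₀).ae_hasDerivAt_integral
    have hpos : volume (Ioo 0 s₀) ≠ 0 := by simp [hs₀]
    obtain ⟨x, hx, hxd⟩ : ∃ x ∈ Ioo 0 s₀,
        HasDerivAt (fun x => ∫ t in (0 : ℝ)..x, φ t) (φ x) x := by
      by_contra hno
      push Not at hno
      refine hpos (measure_mono_null (fun x hx => ?_) (ae_iff.1 hder))
      simp only [mem_ofPred_eq]
      intro h
      refine hno x hx (h ?_ 0 left_mem_uIcc)
      rw [uIcc_of_le hs₀.le]
      exact Ioo_subset_Icc_self hx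
    have hzero : HasDerivAt (fun x => ∫ t in (0 : ℝ)..x, φ t) 0 x := by
      refine (hasDerivAt_const x (0 : ℂ)).congr_of_eventuallyEq ?_
      filter_upwards [Ioo_mem_nhds hx.1 hx.2] with y hy using hcon y hy.1 hy.2
    exact hne x hx.1.le hx.2.le (hxd.unique hzero)
  have hcont : Continuous fun x => ∫ t in (0 : ℝ)..x, φ t :=
    intervalIntegral.continuous_primitive hint 0
  have hlim : Tendsto (fun t => ((∫ s in (0 : ℝ)..(t + a), φ s) - ∫ s in (0 : ℝ)..t, φ s) /
      ∫ s in (0 : ℝ)..a, φ s) (𝓝[>] 0) (𝓝 1) := by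
    have h : Continuous fun t => ((∫ s in (0 : ℝ)..(t + a), φ s) - ∫ s in (0 : ℝ)..t, φ s) /
      ∫ s in (0 : ℝ)..a, φ s :=
      ((hcont.comp (continuous_id.add continuous_const)).sub hcont).div_const _
    have h1 := (h.tendsto 0).mono_left (nhdsWithin_le_nhds (s := Ioi (0 : ℝ)))
    simpa [div_self hane] using h1
  refine hlim.congr' ?_
  filter_upwards [Ioo_mem_nhdsGT (sub_pos.2 has)] with t ht
  rw [div_eq_iff hane, intervalIntegral.integral_interval_sub_left (hint _ _) (hint _ _),
    ← intervalIntegral.integral_const_mul]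
  have h := intervalIntegral.integral_comp_add_left (a := 0) (b := a) (fun s => φ s) t
  rw [add_zero] at h
  rw [← h]
  refine intervalIntegral.integral_congr fun s hs => ?_
  rw [uIcc_of_le ha0.le] at hs
  exact hmul t s ht.1.le hs.1 (by linarith [hs.2, ht.2])

/-! ### Characteristic functions close to one -/

/-- An integrated form of `1 - cos (2 θ) ≤ 4 (1 - cos θ)`. -/
lemma one_sub_re_charFun_two_mul_le (μ : Measure ℝ) [IsProbabilityMeasure μ] (z : ℝ) :
    1 - (charFun μ (2 * z)).re ≤ 4 * (1 - (charFun μ z).re) := by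
  have hre : ∀ z, 1 - (charFun μ z).re = ∫ x, (1 - Real.cos (z * x)) ∂μ := by
    intro z
    have hi : Integrable (fun x : ℝ => Complex.exp (z * x * Complex.I)) μ := by
      refine (integrable_const (1 : ℝ)).mono' (by fun_prop) (Eventually.of_forall fun x => ?_)
      rw [← Complex.ofReal_mul, Complex.norm_exp_ofReal_mul_I]
    have hc : Integrable (fun x : ℝ => Real.cos (z * x)) μ :=
      (integrable_const (1 : ℝ)).mono' (by fun_prop)
        (Eventually.of_forall fun x => Real.abs_cos_le_one _)
    rw [integral_sub (integrable_const _) hc, charFun_apply_real]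
    have h := integral_re (𝕜 := ℂ) hi
    simp only [RCLike.re_to_complex] at h
    rw [← h]
    simp only [integral_const, probReal_univ, smul_eq_mul, mul_one]
    congr 2
    ext x
    rw [← Complex.ofReal_mul, Complex.exp_ofReal_mul_I_re]
  have hci : ∀ z : ℝ, Integrable (fun x : ℝ => 1 - Real.cos (z * x)) μ := fun z =>
    (integrable_const (1 : ℝ)).sub ((integrable_const (1 : ℝ)).mono' (by fun_prop)
        (Eventually.of_forall fun x => Real.abs_cos_le_one _))
  rw [hre, hre, ← integral_const_mul]
  refine integral_mono (hci _) ((hci _).const_mul _) fun x => ?_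
  simp only
  rw [mul_assoc, Real.cos_two_mul]
  nlinarith [Real.cos_le_one (z * x), Real.neg_one_le_cos (z * x)]

lemma tendsto_one_of_re_tendsto_one {ι : Type*} {l : Filter ι} {f : ι → ℂ} (hf : ∀ i, ‖f i‖ ≤ 1)
    (h : Tendsto (fun i => (f i).re) l (𝓝 1)) : Tendsto f l (𝓝 1) := by
  rw [tendsto_iff_norm_sub_tendsto_zero]
  have h2 : Tendsto (fun i => Real.sqrt (2 * (1 - (f i).re))) l (𝓝 0) := by
    have h3 := ((h.const_sub 1).const_mul 2).sqrt
    simpa using h3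
  refine squeeze_zero (fun _ => norm_nonneg _) (fun i => Real.le_sqrt_of_sq_le ?_) h2
  have h1 : (f i).re ^ 2 + (f i).im ^ 2 ≤ 1 := by
    have := hf i
    rw [← abs_of_nonneg (norm_nonneg (f i)), ← sq_le_one_iff_abs_le_one, Complex.sq_norm,
      Complex.normSq_apply] at this
    nlinarith
  rw [Complex.sq_norm, Complex.normSq_apply]
  simp only [Complex.sub_re, Complex.one_re, Complex.sub_im, Complex.one_im]
  nlinarith

/-- Convergence of characteristic functions to `1` near the origin implies convergence everywhere,
since `1 - re φ (2 z) ≤ 4 (1 - re φ z)` doubles the neighbourhood. -/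
lemma tendsto_charFun_one_of_near_zero {ι : Type*} {l : Filter ι} {μ : ι → Measure ℝ}
    [∀ i, IsProbabilityMeasure (μ i)] {r : ℝ} (hr : 0 < r)
    (h : ∀ z, |z| < r → Tendsto (fun i => charFun (μ i) z) l (𝓝 1)) (z : ℝ) :
    Tendsto (fun i => charFun (μ i) z) l (𝓝 1) := by
  have key : ∀ n : ℕ, ∀ z, |z| < 2 ^ n * r → Tendsto (fun i => charFun (μ i) z) l (𝓝 1) := by
    intro n
    induction n with
    | zero => simpa using h
    | succ n ih =>
      intro z hz
      have hz2 : |z / 2| < 2 ^ n * r := by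
        rw [abs_div, abs_two, div_lt_iff₀ two_pos]
        rw [pow_succ] at hz
        linarith
      have h1 := ih _ hz2
      refine tendsto_one_of_re_tendsto_one (fun i => norm_charFun_le_one _) ?_
      have h2 : Tendsto (fun i => 1 - 4 * (1 - (charFun (μ i) (z / 2)).re)) l (𝓝 1) := by
        have h3 := ((((Complex.continuous_re.tendsto _).comp h1).const_sub 1).const_mul 4).const_sub 1
        simpa using h3
      refine tendsto_of_tendsto_of_tendsto_of_le_of_le h2 tendsto_const_nhds (fun i => ?_)
        (fun i => (Complex.re_le_norm _).trans (norm_charFun_le_one _))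
      have := one_sub_re_charFun_two_mul_le (μ i) (z / 2)
      rw [mul_div_cancel₀ _ (two_ne_zero)] at this
      simp only
      linarith
  obtain ⟨n, hn⟩ := pow_unbounded_of_one_lt (|z| / r) (one_lt_two)
  exact key n z (by rwa [div_lt_iff₀ hr] at hn)

/-- Variables whose characteristic functions tend to `1` tend to `0` in probability: the tails of a
law are bounded by an integral of `1 - φ` around the origin. -/
lemma tendstoInMeasure_zero_of_charFun {Ω : Type*} [MeasurableSpace Ω] {P : Measure Ω}
    [IsProbabilityMeasure P] {Y : ℕ → Ω → ℝ} (hY : ∀ n, Measurable (Y n))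
    (h : ∀ z, Tendsto (fun n => charFun (P.map (Y n)) z) atTop (𝓝 1)) :
    TendstoInMeasure P Y atTop 0 := by
  rw [tendstoInMeasure_iff_measureReal_norm]
  intro ε hε
  have hprob : ∀ n, IsProbabilityMeasure (P.map (Y n)) := fun n =>
    Measure.isProbabilityMeasure_map (hY n).aemeasurable
  have hlim : Tendsto (fun n => 2⁻¹ * (ε / 2) *
      ‖∫ t in (-2 * (ε / 2)⁻¹)..(2 * (ε / 2)⁻¹), 1 - charFun (P.map (Y n)) t‖) atTop (𝓝 0) := by
    have h1 : Tendsto (fun n => ∫ t in (-2 * (ε / 2)⁻¹)..(2 * (ε / 2)⁻¹),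
        1 - charFun (P.map (Y n)) t) atTop
        (𝓝 (∫ _ in (-2 * (ε / 2)⁻¹)..(2 * (ε / 2)⁻¹), (0 : ℂ))) := by
      refine intervalIntegral.tendsto_integral_filter_of_dominated_convergence (fun _ => 2)
        (Eventually.of_forall fun n => ?_) (Eventually.of_forall fun n =>
          Eventually.of_forall fun t _ => norm_one_sub_charFun_le_two)
        intervalIntegrable_const (Eventually.of_forall fun t _ => ?_)
      · exact (measurable_const.sub measurable_charFun).aestronglyMeasurable
      · simpa using (h t).const_sub 1
    have h2 := (h1.norm).const_mul (2⁻¹ * (ε / 2))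
    simpa using h2
  refine squeeze_zero (fun _ => measureReal_nonneg) (fun n => ?_) hlim
  refine le_trans ?_ (measureReal_abs_gt_le_integral_charFun (μ := P.map (Y n)) (half_pos hε))
  rw [map_measureReal_apply (hY n) (measurableSet_lt measurable_const (by fun_prop))]
  refine measureReal_mono (fun ω hω => ?_)
  simp only [mem_ofPred_eq, Pi.zero_apply, sub_zero, Real.norm_eq_abs] at hω
  simp only [mem_preimage, mem_ofPred_eq]
  linarith

end SetIndexed

namespace SetIndexed

/-! ### Inclusion-exclusion and the linear extension of a set-indexed process -/

section LinearExtension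

variable {T : Type u} {Ω : Type v}

/-- The linear relation spanned by the pairs `(1_U, X_U)`, `U ∈ A`. A pair `(f, Y)` belongs to it
if `Y` is a linear combination of values of `X` and `f` is the same linear combination of
indicator functions; for processes with definite increments it is the graph, up to null events, of
the linear extension of `X` to simple functions. -/
def incrGraph (A : Set (Set T)) (X : Set T → Ω → ℝ) : Submodule ℝ ((T → ℝ) × (Ω → ℝ)) :=
  Submodule.span ℝ ((fun U => (U.indicator 1, X U)) '' A)

variable {A : Set (Set T)} {X : Set T → Ω → ℝ}

lemma mem_incrGraph {U : Set T} (hU : U ∈ A) : (U.indicator 1, X U) ∈ incrGraph A X :=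
  Submodule.subset_span ⟨U, hU, rfl⟩

lemma biInter_mem (hinter : ∀ S ∈ A, ∀ R ∈ A, S ∩ R ∈ A) {ι : Type*} {U : ι → Set T}
    (hU : ∀ i, U i ∈ A) {s : Finset ι} (hs : s.Nonempty) : (⋂ i ∈ s, U i) ∈ A := by
  classical
  induction hs using Finset.Nonempty.cons_induction with
  | singleton a => simpa using hU a
  | cons a s ha hs ih =>
    rw [Finset.cons_eq_insert, Finset.set_biInter_insert]
    exact hinter _ (hU a) _ ih

lemma inter_biInter_mem (hinter : ∀ S ∈ A, ∀ R ∈ A, S ∩ R ∈ A) {ι : Type*} {U : ι → Set T}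
    {U₀ : Set T} (hU₀ : U₀ ∈ A) (hU : ∀ i, U i ∈ A) (s : Finset ι) : U₀ ∩ (⋂ i ∈ s, U i) ∈ A := by
  rcases s.eq_empty_or_nonempty with rfl | hs
  · simpa using hU₀
  · exact hinter _ hU₀ _ (biInter_mem hinter hU hs)

lemma neg_one_pow_card_sub_one {ι : Type*} {s : Finset ι} (hs : s.Nonempty) :
    (-1 : ℝ) ^ (s.card - 1) = -(-1) ^ s.card := by
  obtain ⟨k, hk⟩ := Nat.exists_eq_succ_of_ne_zero hs.card_pos.ne'
  rw [hk, Nat.succ_sub_one, pow_succ]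
  ring

lemma increment_eq_sum {n : ℕ} (U₀ : Set T) (U : Fin n → Set T) :
    increment X U₀ U = ∑ s : Finset (Fin n), (-1 : ℝ) ^ s.card • X (U₀ ∩ ⋂ i ∈ s, U i) := by
  ext ω
  rw [increment, Finset.sum_apply,
    ← Finset.sum_filter_add_sum_filter_not Finset.univ (fun s : Finset (Fin n) => s.Nonempty)]
  have h1 : (Finset.univ.filter fun s : Finset (Fin n) => ¬ s.Nonempty) = {∅} := by
    ext s
    simp [Finset.not_nonempty_iff_eq_empty]
  rw [h1, Finset.sum_singleton, add_comm, sub_eq_add_neg, ← Finset.sum_neg_distrib]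
  congr 1
  · simp
  · refine Finset.sum_congr rfl fun s hs => ?_
    rw [neg_one_pow_card_sub_one (Finset.mem_filter.1 hs).2]
    simp

lemma indicator_biInter {ι : Type*} (U : ι → Set T) (s : Finset ι) (t : T) :
    (⋂ i ∈ s, U i).indicator (1 : T → ℝ) t = ∏ i ∈ s, (U i).indicator 1 t := by
  classical
  induction s using Finset.induction_on with
  | empty => simp
  | insert a s ha ih =>
    rw [Finset.set_biInter_insert, Finset.prod_insert ha, ← ih, Set.inter_indicator_one]
    rfl

lemma one_sub_indicator_iUnion {ι : Type*} [Fintype ι] (U : ι → Set T) (t : T) :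
    1 - (⋃ i, U i).indicator (1 : T → ℝ) t = ∏ i, (1 - (U i).indicator 1 t) := by
  classical
  by_cases h : ∃ i, t ∈ U i
  · obtain ⟨i, hi⟩ := h
    rw [Finset.prod_eq_zero (Finset.mem_univ i) (by simp [hi]),
      Set.indicator_of_mem (mem_iUnion.2 ⟨i, hi⟩)]
    simp
  · push Not at h
    rw [Set.indicator_of_notMem (by simpa using h)]
    simp [h]

lemma sum_neg_one_pow_card_smul_indicator {ι : Type*} [Fintype ι] [DecidableEq ι] (U : ι → Set T)
    (t : T) : ∑ s : Finset ι, (-1 : ℝ) ^ s.card * (⋂ i ∈ s, U i).indicator (1 : T → ℝ) t =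
      1 - (⋃ i, U i).indicator (1 : T → ℝ) t := by
  rw [one_sub_indicator_iUnion]
  simp only [sub_eq_add_neg]
  rw [Finset.prod_one_add, Finset.powerset_univ]
  exact Finset.sum_congr rfl fun s _ => by rw [indicator_biInter, Finset.prod_neg]

lemma increment_mem (hinter : ∀ S ∈ A, ∀ R ∈ A, S ∩ R ∈ A) {n : ℕ} {U₀ : Set T}
    {U : Fin n → Set T} (hU₀ : U₀ ∈ A) (hU : ∀ i, U i ∈ A) :
    ((U₀ \ ⋃ i, U i).indicator 1, increment X U₀ U) ∈ incrGraph A X := by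
  have h : ((U₀ \ ⋃ i, U i).indicator 1, increment X U₀ U) =
      ∑ s : Finset (Fin n), (-1 : ℝ) ^ s.card •
        (((U₀ ∩ ⋂ i ∈ s, U i).indicator 1, X (U₀ ∩ ⋂ i ∈ s, U i)) : (T → ℝ) × (Ω → ℝ)) := by
    refine Prod.ext ?_ ?_
    · simp only [Prod.fst_sum, Prod.smul_fst]
      ext t
      simp only [Finset.sum_apply, Pi.smul_apply, Set.inter_indicator_one, Pi.mul_apply,
        smul_eq_mul]
      have h2 := sum_neg_one_pow_card_smul_indicator U t
      rw [← Finset.sum_congr rfl fun s _ => mul_left_comm _ _ _, ← Finset.mul_sum, h2]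
      by_cases h0 : t ∈ U₀ <;> by_cases h1 : t ∈ ⋃ i, U i <;> simp [Set.indicator, h0, h1]
    · simp only [Prod.snd_sum, Prod.smul_snd]
      exact increment_eq_sum U₀ U
  rw [h]
  exact Submodule.sum_mem _ fun s _ =>
    Submodule.smul_mem _ _ (mem_incrGraph (inter_biInter_mem hinter hU₀ hU s))

lemma unionIncrement_mem (hinter : ∀ S ∈ A, ∀ R ∈ A, S ∩ R ∈ A) {n : ℕ} {U : Fin n → Set T}
    (hU : ∀ i, U i ∈ A) :
    ((⋃ i, U i).indicator 1, unionIncrement X U) ∈ incrGraph A X := by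
  have h : ((⋃ i, U i).indicator 1, unionIncrement X U) =
      ∑ s : Finset (Fin n) with s.Nonempty, (-1 : ℝ) ^ (s.card - 1) •
        (((⋂ i ∈ s, U i).indicator 1, X (⋂ i ∈ s, U i)) : (T → ℝ) × (Ω → ℝ)) := by
    refine Prod.ext ?_ ?_
    · simp only [Prod.fst_sum, Prod.smul_fst]
      ext t
      simp only [Finset.sum_apply, Pi.smul_apply, smul_eq_mul]
      have h2 := sum_neg_one_pow_card_smul_indicator U t
      rw [← Finset.sum_filter_add_sum_filter_not Finset.univ
        (fun s : Finset (Fin n) => s.Nonempty)] at h2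
      have h1 : (Finset.univ.filter fun s : Finset (Fin n) => ¬ s.Nonempty) = {∅} := by
        ext s
        simp [Finset.not_nonempty_iff_eq_empty]
      rw [h1, Finset.sum_singleton] at h2
      simp only [Finset.card_empty, pow_zero, Finset.notMem_empty, iInter_of_empty, iInter_univ,
        Set.indicator_univ, Pi.one_apply, mul_one] at h2
      rw [Finset.sum_congr rfl fun s hs => by
        rw [neg_one_pow_card_sub_one (Finset.mem_filter.1 hs).2, neg_mul],
        Finset.sum_neg_distrib]
      linarith
    · simp only [Prod.snd_sum, Prod.smul_snd]
      ext ω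
      simp [unionIncrement]
  rw [h]
  exact Submodule.sum_mem _ fun s hs =>
    Submodule.smul_mem _ _ (mem_incrGraph (biInter_mem hinter hU (Finset.mem_filter.1 hs).2))

lemma measurable_of_mem_incrGraph [MeasurableSpace Ω] (hX : ∀ U ∈ A, Measurable (X U))
    {f : T → ℝ} {Y : Ω → ℝ} (h : (f, Y) ∈ incrGraph A X) : Measurable Y := by
  have key : ∀ p ∈ incrGraph A X, Measurable p.2 := by
    intro p hp
    induction hp using Submodule.span_induction with
    | mem x hx => obtain ⟨U, hU, rfl⟩ := hx; exact hX U hU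
    | zero => exact measurable_zero
    | add x y _ _ hx hy => exact hx.add hy
    | smul a x _ hx => exact hx.const_smul a
  exact key _ h

lemma exists_sum_of_mem_incrGraph {f : T → ℝ} {Y : Ω → ℝ} (h : (f, Y) ∈ incrGraph A X) :
    ∃ (n : ℕ) (W : Fin n → Set T) (c : Fin n → ℝ), (∀ i, W i ∈ A) ∧
      f = ∑ i, c i • (W i).indicator 1 ∧ Y = ∑ i, c i • X (W i) := by
  rw [incrGraph, Submodule.mem_span_set'] at h
  obtain ⟨n, c, g, hg⟩ := h
  choose W hWA hW using fun i => (g i).2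
  refine ⟨n, W, c, hWA, ?_, ?_⟩
  · have := congrArg Prod.fst hg
    simp only [Prod.fst_sum, Prod.smul_fst] at this
    rw [← this]
    exact Finset.sum_congr rfl fun i _ => by rw [← hW i]
  · have := congrArg Prod.snd hg
    simp only [Prod.snd_sum, Prod.smul_snd] at this
    rw [← this]
    exact Finset.sum_congr rfl fun i _ => by rw [← hW i]

/-- Finitely many elements of the graph are linear combinations of a common finite family. -/
lemma exists_family_of_mem_incrGraph {κ : Type*} [Fintype κ] {f : κ → T → ℝ} {Y : κ → Ω → ℝ}
    (h : ∀ k, (f k, Y k) ∈ incrGraph A X) :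
    ∃ (ι : Type) (_ : Fintype ι) (W : ι → Set T) (c : κ → ι → ℝ), (∀ i, W i ∈ A) ∧
      ∀ k, f k = ∑ i, c k i • (W i).indicator 1 ∧ Y k = ∑ i, c k i • X (W i) := by
  classical
  choose n W c hW hf hY using fun k => exists_sum_of_mem_incrGraph (h k)
  let e := Fintype.equivFin κ
  refine ⟨Σ j : Fin (Fintype.card κ), Fin (n (e.symm j)), inferInstance,
    fun p => W (e.symm p.1) p.2, fun k p => if p.1 = e k then c _ p.2 else 0,
    fun p => hW _ _, fun k => ?_⟩
  obtain ⟨j, rfl⟩ := e.symm.surjective k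
  refine ⟨?_, ?_⟩
  · rw [hf (e.symm j), Fintype.sum_sigma, Finset.sum_eq_single j]
    · simp
    · intro i _ hi
      simp [hi]
    · simp
  · rw [hY (e.symm j), Fintype.sum_sigma, Finset.sum_eq_single j]
    · simp
    · intro i _ hi
      simp [hi]
    · simp

end LinearExtension

end SetIndexed

namespace SetIndexed

/-! ### Atoms of a finite family of sets -/

section Atoms

variable {T : Type u} {Ω : Type v} {ι : Type*}

/-- The atom with label `s` of the finite family `W`: the points which lie in `W i` exactly when
`i ∈ s`. -/
def atom (W : ι → Set T) (s : Finset ι) : Set T := {t | ∀ i, t ∈ W i ↔ i ∈ s}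

/-- The labels of the nonempty atoms contained in the union of the family. -/
abbrev AtomIdx (W : ι → Set T) : Type _ := {s : Finset ι // s.Nonempty ∧ (atom W s).Nonempty}

/-- A point of the atom with label `s`. -/
def pt {W : ι → Set T} (s : AtomIdx W) : T := s.2.2.some

lemma pt_mem {W : ι → Set T} (s : AtomIdx W) : pt s ∈ atom W s := s.2.2.some_mem

variable [Fintype ι]

/-- The label of the atom containing `t`. -/
def label (W : ι → Set T) (t : T) : Finset ι := by
  classical exact Finset.univ.filter fun i => t ∈ W i

lemma mem_label {W : ι → Set T} {t : T} {i : ι} : i ∈ label W t ↔ t ∈ W i := by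
  simp [label]

lemma mem_atom_iff {W : ι → Set T} {s : Finset ι} {t : T} : t ∈ atom W s ↔ label W t = s := by
  simp only [atom, Finset.ext_iff, mem_label]
  rfl

lemma mem_biInter_iff {W : ι → Set T} {s : Finset ι} {t : T} :
    t ∈ ⋂ i ∈ s, W i ↔ s ⊆ label W t := by
  simp only [mem_iInter, Finset.subset_iff, mem_label]

instance (W : ι → Set T) : Fintype (AtomIdx W) := by classical exact Fintype.ofFinite _

lemma label_pt {W : ι → Set T} (s : AtomIdx W) : label W (pt s) = s := mem_atom_iff.1 (pt_mem s)

/-- The atom of a point of the union of the family. -/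
def atomOf (W : ι → Set T) (t : T) (h : (label W t).Nonempty) : AtomIdx W :=
  ⟨label W t, h, t, mem_atom_iff.2 rfl⟩

lemma sum_smul_indicator_apply (W : ι → Set T) (c : ι → ℝ) (t : T) :
    (∑ i, c i • (W i).indicator (1 : T → ℝ)) t = ∑ i ∈ label W t, c i := by
  rw [Finset.sum_apply, label, Finset.sum_filter]
  refine Finset.sum_congr rfl fun i _ => ?_
  by_cases h : t ∈ W i <;> simp [h]

variable [DecidableEq ι]

/-- The indices outside the label `s`, enumerated. -/
def outside (s : Finset ι) (j : Fin sᶜ.card) : ι := sᶜ.equivFin.symm j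

lemma outside_injective (s : Finset ι) : Function.Injective (outside s) := fun i j h => by
  simpa [outside] using h

lemma exists_outside_eq {s : Finset ι} {i : ι} (hi : i ∉ s) : ∃ j, outside s j = i :=
  ⟨sᶜ.equivFin ⟨i, by simpa using hi⟩, by simp [outside]⟩

lemma outside_notMem (s : Finset ι) (j : Fin sᶜ.card) : outside s j ∉ s :=
  Finset.mem_compl.1 (sᶜ.equivFin.symm j).2

lemma atom_eq_diff (W : ι → Set T) (s : Finset ι) :
    (⋂ i ∈ s, W i) \ ⋃ j, W (outside s j) = atom W s := by
  ext t
  simp only [Set.mem_sdiff, mem_iInter, mem_iUnion, not_exists, atom]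
  constructor
  · rintro ⟨h1, h2⟩ i
    refine ⟨fun hi => ?_, h1 i⟩
    by_contra hs
    obtain ⟨j, rfl⟩ := exists_outside_eq hs
    exact h2 j hi
  · intro h
    exact ⟨fun i hi => (h i).2 hi, fun j hj => outside_notMem s j ((h _).1 hj)⟩

/-- The increment of `X` over the atom with label `s`. -/
def atomIncr (X : Set T → Ω → ℝ) (W : ι → Set T) (s : Finset ι) : Ω → ℝ :=
  increment X (⋂ i ∈ s, W i) fun j => W (outside s j)

variable {X : Set T → Ω → ℝ}

lemma atomIncr_eq_sum (W : ι → Set T) (s : Finset ι) :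
    atomIncr X W s =
      ∑ r : Finset ι with s ⊆ r, (-1 : ℝ) ^ (r \ s).card • X (⋂ i ∈ r, W i) := by
  rw [atomIncr, increment_eq_sum]
  let e : Fin sᶜ.card ↪ ι := ⟨outside s, outside_injective s⟩
  have hdisj : ∀ p : Finset (Fin sᶜ.card), (s ∪ p.map e) \ s = p.map e := by
    intro p
    rw [Finset.union_sdiff_left, Finset.sdiff_eq_self_iff_disjoint, Finset.disjoint_left]
    rintro _ hi
    obtain ⟨j, -, rfl⟩ := Finset.mem_map.1 hi
    exact outside_notMem s j
  refine Finset.sum_bij' (fun p _ => s ∪ p.map e)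
    (fun r _ => Finset.univ.filter fun j => outside s j ∈ r) ?_ ?_ ?_ ?_ ?_
  · intro p _
    simp
  · intro r _
    simp
  · intro p _
    ext j
    simp only [Finset.mem_union, Finset.mem_filter, Finset.mem_univ, true_and, Finset.mem_map]
    constructor
    · rintro (h | ⟨i, hi, hij⟩)
      · exact absurd h (outside_notMem s j)
      · exact outside_injective s hij ▸ hi
    · exact fun h => Or.inr ⟨j, h, rfl⟩
  · intro r hr
    ext i
    simp only [Finset.mem_union, Finset.mem_filter, Finset.mem_univ, true_and, Finset.mem_map]
    constructor
    · rintro (h | ⟨j, hj, rfl⟩)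
      · exact (Finset.mem_filter.1 hr).2 h
      · exact hj
    · intro h
      by_cases hs : i ∈ s
      · exact Or.inl hs
      · obtain ⟨j, rfl⟩ := exists_outside_eq hs
        exact Or.inr ⟨j, h, rfl⟩
  · intro p _
    rw [hdisj, Finset.card_map]
    congr 2
    ext t
    simp only [mem_inter_iff, mem_iInter, Finset.mem_union, Finset.mem_map]
    constructor
    · rintro ⟨h1, h2⟩ i (hi | ⟨j, hj, rfl⟩)
      · exact h1 i hi
      · exact h2 j hj
    · intro h
      exact ⟨fun i hi => h i (Or.inl hi), fun j hj => h _ (Or.inr ⟨j, hj, rfl⟩)⟩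

lemma sum_neg_one_pow_card_sdiff (i : ι) (r : Finset ι) :
    ∑ s : Finset ι with i ∈ s ∧ s ⊆ r, (-1 : ℝ) ^ (r \ s).card = if r = {i} then 1 else 0 := by
  by_cases hi : i ∈ r
  · have h : ∑ s : Finset ι with i ∈ s ∧ s ⊆ r, (-1 : ℝ) ^ (r \ s).card =
        ∑ q ∈ (r.erase i).powerset, (-1 : ℝ) ^ q.card := by
      refine Finset.sum_bij' (fun s _ => r \ s) (fun q _ => r \ q) ?_ ?_ ?_ ?_ ?_
      · intro s hs
        simp only [Finset.mem_filter, Finset.mem_univ, true_and] at hs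
        rw [Finset.mem_powerset]
        intro j hj
        rw [Finset.mem_sdiff] at hj
        exact Finset.mem_erase.2 ⟨fun h => hj.2 (h ▸ hs.1), hj.1⟩
      · intro q hq
        rw [Finset.mem_powerset] at hq
        simp only [Finset.mem_filter, Finset.mem_univ, true_and, Finset.mem_sdiff]
        exact ⟨⟨hi, fun h => (Finset.mem_erase.1 (hq h)).1 rfl⟩, Finset.sdiff_subset⟩
      · intro s hs
        simp only [Finset.mem_filter, Finset.mem_univ, true_and] at hs
        exact Finset.sdiff_sdiff_eq_self hs.2
      · intro q hq
        exact Finset.sdiff_sdiff_eq_self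
          ((Finset.mem_powerset.1 hq).trans (Finset.erase_subset _ _))
      · intro s _
        rfl
    rw [h]
    have h2 := Finset.sum_powerset_neg_one_pow_card (x := r.erase i)
    have h3 : ∑ q ∈ (r.erase i).powerset, (-1 : ℝ) ^ q.card =
        ((∑ q ∈ (r.erase i).powerset, (-1 : ℤ) ^ q.card : ℤ) : ℝ) := by push_cast; rfl
    rw [h3, h2]
    by_cases hr : r = {i}
    · simp [hr]
    · have : r.erase i ≠ ∅ := fun h =>
        (Finset.erase_eq_empty_iff _ _).1 h |>.elim (fun h => by simp [h] at hi) hr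
      simp [hr, this]
  · rw [if_neg (fun h => hi (by simp [h])), Finset.filter_eq_empty_iff.2]
    · simp
    · rintro s - ⟨h1, h2⟩
      exact hi (h2 h1)

/-- Möbius inversion: the value of `X` on a member of the family is the sum of the increments over
the atoms with a label containing its index, as functions on the whole probability space. -/
lemma eq_sum_atomIncr (W : ι → Set T) (i : ι) :
    X (W i) = ∑ s : Finset ι with i ∈ s, atomIncr X W s := by
  simp_rw [atomIncr_eq_sum]
  rw [Finset.sum_comm' (t' := Finset.univ)
    (s' := fun r => Finset.univ.filter fun s => i ∈ s ∧ s ⊆ r) (by simp)]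
  simp_rw [← Finset.sum_smul, sum_neg_one_pow_card_sdiff]
  simp

variable {A : Set (Set T)}

lemma atomIncr_mem (hinter : ∀ S ∈ A, ∀ R ∈ A, S ∩ R ∈ A) {W : ι → Set T} (hW : ∀ i, W i ∈ A)
    {s : Finset ι} (hs : s.Nonempty) :
    ((atom W s).indicator 1, atomIncr X W s) ∈ incrGraph A X := by
  rw [← atom_eq_diff]
  exact increment_mem hinter (biInter_mem hinter hW hs) fun j => hW _

lemma sum_smul_eq_sum_atomIncr (W : ι → Set T) (c : ι → ℝ) :
    ∑ i, c i • X (W i) =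
      ∑ s : Finset ι with s.Nonempty, (∑ i ∈ s, c i) • atomIncr X W s := by
  simp_rw [Finset.sum_smul]
  rw [Finset.sum_comm' (t' := Finset.univ) (s' := fun i => Finset.univ.filter fun s => i ∈ s)]
  · refine Finset.sum_congr rfl fun i _ => ?_
    rw [← Finset.smul_sum, ← eq_sum_atomIncr]
  · intro s i
    simp only [Finset.mem_filter, Finset.mem_univ, true_and, and_true, and_iff_right_iff_imp]
    exact fun h => ⟨i, h⟩

variable [MeasurableSpace Ω] {P : Measure Ω}

lemma HasDefiniteIncrements.increment_ae_eq_zero (hX : HasDefiniteIncrements A P X)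
    (hempty : ∅ ∈ A) {n : ℕ} {U₀ : Set T} {U : Fin n → Set T} (hU₀ : U₀ ∈ A) (hU : ∀ i, U i ∈ A)
    (h : U₀ \ (⋃ i, U i) = ∅) : increment X U₀ U =ᵐ[P] 0 := by
  have h1 := hX.2 n 0 U₀ ∅ U Fin.elim0 hU₀ hempty hU (fun i => i.elim0) (by rw [h]; simp)
  refine h1.trans (EventuallyEq.trans ?_ hX.1)
  refine Eventually.of_forall fun ω => ?_
  rw [increment, Finset.sum_eq_zero, sub_zero]
  intro s hs
  have := (Finset.mem_filter.1 hs).2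
  rw [Finset.eq_empty_of_isEmpty s] at this
  simp at this

/-- Decomposition of a linear combination of values of `X` into increments over nonempty atoms. -/
lemma sum_smul_ae_eq_sum_atomIncr (hX : HasDefiniteIncrements A P X)
    (hinter : ∀ S ∈ A, ∀ R ∈ A, S ∩ R ∈ A) (hempty : ∅ ∈ A) {W : ι → Set T} (hW : ∀ i, W i ∈ A)
    (c : ι → ℝ) :
    ∑ i, c i • X (W i) =ᵐ[P] ∑ s : AtomIdx W,
      ((∑ i, c i • (W i).indicator (1 : T → ℝ)) (pt s)) • atomIncr X W s := by
  classical
  have hzero : ∀ s : Finset ι, s.Nonempty → ¬ (atom W s).Nonempty → atomIncr X W s =ᵐ[P] 0 := by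
    intro s hs h
    refine hX.increment_ae_eq_zero hempty (biInter_mem hinter hW hs) (fun j => hW _) ?_
    rw [atom_eq_diff, not_nonempty_iff_eq_empty.1 h]
  have hall : ∀ᵐ ω ∂P, ∀ s : Finset ι, s.Nonempty → ¬ (atom W s).Nonempty →
      atomIncr X W s ω = 0 := by
    rw [ae_all_iff]
    intro s
    by_cases h : s.Nonempty ∧ ¬ (atom W s).Nonempty
    · filter_upwards [hzero s h.1 h.2] with ω hω _ _ using hω
    · exact Eventually.of_forall fun ω h1 h2 => absurd ⟨h1, h2⟩ h
  filter_upwards [hall] with ω hω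
  rw [sum_smul_eq_sum_atomIncr, Finset.sum_apply, Finset.sum_apply,
    ← Finset.sum_filter_add_sum_filter_not _ (fun s => (atom W s).Nonempty)]
  rw [Finset.sum_eq_zero (s := Finset.filter (fun s => ¬ (atom W s).Nonempty) _), add_zero,
    Finset.filter_filter]
  · rw [Finset.sum_subtype (p := fun s : Finset ι => s.Nonempty ∧ (atom W s).Nonempty) _
      (by simp)]
    refine Finset.sum_congr rfl fun s _ => ?_
    rw [sum_smul_indicator_apply, label_pt s]
  · intro s hs
    simp only [Finset.mem_filter, Finset.mem_univ, true_and] at hs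
    simp [hω s hs.1 hs.2]

end Atoms

end SetIndexed

namespace SetIndexed

/-! ### Finite unions and multiplicative functions of their differences -/

section FinUnions

variable {T : Type u} {A : Set (Set T)}

lemma mem_finUnions_of_mem {S : Set T} (hS : S ∈ A) : S ∈ finUnions A :=
  ⟨0, fun _ => S, fun _ => hS, (iUnion_const S).symm⟩

lemma iUnion_mem_finUnions (hempty : ∅ ∈ A) {n : ℕ} {U : Fin n → Set T} (hU : ∀ i, U i ∈ A) :
    (⋃ i, U i) ∈ finUnions A := by
  cases n with
  | zero => simpa using mem_finUnions_of_mem hempty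
  | succ n => exact ⟨n, U, hU, rfl⟩

lemma union_mem_finUnions {S R : Set T} (hS : S ∈ finUnions A) (hR : R ∈ finUnions A) :
    S ∪ R ∈ finUnions A := by
  obtain ⟨n, U, hU, rfl⟩ := hS
  obtain ⟨k, V, hV, rfl⟩ := hR
  refine ⟨n + 1 + k, Fin.append (m := n + 1) (n := k + 1) U V, fun i => ?_, ?_⟩
  · refine Fin.addCases (m := n + 1) (n := k + 1) (fun j => ?_) (fun j => ?_) i
    · simpa using hU j
    · simpa using hV j
  · ext t
    simp only [mem_union, mem_iUnion]
    constructor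
    · rintro (⟨i, hi⟩ | ⟨i, hi⟩)
      · exact ⟨Fin.castAdd (k + 1) i, by simpa using hi⟩
      · exact ⟨Fin.natAdd (n + 1) i, by simpa using hi⟩
    · rintro ⟨i, hi⟩
      induction i using Fin.addCases (m := n + 1) (n := k + 1) with
      | left j => exact Or.inl ⟨j, by simpa using hi⟩
      | right j => exact Or.inr ⟨j, by simpa using hi⟩

lemma biUnion_mem_finUnions (hempty : ∅ ∈ A) {ι : Type*} (s : Finset ι) {U : ι → Set T}
    (hU : ∀ i ∈ s, U i ∈ finUnions A) : (⋃ i ∈ s, U i) ∈ finUnions A := by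
  classical
  induction s using Finset.induction_on with
  | empty => simpa using mem_finUnions_of_mem hempty
  | insert a s ha ih =>
    rw [Finset.set_biUnion_insert]
    exact union_mem_finUnions (hU _ (Finset.mem_insert_self _ _))
      (ih fun i hi => hU i (Finset.mem_insert_of_mem hi))

/-- A function of sets with values in the functions `ℝ → ℂ`, to be thought of as the characteristic
functions of the increments over the differences `V \ U` of finite unions `U ⊆ V`, which is
multiplicative along chains of finite unions. -/
structure IsChainMul (A : Set (Set T)) (κ : Set T → ℝ → ℂ) : Prop where
  empty : ∀ z, κ ∅ z = 1
  zero : ∀ C, κ C 0 = 1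
  mul : ∀ U ∈ finUnions A, ∀ V ∈ finUnions A, ∀ R ∈ finUnions A, U ⊆ V → V ⊆ R →
    ∀ z, κ (R \ U) z = κ (V \ U) z * κ (R \ V) z

variable {ι : Type*} {W : ι → Set T}

/-- The union of the atoms with labels in `S`. -/
def atomUnion (S : Finset (AtomIdx W)) : Set T := ⋃ s ∈ S, atom W s

lemma atomUnion_mono {S S' : Finset (AtomIdx W)} (h : S ⊆ S') : atomUnion S ⊆ atomUnion S' :=
  biUnion_subset_biUnion_left h

/-- A set of labels is upper if it contains, with each label, all larger ones. The corresponding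
union of atoms is then a union of intersections of members of the family. -/
def IsUpperLabels (S : Finset (AtomIdx W)) : Prop :=
  ∀ s ∈ S, ∀ s' : AtomIdx W, s.1 ⊆ s'.1 → s' ∈ S

lemma IsUpperLabels.of_insert [DecidableEq ι] {S : Finset (AtomIdx W)} {a : AtomIdx W} (ha : a ∉ S)
    (hmin : ∀ s ∈ S, s.1 ⊆ a.1 → a.1.card ≤ s.1.card) (hS : IsUpperLabels (insert a S)) :
    IsUpperLabels S := by
  intro s hs s' hss'
  rcases Finset.mem_insert.1 (hS s (Finset.mem_insert_of_mem hs) s' hss') with h | h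
  · subst h
    have : s.1 = s'.1 := Finset.eq_of_subset_of_card_le hss' (hmin s hs hss')
    exact absurd (Subtype.ext this ▸ hs) ha
  · exact h

variable [Fintype ι]

lemma mem_atomUnion {S : Finset (AtomIdx W)} {t : T} :
    t ∈ atomUnion S ↔ ∃ s ∈ S, label W t = s := by
  simp [atomUnion, mem_atom_iff]

/-- A set is saturated for the family if it is contained in the union of the family and contains,
with each point, all points lying in the same members of the family and possibly more. -/
def IsSaturated (W : ι → Set T) (V : Set T) : Prop :=
  ∀ t ∈ V, (label W t).Nonempty ∧ ∀ t', label W t ⊆ label W t' → t' ∈ V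

lemma IsSaturated.iUnion {κ : Type*} {V : κ → Set T} (hV : ∀ k, IsSaturated W (V k)) :
    IsSaturated W (⋃ k, V k) := by
  intro t ht
  obtain ⟨k, hk⟩ := mem_iUnion.1 ht
  exact ⟨(hV k t hk).1, fun t' h => mem_iUnion.2 ⟨k, (hV k t hk).2 t' h⟩⟩

lemma IsSaturated.inter {V V' : Set T} (hV : IsSaturated W V) (hV' : IsSaturated W V') :
    IsSaturated W (V ∩ V') := fun t ht =>
  ⟨(hV t ht.1).1, fun t' h => ⟨(hV t ht.1).2 t' h, (hV' t ht.2).2 t' h⟩⟩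

lemma isSaturated_biInter {κ : Type*} {V : κ → Set T} {s : Finset κ} (hs : s.Nonempty)
    (hV : ∀ k, IsSaturated W (V k)) : IsSaturated W (⋂ k ∈ s, V k) := by
  intro t ht
  rw [mem_iInter₂] at ht
  obtain ⟨k, hk⟩ := hs
  exact ⟨(hV k t (ht k hk)).1, fun t' h => mem_iInter₂.2 fun j hj => (hV j t (ht j hj)).2 t' h⟩

lemma isSaturated_apply (i : ι) : IsSaturated W (W i) := fun _ ht =>
  ⟨⟨i, mem_label.2 ht⟩, fun _ h => mem_label.1 (h (mem_label.2 ht))⟩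

open Classical in
/-- The labels of the atoms contained in a saturated set. -/
def labelsOf (W : ι → Set T) (V : Set T) : Finset (AtomIdx W) :=
  Finset.univ.filter fun s => pt s ∈ V

lemma mem_labelsOf {V : Set T} {s : AtomIdx W} : s ∈ labelsOf W V ↔ pt s ∈ V := by
  simp [labelsOf]

lemma IsUpperLabels.atomUnion_eq {S : Finset (AtomIdx W)} (hS : IsUpperLabels S) :
    atomUnion S = ⋃ s ∈ S, ⋂ i ∈ s.1, W i := by
  ext t
  rw [mem_atomUnion]
  simp only [mem_iUnion, exists_prop]
  constructor
  · rintro ⟨s, hs, hst⟩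
    exact ⟨s, hs, mem_biInter_iff.2 hst.ge⟩
  · rintro ⟨s, hs, hst⟩
    rw [mem_biInter_iff] at hst
    exact ⟨atomOf W t (s.2.1.mono hst), hS s hs _ hst, rfl⟩

lemma IsUpperLabels.atomUnion_mem (hinter : ∀ S ∈ A, ∀ R ∈ A, S ∩ R ∈ A) (hempty : ∅ ∈ A)
    (hW : ∀ i, W i ∈ A) {S : Finset (AtomIdx W)} (hS : IsUpperLabels S) :
    atomUnion S ∈ finUnions A := by
  rw [hS.atomUnion_eq]
  exact biUnion_mem_finUnions hempty S fun s _ =>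
    mem_finUnions_of_mem (biInter_mem hinter hW s.2.1)

lemma IsSaturated.isUpperLabels {V : Set T} (hV : IsSaturated W V) :
    IsUpperLabels (labelsOf W V) := by
  intro s hs s' hss'
  rw [mem_labelsOf] at hs ⊢
  exact (hV _ hs).2 _ (by rwa [label_pt, label_pt])

lemma IsSaturated.atomUnion_labelsOf {V : Set T} (hV : IsSaturated W V) :
    atomUnion (labelsOf W V) = V := by
  ext t
  simp only [mem_atomUnion, mem_labelsOf]
  constructor
  · rintro ⟨s, hs, hst⟩
    exact (hV _ hs).2 t (by rw [hst, label_pt])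
  · intro ht
    refine ⟨atomOf W t (hV t ht).1, (hV t ht).2 _ ?_, rfl⟩
    rw [label_pt, atomOf]

variable [DecidableEq ι]

lemma atomUnion_insert_diff {S : Finset (AtomIdx W)} {a : AtomIdx W} (ha : a ∉ S) :
    atomUnion (insert a S) \ atomUnion S = atom W a := by
  ext t
  rw [Set.mem_sdiff, mem_atomUnion, mem_atomUnion, mem_atom_iff]
  constructor
  · rintro ⟨⟨s, hs, hst⟩, h⟩
    rcases Finset.mem_insert.1 hs with rfl | hs
    · exact hst
    · exact absurd ⟨s, hs, hst⟩ h
  · intro h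
    refine ⟨⟨a, Finset.mem_insert_self _ _, h⟩, ?_⟩
    rintro ⟨s, hs, hst⟩
    exact ha (Subtype.ext (h.symm.trans hst) ▸ hs)

/-- A chain multiplicative function of the difference of two upper unions of atoms is the product
of its values on the atoms: the atoms are added one by one, those with large labels first. -/
lemma IsChainMul.atomUnion_diff {κ : Set T → ℝ → ℂ} (hκ : IsChainMul A κ)
    (hinter : ∀ S ∈ A, ∀ R ∈ A, S ∩ R ∈ A) (hempty : ∅ ∈ A) (hW : ∀ i, W i ∈ A)
    {S' : Finset (AtomIdx W)} (hS' : IsUpperLabels S') (R : Finset (AtomIdx W))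
    (hdisj : Disjoint S' R) (hR : IsUpperLabels (S' ∪ R)) (z : ℝ) :
    κ (atomUnion (S' ∪ R) \ atomUnion S') z = ∏ s ∈ R, κ (atom W s) z := by
  induction R using Finset.induction_on_min_value (fun s : AtomIdx W => s.1.card) with
  | empty => simp [hκ.empty]
  | insert a R ha hmin ih =>
    rw [Finset.disjoint_insert_right] at hdisj
    have ha' : a ∉ S' ∪ R := by simp [hdisj.1, ha]
    rw [Finset.union_insert] at hR ⊢
    have hup : IsUpperLabels (S' ∪ R) := by
      refine hR.of_insert ha' fun s hs hsa => ?_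
      rcases Finset.mem_union.1 hs with h | h
      · exact absurd (hS' s h a hsa) hdisj.1
      · exact hmin s h
    rw [hκ.mul _ (hS'.atomUnion_mem hinter hempty hW) _ (hup.atomUnion_mem hinter hempty hW) _
      (hR.atomUnion_mem hinter hempty hW) (atomUnion_mono Finset.subset_union_left)
      (atomUnion_mono (Finset.subset_insert _ _)), ih hdisj.2 hup, atomUnion_insert_diff ha',
      Finset.prod_insert ha, mul_comm]

/-- A chain multiplicative function of a difference of saturated sets is the product of its values
on the atoms contained in the difference. -/
lemma IsChainMul.diff_eq_prod {κ : Set T → ℝ → ℂ} (hκ : IsChainMul A κ)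
    (hinter : ∀ S ∈ A, ∀ R ∈ A, S ∩ R ∈ A) (hempty : ∅ ∈ A) (hW : ∀ i, W i ∈ A) {U V : Set T}
    (hU : IsSaturated W U) (hV : IsSaturated W V) (hUV : U ⊆ V) (z : ℝ) :
    κ (V \ U) z = ∏ s ∈ labelsOf W (V \ U), κ (atom W s) z := by
  have hsub : labelsOf W U ⊆ labelsOf W V := fun s hs => mem_labelsOf.2 (hUV (mem_labelsOf.1 hs))
  have hun : labelsOf W U ∪ labelsOf W (V \ U) = labelsOf W V := by
    ext s
    simp only [Finset.mem_union, mem_labelsOf]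
    by_cases h : pt s ∈ U
    · simp [h, hUV h]
    · simp [h]
  have hdisj : Disjoint (labelsOf W U) (labelsOf W (V \ U)) := by
    rw [Finset.disjoint_left]
    intro s hs hs'
    exact (mem_labelsOf.1 hs').2 (mem_labelsOf.1 hs)
  have h := hκ.atomUnion_diff hinter hempty hW hU.isUpperLabels _ hdisj
    (by rw [hun]; exact hV.isUpperLabels) z
  rw [hun, hV.atomUnion_labelsOf, hU.atomUnion_labelsOf] at h
  exact h

/-- The product over the atoms of a family of the values of a chain multiplicative function at the
values of a simple function does not change if the family is refined. -/
lemma IsChainMul.prod_atoms_eq {κ : Set T → ℝ → ℂ} (hκ : IsChainMul A κ)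
    (hinter : ∀ S ∈ A, ∀ R ∈ A, S ∩ R ∈ A) (hempty : ∅ ∈ A) {ι' : Type*} [Fintype ι']
    [DecidableEq ι'] {W' : ι' → Set T} (hW' : ∀ i, W' i ∈ A) (e : ι → ι')
    (he : ∀ i, W i = W' (e i)) (c : ι → ℝ) :
    ∏ s : AtomIdx W, κ (atom W s) ((∑ i, c i • (W i).indicator (1 : T → ℝ)) (pt s)) =
      ∏ s : AtomIdx W', κ (atom W' s) ((∑ i, c i • (W i).indicator (1 : T → ℝ)) (pt s)) := by
  classical
  set f : T → ℝ := ∑ i, c i • (W i).indicator (1 : T → ℝ) with hf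
  have hfl : ∀ t, f t = ∑ i ∈ label W t, c i := fun t => sum_smul_indicator_apply W c t
  have hWs : ∀ i, IsSaturated W' (W i) := fun i => he i ▸ isSaturated_apply (e i)
  have hstep : ∀ s : AtomIdx W, κ (atom W s) (f (pt s)) =
      ∏ s' : AtomIdx W', if pt s' ∈ atom W s then κ (atom W' s') (f (pt s')) else 1 := by
    intro s
    have hs := s.2.1
    set V := ⋂ i ∈ s.1, W i with hVdef
    have hVs : IsSaturated W' V := isSaturated_biInter hs hWs
    have hUs : IsSaturated W' (V ∩ ⋃ j, W (outside s.1 j)) :=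
      hVs.inter (IsSaturated.iUnion fun j => hWs _)
    have hat : atom W s = V \ (V ∩ ⋃ j, W (outside s.1 j)) := by
      rw [← atom_eq_diff, Set.sdiff_self_inter]
    rw [hat, hκ.diff_eq_prod hinter hempty hW' hUs hVs inter_subset_left, ← hat, labelsOf,
      Finset.prod_filter]
    refine Finset.prod_congr rfl fun s' _ => ?_
    split_ifs with h
    · rw [hfl (pt s), hfl (pt s'), label_pt, mem_atom_iff.1 h]
    · rfl
  rw [Finset.prod_congr rfl fun s _ => hstep s, Finset.prod_comm]
  refine Finset.prod_congr rfl fun s' _ => ?_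
  by_cases h : (label W (pt s')).Nonempty
  · rw [Finset.prod_eq_single (atomOf W (pt s') h)]
    · exact if_pos (mem_atom_iff.2 rfl)
    · intro s _ hs
      rw [if_neg]
      exact fun h' => hs (Subtype.ext (mem_atom_iff.1 h').symm)
    · simp
  · have h0 : f (pt s') = 0 := by
      rw [hfl, Finset.not_nonempty_iff_eq_empty.1 h, Finset.sum_empty]
    simp [h0, hκ.zero]

end FinUnions

end SetIndexed

namespace SetIndexed

/-! ### Joint characteristic functions of increments -/

section AtomFormula

variable {T : Type u} {Ω : Type v} [MeasurableSpace Ω] {A : Set (Set T)} {P : Measure Ω}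
  {X : Set T → Ω → ℝ} {κ : Set T → ℝ → ℂ}

/-- The characteristic functions of linear combinations of values of `X` are the products over the
atoms of the family of the values of `κ`: the increments over the atoms are independent with
characteristic functions given by `κ`. -/
def HasAtomFormula (A : Set (Set T)) (P : Measure Ω) (X : Set T → Ω → ℝ) (κ : Set T → ℝ → ℂ) :
    Prop :=
  ∀ (ι : Type) [Fintype ι] [DecidableEq ι] (W : ι → Set T), (∀ i, W i ∈ A) → ∀ c : ι → ℝ,
    charFun (P.map (∑ i, c i • X (W i))) 1 =
      ∏ s : AtomIdx W, κ (atom W s) ((∑ i, c i • (W i).indicator (1 : T → ℝ)) (pt s))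

lemma charFun_map_eq_charFun_smul {Y : Ω → ℝ} (hY : Measurable Y) (z : ℝ) :
    charFun (P.map Y) z = charFun (P.map (z • Y)) 1 := by
  have h := charFun_map_mul_comp (μ := P) hY.aemeasurable z 1
  rw [mul_one] at h
  rw [← h]
  rfl

lemma ae_eq_zero_of_charFun_eq_one [IsProbabilityMeasure P] {Y : Ω → ℝ} (hY : Measurable Y)
    (h : ∀ z, charFun (P.map Y) z = 1) : Y =ᵐ[P] 0 := by
  have hprob : IsProbabilityMeasure (P.map Y) := Measure.isProbabilityMeasure_map hY.aemeasurable
  have hd : P.map Y = Measure.dirac 0 := by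
    refine Measure.ext_of_charFun ?_
    ext z
    rw [h, charFun_dirac]
    simp
  have h2 : ∀ᵐ y ∂(P.map Y), y = 0 := by
    rw [hd, ae_dirac_eq]
    simp
  exact ae_of_ae_map hY.aemeasurable h2

lemma HasAtomFormula.ae_eq_zero [IsProbabilityMeasure P] (h : HasAtomFormula A P X κ)
    (hκ : ∀ C, κ C 0 = 1) (hX : ∀ U ∈ A, Measurable (X U)) {Y : Ω → ℝ}
    (hY : ((0 : T → ℝ), Y) ∈ incrGraph A X) : Y =ᵐ[P] 0 := by
  refine ae_eq_zero_of_charFun_eq_one (measurable_of_mem_incrGraph hX hY) fun z => ?_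
  rw [charFun_map_eq_charFun_smul (measurable_of_mem_incrGraph hX hY)]
  have hz : ((0 : T → ℝ), z • Y) ∈ incrGraph A X := by
    simpa using Submodule.smul_mem _ z hY
  obtain ⟨n, W, c, hW, h1, h2⟩ := exists_sum_of_mem_incrGraph hz
  rw [h2, h _ W hW c, ← h1]
  simp [hκ]

lemma HasAtomFormula.hasDefiniteIncrements [IsProbabilityMeasure P] (h : HasAtomFormula A P X κ)
    (hκ : ∀ C, κ C 0 = 1) (hX : ∀ U ∈ A, Measurable (X U))
    (hinter : ∀ S ∈ A, ∀ R ∈ A, S ∩ R ∈ A) (hempty : ∅ ∈ A) : HasDefiniteIncrements A P X := by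
  refine ⟨h.ae_eq_zero hκ hX ?_, fun k l U₀ V₀ U V hU₀ hV₀ hU hV heq => ?_⟩
  · have h1 := mem_incrGraph (X := X) hempty
    rwa [Set.indicator_empty'] at h1
  · have h1 := Submodule.sub_mem _ (increment_mem (X := X) hinter hU₀ hU)
      (increment_mem (X := X) hinter hV₀ hV)
    rw [heq, Prod.mk_sub_mk, sub_self] at h1
    filter_upwards [h.ae_eq_zero hκ hX h1] with ω hω
    exact sub_eq_zero.1 hω

/-- Increments over simple functions with disjoint supports are independent. -/
lemma HasAtomFormula.iIndepFun [IsProbabilityMeasure P] (h : HasAtomFormula A P X κ)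
    (hκ : ∀ C, κ C 0 = 1) (hX : ∀ U ∈ A, Measurable (X U)) {n : ℕ} {f : Fin n → T → ℝ}
    {Y : Fin n → Ω → ℝ} (hY : ∀ k, (f k, Y k) ∈ incrGraph A X)
    (hdisj : ∀ k l, k ≠ l → ∀ t, f k t ≠ 0 → f l t = 0) : iIndepFun Y P := by
  classical
  have hYm : ∀ k, Measurable (Y k) := fun k => measurable_of_mem_incrGraph hX (hY k)
  obtain ⟨ι, hι, W, c, hW, hfY⟩ := exists_family_of_mem_incrGraph hY
  have key : ∀ d : Fin n → ℝ, charFun (P.map (∑ k, d k • Y k)) 1 =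
      ∏ s : AtomIdx W, κ (atom W s) (∑ k, d k * f k (pt s)) := by
    intro d
    have h1 : ∑ k, d k • Y k = ∑ i, (∑ k, d k * c k i) • X (W i) := by
      simp_rw [fun k => (hfY k).2, Finset.smul_sum, smul_smul]
      rw [Finset.sum_comm]
      simp_rw [Finset.sum_smul]
    have h2 : ∑ i, (∑ k, d k * c k i) • (W i).indicator (1 : T → ℝ) = ∑ k, d k • f k := by
      simp_rw [fun k => (hfY k).1, Finset.smul_sum, smul_smul]
      rw [Finset.sum_comm]
      simp_rw [Finset.sum_smul]
    rw [h1, h ι W hW, h2]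
    simp
  rw [iIndepFun_iff_charFun_pi fun k => (hYm k).aemeasurable]
  intro z
  have hjoint : charFun (P.map fun ω => WithLp.toLp 2 (fun k => Y k ω)) z =
      charFun (P.map (∑ k, z k • Y k)) 1 := by
    rw [charFun_apply, charFun_apply, integral_map (by fun_prop) (by fun_prop),
      integral_map (by fun_prop) (by fun_prop)]
    congr 1
    ext ω
    simp [PiLp.inner_apply]
  have hsingle : ∀ k, charFun (P.map (Y k)) (z k) =
      ∏ s : AtomIdx W, κ (atom W s) (z k * f k (pt s)) := by
    intro k
    have h1 := key (Pi.single k (z k))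
    rw [Finset.sum_eq_single k (by intro j _ hj; simp [hj]) (by simp)] at h1
    rw [charFun_map_eq_charFun_smul (hYm k)]
    simp only [Pi.single_eq_same] at h1
    rw [h1]
    refine Finset.prod_congr rfl fun s _ => ?_
    rw [Finset.sum_eq_single k (by intro j _ hj; simp [hj]) (by simp), Pi.single_eq_same]
  rw [hjoint, key, Finset.prod_congr rfl fun k _ => hsingle k, Finset.prod_comm]
  refine Finset.prod_congr rfl fun s _ => ?_
  by_cases hs : ∃ k, f k (pt s) ≠ 0
  · obtain ⟨k, hk⟩ := hs
    have h0 : ∀ l, l ≠ k → f l (pt s) = 0 := fun l hl => hdisj k l hl.symm _ hk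
    rw [Finset.sum_eq_single k (fun l _ hl => by rw [h0 l hl, mul_zero]) (by simp),
      Finset.prod_eq_single k (fun l _ hl => by rw [h0 l hl, mul_zero, hκ]) (by simp)]
  · push Not at hs
    simp [hs, hκ]

lemma HasAtomFormula.hasIndependentIncrements [IsProbabilityMeasure P]
    (h : HasAtomFormula A P X κ) (hκ : ∀ C, κ C 0 = 1) (hX : ∀ U ∈ A, Measurable (X U))
    (hinter : ∀ S ∈ A, ∀ R ∈ A, S ∩ R ∈ A) : HasIndependentIncrements A P X := by
  intro n U₀ k U hU₀ hU hdisj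
  refine h.iIndepFun hκ hX (fun i => increment_mem hinter (hU₀ i) (hU i)) fun i j hij t ht => ?_
  have hti : t ∈ U₀ i \ ⋃ a, U i a := by
    by_contra hcon
    exact ht (Set.indicator_of_notMem hcon _)
  exact Set.indicator_of_notMem (fun htj => Set.disjoint_left.1 (hdisj hij) hti htj) _

/-- The characteristic function of the increment over a difference of finite unions. -/
lemma HasAtomFormula.charFun_diff (h : HasAtomFormula A P X κ)
    (hκ : IsChainMul A κ) (hX : ∀ U ∈ A, Measurable (X U))
    (hinter : ∀ S ∈ A, ∀ R ∈ A, S ∩ R ∈ A) (hempty : ∅ ∈ A) {U V : Set T} (hU : U ∈ finUnions A)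
    (hV : V ∈ finUnions A) (hUV : U ⊆ V) {Y : Ω → ℝ}
    (hY : ((V \ U).indicator (1 : T → ℝ), Y) ∈ incrGraph A X) (z : ℝ) :
    charFun (P.map Y) z = κ (V \ U) z := by
  classical
  rw [charFun_map_eq_charFun_smul (measurable_of_mem_incrGraph hX hY)]
  obtain ⟨n, W, c, hW, h1, h2⟩ := exists_sum_of_mem_incrGraph (Submodule.smul_mem _ z hY)
  obtain ⟨k, a, ha, rfl⟩ := hU
  obtain ⟨l, b, hb, rfl⟩ := hV
  -- The sets of both unions are added to the family, with coefficient zero, to make them saturated.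
  let W' : Fin n ⊕ (Fin (k + 1) ⊕ Fin (l + 1)) → Set T := Sum.elim W (Sum.elim a b)
  have hW' : ∀ i, W' i ∈ A := by
    rintro (i | i | i)
    exacts [hW i, ha i, hb i]
  have hsa : IsSaturated W' (⋃ i, a i) :=
    IsSaturated.iUnion fun i => isSaturated_apply (W := W') (Sum.inr (Sum.inl i))
  have hsb : IsSaturated W' (⋃ i, b i) :=
    IsSaturated.iUnion fun i => isSaturated_apply (W := W') (Sum.inr (Sum.inr i))
  have hf := h _ W' hW' (Sum.elim c 0)
  simp only [Fintype.sum_sum_type, Sum.elim_inl, Sum.elim_inr, Pi.zero_apply, zero_smul,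
    Finset.sum_const_zero, add_zero, W'] at hf
  rw [← h1, ← h2] at hf
  dsimp only at hf
  rw [hf, hκ.diff_eq_prod hinter hempty hW' hsa hsb hUV, labelsOf, Finset.prod_filter]
  refine Finset.prod_congr rfl fun s _ => ?_
  by_cases hs : pt s ∈ (⋃ i, b i) \ ⋃ i, a i
  · rw [if_pos hs]
    simp [Set.indicator_of_mem hs, W']
  · rw [if_neg hs]
    simp [Set.indicator_of_notMem hs, hκ.zero]

end AtomFormula

end SetIndexed

namespace SetIndexed

/-! ### Conditional laws and independent increments -/

section Conditional

variable {Ω : Type v} {m' mΩ : MeasurableSpace Ω} {P : Measure Ω} [IsProbabilityMeasure P]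

/-- If `Z` is `m'`-measurable, `I` is independent of `m'` and the measure `K x` is the law of `x + I`,
then the conditional law of `Z + I` given `m'` is `K Z`. -/
lemma condExp_preimage_add_of_indep (hm : m' ≤ mΩ) {Z I : Ω → ℝ} (hZ : Measurable[m'] Z)
    (hI : Measurable I) (hind : Indep m' (MeasurableSpace.comap I inferInstance) P)
    {K : Kernel ℝ ℝ} [IsMarkovKernel K] {B : Set ℝ} (hB : MeasurableSet B)
    (hK : ∀ x, K x B = P.map I {y | y + x ∈ B}) :
    P⟦(Z + I) ⁻¹' B | m'⟧ =ᵐ[P] fun ω => (K (Z ω)).real B := by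
  have hZ' : Measurable Z := hZ.mono hm le_rfl
  have hpre : MeasurableSet ((Z + I) ⁻¹' B) := (hZ'.add hI) hB
  have hKm : Measurable fun x => (K x).real B := (K.measurable_coe hB).ennreal_toReal
  have hgm : Measurable[m'] fun ω => (K (Z ω)).real B := hKm.comp hZ
  symm
  refine ae_eq_condExp_of_forall_setIntegral_eq hm ((integrable_const (1 : ℝ)).indicator hpre)
    (fun s _ _ => ?_) (fun s hs _ => ?_) hgm.aestronglyMeasurable
  · refine Integrable.integrableOn ((integrable_const (1 : ℝ)).mono'
      (hgm.mono hm le_rfl).aestronglyMeasurable (Eventually.of_forall fun ω => ?_))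
    rw [Real.norm_of_nonneg measureReal_nonneg]
    exact measureReal_le_one
  · have hprod : (P.restrict s).map (fun ω => (Z ω, I ω)) =
        ((P.restrict s).map Z).prod (P.map I) := by
      have : IsFiniteMeasure ((P.restrict s).map (fun ω => (Z ω, I ω))) :=
        Measure.isFiniteMeasure_map _ _
      refine Measure.ext_prod fun {u w} hu hw => ?_
      rw [Measure.prod_prod, Measure.map_apply (hZ'.prodMk hI) (hu.prod hw),
        Measure.map_apply hZ' hu, Measure.map_apply hI hw,
        Measure.restrict_apply ((hZ'.prodMk hI) (hu.prod hw)), Measure.restrict_apply (hZ' hu)]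
      have h := (Indep_iff _ _ _).1 hind (Z ⁻¹' u ∩ s) (I ⁻¹' w) ((hZ hu).inter hs) ⟨w, hw, rfl⟩
      rw [← h]
      congr 1
      ext ω
      simp only [mem_inter_iff, mem_preimage, Set.mem_prod]
      tauto
    have hset : MeasurableSet {p : ℝ × ℝ | p.2 + p.1 ∈ B} :=
      (measurable_snd.add measurable_fst) hB
    have h1 : P ((Z + I) ⁻¹' B ∩ s) = ∫⁻ ω in s, K (Z ω) B ∂P := by
      have h2 : P ((Z + I) ⁻¹' B ∩ s) =
          (P.restrict s).map (fun ω => (Z ω, I ω)) {p : ℝ × ℝ | p.2 + p.1 ∈ B} := by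
        rw [Measure.map_apply (hZ'.prodMk hI) hset, Measure.restrict_apply ((hZ'.prodMk hI) hset)]
        congr 1
        ext ω
        simp [add_comm]
      have : IsProbabilityMeasure (P.map I) := Measure.isProbabilityMeasure_map hI.aemeasurable
      rw [h2, hprod, Measure.prod_apply hset, lintegral_map (measurable_measure_prodMk_left hset) hZ']
      exact lintegral_congr fun ω => (hK (Z ω)).symm
    rw [integral_indicator hpre, Measure.restrict_restrict hpre, setIntegral_const, smul_eq_mul,
      mul_one, measureReal_def, h1]
    rw [integral_eq_lintegral_of_nonneg_ae (Eventually.of_forall fun ω => measureReal_nonneg)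
      (hgm.mono hm le_rfl).aestronglyMeasurable]
    congr 1
    refine lintegral_congr fun ω => ?_
    rw [ofReal_measureReal]

/-- If the conditional law of `V` given `m'` is `K Z` for a translation invariant kernel `K`,
then `V - Z` is independent of `m'` and has law `K 0`. -/
lemma measure_inter_preimage_sub_of_condExp (hm : m' ≤ mΩ) {Z V : Ω → ℝ} (hZ : Measurable[m'] Z)
    (hV : Measurable V) {K : Kernel ℝ ℝ} [IsMarkovKernel K]
    (hK : ∀ x B, MeasurableSet B → K x B = K 0 {y | y + x ∈ B})
    (hcond : ∀ B, MeasurableSet B → P⟦V ⁻¹' B | m'⟧ =ᵐ[P] fun ω => (K (Z ω)).real B)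
    {s : Set Ω} (hs : MeasurableSet[m'] s) {B : Set ℝ} (hB : MeasurableSet B) :
    P (s ∩ (V - Z) ⁻¹' B) = P s * K 0 B := by
  have hZ' : Measurable Z := hZ.mono hm le_rfl
  have hprod : (P.restrict s).map (fun ω => (Z ω, V ω)) = ((P.restrict s).map Z) ⊗ₘ K := by
    have : IsFiniteMeasure ((P.restrict s).map (fun ω => (Z ω, V ω))) :=
      Measure.isFiniteMeasure_map _ _
    refine Measure.ext_prod fun {u w} hu hw => ?_
    rw [Measure.compProd_apply_prod hu hw, Measure.map_apply (hZ'.prodMk hV) (hu.prod hw),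
      setLIntegral_map hu (K.measurable_coe hw) hZ',
      Measure.restrict_apply ((hZ'.prodMk hV) (hu.prod hw)), Measure.restrict_restrict (hZ' hu)]
    have hsu : MeasurableSet[m'] (Z ⁻¹' u ∩ s) := (hZ hu).inter hs
    have h1 := setIntegral_condExp hm
      ((integrable_const (1 : ℝ)).indicator (hV hw) : Integrable _ P) hsu
    rw [setIntegral_congr_ae (hm _ hsu) ((hcond w hw).mono fun ω h _ => h),
      integral_indicator (hV hw), Measure.restrict_restrict (hV hw), setIntegral_const,
      smul_eq_mul, mul_one, integral_eq_lintegral_of_nonneg_ae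
        (Eventually.of_forall fun ω => measureReal_nonneg)
        (((K.measurable_coe hw).ennreal_toReal.comp hZ').aestronglyMeasurable)] at h1
    have h2 : ∫⁻ ω in Z ⁻¹' u ∩ s, K (Z ω) w ∂P = P (V ⁻¹' w ∩ (Z ⁻¹' u ∩ s)) := by
      rw [measureReal_def, ENNReal.toReal_eq_toReal_iff' ?_ (measure_ne_top _ _)] at h1
      · rw [← h1]
        exact lintegral_congr fun ω => by rw [ofReal_measureReal]
      · refine ne_top_of_le_ne_top (measure_ne_top P (Z ⁻¹' u ∩ s)) ?_
        rw [← setLIntegral_one]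
        refine lintegral_mono fun ω => ?_
        rw [ofReal_measureReal]
        exact prob_le_one
    rw [h2]
    congr 1
    ext ω
    simp only [mem_inter_iff, mem_preimage, Set.mem_prod]
    tauto
  have hset : MeasurableSet {p : ℝ × ℝ | p.2 - p.1 ∈ B} :=
    (measurable_snd.sub measurable_fst) hB
  have h2 : P (s ∩ (V - Z) ⁻¹' B) =
      (P.restrict s).map (fun ω => (Z ω, V ω)) {p : ℝ × ℝ | p.2 - p.1 ∈ B} := by
    rw [Measure.map_apply (hZ'.prodMk hV) hset, Measure.restrict_apply ((hZ'.prodMk hV) hset),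
      inter_comm]
    rfl
  rw [h2, hprod, Measure.compProd_apply hset]
  have h3 : ∀ x, K x (Prod.mk x ⁻¹' {p : ℝ × ℝ | p.2 - p.1 ∈ B}) = K 0 B := by
    intro x
    rw [hK x _ (measurable_prodMk_left hset)]
    congr 1
    ext y
    simp
  simp_rw [h3]
  rw [lintegral_const, Measure.map_apply hZ' MeasurableSet.univ, preimage_univ,
    Measure.restrict_apply_univ, mul_comm]

end Conditional

section Measurability

variable {T : Type u} {Ω : Type v} {A : Set (Set T)} {X : Set T → Ω → ℝ}

lemma measurable_minimalFiltration {U V : Set T} (hV : V ∈ A) (hVU : V ⊆ U) :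
    Measurable[minimalFiltration A X U] (X V) := by
  have h : MeasurableSpace.comap (X V) (borel ℝ) ≤ minimalFiltration A X U :=
    le_iSup₂ (f := fun V (_ : V ∈ {V | V ∈ A ∧ V ⊆ U}) => MeasurableSpace.comap (X V) (borel ℝ))
      V ⟨hV, hVU⟩
  rw [measurable_iff_comap_le, BorelSpace.measurable_eq (α := ℝ)]
  exact h

lemma measurable_unionIncrement_minimalFiltration (hinter : ∀ S ∈ A, ∀ R ∈ A, S ∩ R ∈ A) {n : ℕ}
    {a : Fin n → Set T} (ha : ∀ i, a i ∈ A) :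
    Measurable[minimalFiltration A X (⋃ i, a i)] (unionIncrement X a) := by
  unfold unionIncrement
  refine Finset.measurable_fun_sum _ fun s hs => ?_
  obtain ⟨i, hi⟩ := (Finset.mem_filter.1 hs).2
  refine (measurable_minimalFiltration (biInter_mem hinter ha ⟨i, hi⟩) ?_).const_mul _
  exact (biInter_subset_of_mem hi).trans (subset_iUnion a i)

end Measurability

section Decomposition

variable {T : Type u} {Ω : Type v} [MeasurableSpace Ω] {A : Set (Set T)} {P : Measure Ω}
  {X : Set T → Ω → ℝ}

lemma HasIndependentIncrements.iIndepFun_of_fintype (h : HasIndependentIncrements A P X)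
    {σ : Type*} [Fintype σ] {U₀ : σ → Set T} {k : σ → ℕ} {U : ∀ s, Fin (k s) → Set T}
    (hU₀ : ∀ s, U₀ s ∈ A) (hU : ∀ s j, U s j ∈ A)
    (hdisj : Pairwise fun s s' => Disjoint (U₀ s \ ⋃ a, U s a) (U₀ s' \ ⋃ a, U s' a)) :
    iIndepFun (fun s => increment X (U₀ s) (U s)) P := by
  let e := Fintype.equivFin σ
  have h1 := h (Fintype.card σ) (fun i => U₀ (e.symm i)) (fun i => k (e.symm i))
    (fun i => U (e.symm i)) (fun i => hU₀ _) (fun i j => hU _ _)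
    (fun i j hij => hdisj (e.symm.injective.ne hij))
  have h2 := h1.precomp e.injective
  have h3 : (fun s => increment X (U₀ s) (U s)) =
      fun s => increment X (U₀ (e.symm (e s))) (U (e.symm (e s))) :=
    funext fun s => congrArg (fun s => increment X (U₀ s) (U s)) (e.symm_apply_apply s).symm
  rw [h3]
  exact h2

/-- Finitely many increments of a process with independent increments are simultaneously linear
combinations of independent increments over disjoint sets `C s`, the coefficients being the values
at points `t s ∈ C s`. -/
lemma exists_indep_decomposition (hX : HasDefiniteIncrements A P X)
    (hind : HasIndependentIncrements A P X) (hinter : ∀ S ∈ A, ∀ R ∈ A, S ∩ R ∈ A)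
    (hempty : ∅ ∈ A) {κ : Type*} [Fintype κ] {f : κ → T → ℝ} {Y : κ → Ω → ℝ}
    (hY : ∀ k, (f k, Y k) ∈ incrGraph A X) :
    ∃ (σ : Type) (_ : Fintype σ) (t : σ → T) (C : σ → Set T) (y : σ → Ω → ℝ),
      (∀ s, ∃ (n : ℕ) (U₀ : Set T) (U : Fin n → Set T), U₀ ∈ A ∧ (∀ i, U i ∈ A) ∧
        C s = U₀ \ (⋃ i, U i) ∧ y s = increment X U₀ U) ∧
      iIndepFun y P ∧ (Pairwise fun s s' => Disjoint (C s) (C s')) ∧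
      (∀ k, Y k =ᵐ[P] ∑ s, f k (t s) • y s) ∧
      (∀ k, f k = ∑ s, f k (t s) • (C s).indicator 1) := by
  classical
  obtain ⟨ι, hι, W, c, hW, hfY⟩ := exists_family_of_mem_incrGraph hY
  have hdisj : Pairwise fun s s' : AtomIdx W => Disjoint (atom W s) (atom W s') := by
    intro s s' hss'
    rw [Set.disjoint_left]
    intro t ht ht'
    exact hss' (Subtype.ext ((mem_atom_iff.1 ht).symm.trans (mem_atom_iff.1 ht')))
  refine ⟨AtomIdx W, inferInstance, pt, fun s => atom W s, fun s => atomIncr X W s,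
    fun s => ⟨_, _, _, biInter_mem hinter hW s.2.1, fun j => hW _, (atom_eq_diff W s).symm, rfl⟩,
    ?_, hdisj, fun k => ?_, fun k => ?_⟩
  · refine hind.iIndepFun_of_fintype (fun s => biInter_mem hinter hW s.2.1) (fun s j => hW _) ?_
    simp_rw [atom_eq_diff]
    exact hdisj
  · rw [(hfY k).1, (hfY k).2]
    exact sum_smul_ae_eq_sum_atomIncr hX hinter hempty hW (c k)
  · ext t
    rw [Finset.sum_apply]
    have hfl : ∀ t, f k t = ∑ i ∈ label W t, c k i := fun t => by
      rw [(hfY k).1]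
      exact sum_smul_indicator_apply W (c k) t
    by_cases h : (label W t).Nonempty
    · rw [Finset.sum_eq_single (atomOf W t h)]
      · have ht : t ∈ atom W (atomOf W t h).1 := mem_atom_iff.2 rfl
        rw [hfl, hfl, label_pt, Pi.smul_apply, Set.indicator_of_mem ht]
        simp [atomOf]
      · intro s _ hs
        rw [Pi.smul_apply, Set.indicator_of_notMem, smul_zero]
        exact fun h' => hs (Subtype.ext (mem_atom_iff.1 h').symm)
      · simp
    · rw [Finset.not_nonempty_iff_eq_empty] at h
      rw [hfl, h, Finset.sum_empty, Finset.sum_eq_zero]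
      intro s _
      rw [Pi.smul_apply, Set.indicator_of_notMem, smul_zero]
      exact fun h' => s.2.1.ne_empty ((mem_atom_iff.1 h').symm.trans h)

/-- The linear extension of a process with definite increments to simple functions is well defined
up to null events. -/
lemma HasDefiniteIncrements.ae_eq_of_mem (hX : HasDefiniteIncrements A P X)
    (hinter : ∀ S ∈ A, ∀ R ∈ A, S ∩ R ∈ A) (hempty : ∅ ∈ A) {f : T → ℝ} {Y Y' : Ω → ℝ}
    (hY : (f, Y) ∈ incrGraph A X) (hY' : (f, Y') ∈ incrGraph A X) : Y =ᵐ[P] Y' := by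
  classical
  have h := Submodule.sub_mem _ hY hY'
  obtain ⟨n, W, c, hW, h1, h2⟩ := exists_sum_of_mem_incrGraph h
  have h3 := sum_smul_ae_eq_sum_atomIncr (X := X) hX hinter hempty hW c
  rw [← h1, ← h2] at h3
  filter_upwards [h3] with ω hω
  simpa [sub_eq_zero] using hω

lemma minimalFiltration_le (hX : ∀ U ∈ A, Measurable (X U)) (U : Set T) :
    minimalFiltration A X U ≤ ‹MeasurableSpace Ω› := by
  refine iSup₂_le fun V hV => ?_
  rw [← BorelSpace.measurable_eq (α := ℝ)]
  exact (hX V hV.1).comap_le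

/-- An increment over a set disjoint from `U` is independent of `ℱ_U`. -/
lemma indep_minimalFiltration [IsProbabilityMeasure P] (hXm : ∀ U ∈ A, Measurable (X U))
    (hX : HasDefiniteIncrements A P X)
    (hind : HasIndependentIncrements A P X) (hinter : ∀ S ∈ A, ∀ R ∈ A, S ∩ R ∈ A)
    (hempty : ∅ ∈ A) {U : Set T} {g : T → ℝ} {I : Ω → ℝ} (hI : (g, I) ∈ incrGraph A X)
    (hg : ∀ t ∈ U, g t = 0) :
    Indep (minimalFiltration A X U) (MeasurableSpace.comap I inferInstance) P := by
  classical
  have hIm : Measurable I := measurable_of_mem_incrGraph hXm hI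
  have hproc : IndepFun (fun ω (V : {V // V ∈ A ∧ V ⊆ U}) => X V ω) I P := by
    refine IndepFun.process_indepFun (fun V => hXm V V.2.1) hIm fun J => ?_
    let f : Option J → T → ℝ := fun o => o.elim g fun V => (V.1.1 : Set T).indicator 1
    let Y : Option J → Ω → ℝ := fun o => o.elim I fun V => X V.1
    have hY : ∀ o, (f o, Y o) ∈ incrGraph A X := by
      rintro (_ | V)
      · exact hI
      · exact mem_incrGraph V.1.2.1
    obtain ⟨σ, hσ, t, C, y, hy, hyind, -, hYy, -⟩ :=
      exists_indep_decomposition hX hind hinter hempty hY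
    have hym : ∀ s, Measurable (y s) := by
      intro s
      obtain ⟨n, U₀, U', hU₀, hU', -, hys⟩ := hy s
      rw [hys]
      exact measurable_of_mem_incrGraph hXm (increment_mem hinter hU₀ hU')
    let S₁ : Finset σ := Finset.univ.filter fun s => t s ∈ U
    let S₂ : Finset σ := Finset.univ.filter fun s => t s ∉ U
    have hdisj : Disjoint S₁ S₂ := Finset.disjoint_filter_filter_not _ _ _
    have h1 := hyind.indepFun_finset S₁ S₂ hdisj hym
    have h2 := h1.comp
      (φ := fun (z : S₁ → ℝ) (V : J) => ∑ s : S₁, f (some V) (t s) * z s)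
      (ψ := fun (z : S₂ → ℝ) => ∑ s : S₂, f none (t s) * z s) (by fun_prop) (by fun_prop)
    have hYsum : ∀ᵐ ω ∂P, ∀ o, Y o ω = ∑ s, f o (t s) * y s ω := by
      rw [ae_all_iff]
      intro o
      filter_upwards [hYy o] with ω hω
      rw [hω, Finset.sum_apply]
      rfl
    refine h2.congr ?_ ?_
    · filter_upwards [hYsum] with ω hω
      ext V
      have h3 := hω (some V)
      change ∑ s : S₁, f (some V) (t s) * y s ω = X V.1 ω
      refine Eq.trans ?_ h3.symm
      rw [Finset.sum_coe_sort S₁ fun s => f (some V) (t s) * y s ω]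
      refine Finset.sum_subset (Finset.subset_univ _) fun s _ hs => ?_
      have hsU : t s ∉ U := by simpa [S₁] using hs
      have : f (some V) (t s) = 0 :=
        Set.indicator_of_notMem (fun h => hsU (V.1.2.2 h)) _
      rw [this, zero_mul]
    · filter_upwards [hYsum] with ω hω
      have h3 := hω none
      change ∑ s : S₂, f none (t s) * y s ω = I ω
      refine Eq.trans ?_ h3.symm
      rw [Finset.sum_coe_sort S₂ fun s => f none (t s) * y s ω]
      refine Finset.sum_subset (Finset.subset_univ _) fun s _ hs => ?_
      have hsU : t s ∈ U := by simpa [S₂] using hs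
      have : f none (t s) = 0 := hg _ hsU
      rw [this, zero_mul]
  have hle : minimalFiltration A X U ≤
      MeasurableSpace.comap (fun ω (V : {V // V ∈ A ∧ V ⊆ U}) => X V ω) inferInstance := by
    refine iSup₂_le fun V hV => ?_
    rw [← BorelSpace.measurable_eq (α := ℝ), ← measurable_iff_comap_le]
    have h1 : @Measurable _ _ (MeasurableSpace.comap
        (fun ω (V : {V // V ∈ A ∧ V ⊆ U}) => X V ω) inferInstance) _
        (fun ω (V : {V // V ∈ A ∧ V ⊆ U}) => X V ω) := comap_measurable _
    exact (measurable_pi_apply (⟨V, hV⟩ : {V // V ∈ A ∧ V ⊆ U})).comp h1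
  exact indep_of_indep_of_le_left ((IndepFun_iff_Indep _ _ _).1 hproc) hle

end Decomposition

end SetIndexed

namespace SetIndexed

/-! ### Transition systems and the Markov property -/

section Markov

variable {T : Type u} {A : Set (Set T)} {Q : Set T → Set T → Kernel ℝ ℝ}

lemma IsSpatiallyHomogeneous.apply (hs : IsSpatiallyHomogeneous A Q) (hQ : IsTransitionSystem A Q)
    {U V : Set T} (hU : U ∈ finUnions A) (hV : V ∈ finUnions A) (hUV : U ⊆ V) (x : ℝ) (B : Set ℝ)
    (hB : MeasurableSet B) : Q U V x B = Q U V 0 {y | y + x ∈ B} := by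
  rcases hUV.eq_or_ssubset with rfl | h
  · have hB' : MeasurableSet {y | y + x ∈ B} := (measurable_id.add_const x) hB
    rw [hQ.refl U hU, hQ.refl U hU, Measure.dirac_apply' _ hB, Measure.dirac_apply' _ hB']
    by_cases hx : x ∈ B <;> simp [hx]
  · exact hs U hU V hV h x B hB

/-- The Chapman-Kolmogorov equation of a spatially homogeneous transition system is a convolution
identity. -/
lemma IsTransitionSystem.charFun_mul (hQ : IsTransitionSystem A Q)
    (hs : IsSpatiallyHomogeneous A Q) {U V W : Set T} (hU : U ∈ finUnions A)
    (hV : V ∈ finUnions A) (hW : W ∈ finUnions A) (hUV : U ⊆ V) (hVW : V ⊆ W) (z : ℝ) :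
    charFun (Q U W 0) z = charFun (Q U V 0) z * charFun (Q V W 0) z := by
  have h1 := hQ.markov U hU V hV hUV
  have h2 := hQ.markov V hV W hW hVW
  have h3 : Q U W 0 = (Q U V 0).conv (Q V W 0) := by
    ext B hB
    have hset : MeasurableSet ((fun p : ℝ × ℝ => p.1 + p.2) ⁻¹' B) :=
      (measurable_fst.add measurable_snd) hB
    rw [← hQ.chapman_kolmogorov U hU V hV W hW hUV hVW 0 B hB, Measure.conv,
      Measure.map_apply (f := fun p : ℝ × ℝ => p.1 + p.2) (measurable_fst.add measurable_snd) hB,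
      Measure.prod_apply hset]
    refine lintegral_congr fun x => ?_
    rw [hs.apply hQ hV hW hVW x B hB]
    congr 1
    ext y
    simp [add_comm]
  rw [h3, charFun_conv]

open Classical in
/-- The law of the increment over a set `V \ U`, read off from a transition system (and the Dirac
mass at `0` for sets which are not differences of finite unions). -/
def kernelLaw (A : Set (Set T)) (Q : Set T → Set T → Kernel ℝ ℝ) (C : Set T) : Measure ℝ :=
  if h : ∃ p : Set T × Set T, (p.1 ∈ finUnions A ∧ p.2 ∈ finUnions A) ∧ p.1 ⊆ p.2 ∧ C = p.2 \ p.1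
  then Q h.choose.1 h.choose.2 0 else Measure.dirac 0

lemma IsTransitionSystem.isProbabilityMeasure_kernelLaw (hQ : IsTransitionSystem A Q) (C : Set T) :
    IsProbabilityMeasure (kernelLaw A Q C) := by
  rw [kernelLaw]
  split_ifs with h
  · obtain ⟨⟨h1, h2⟩, h3, -⟩ := h.choose_spec
    have := hQ.markov _ h1 _ h2 h3
    infer_instance
  · infer_instance

section MHomogeneous

variable [MeasurableSpace T] {m : Measure T}

/-- By `m`-homogeneity, `kernelLaw` does not depend on the chosen representation. -/
lemma kernelLaw_diff (hQ : IsTransitionSystem A Q) (hm : IsMHomogeneous A m Q) {U V : Set T}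
    (hU : U ∈ finUnions A) (hV : V ∈ finUnions A) (hUV : U ⊆ V) :
    kernelLaw A Q (V \ U) = Q U V 0 := by
  have h : ∃ p : Set T × Set T, (p.1 ∈ finUnions A ∧ p.2 ∈ finUnions A) ∧ p.1 ⊆ p.2 ∧
    V \ U = p.2 \ p.1 := ⟨(U, V), ⟨hU, hV⟩, hUV, rfl⟩
  rw [kernelLaw, dif_pos h]
  obtain ⟨⟨h1, h2⟩, h3, h4⟩ := h.choose_spec
  generalize h.choose = p at h1 h2 h3 h4 ⊢
  rcases hUV.eq_or_ssubset with rfl | hss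
  · have h5 : p.1 = p.2 := by
      refine h3.antisymm ?_
      rw [← Set.sdiff_eq_empty, ← h4, Set.sdiff_self]
    rw [h5, hQ.refl _ h2, hQ.refl _ hU]
  · have h5 : p.1 ⊂ p.2 := by
      refine h3.ssubset_of_ne fun h5 => hss.2 ?_
      rw [← Set.sdiff_eq_empty, h4, h5, Set.sdiff_self]
    rw [hm _ h1 _ h2 U hU V hV h5 hss (by rw [h4])]

lemma isChainMul_kernelLaw (hempty : ∅ ∈ A) (hQ : IsTransitionSystem A Q)
    (hs : IsSpatiallyHomogeneous A Q) (hm : IsMHomogeneous A m Q) :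
    IsChainMul A fun C => charFun (kernelLaw A Q C) where
  empty z := by
    have h := mem_finUnions_of_mem hempty
    have h1 := kernelLaw_diff hQ hm h h subset_rfl
    rw [Set.sdiff_self] at h1
    rw [h1, hQ.refl _ h, charFun_dirac]
    simp
  zero C := by
    have := hQ.isProbabilityMeasure_kernelLaw C
    simp
  mul U hU V hV R hR hUV hVR z := by
    rw [kernelLaw_diff hQ hm hU hR (hUV.trans hVR), kernelLaw_diff hQ hm hU hV hUV,
      kernelLaw_diff hQ hm hV hR hVR, hQ.charFun_mul hs hU hV hR hUV hVR]

end MHomogeneous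

variable {Ω : Type v} {X : Set T → Ω → ℝ}

lemma unionIncrement_sub_mem (hinter : ∀ S ∈ A, ∀ R ∈ A, S ∩ R ∈ A) {k l : ℕ}
    {a : Fin k → Set T} {b : Fin l → Set T} (ha : ∀ i, a i ∈ A) (hb : ∀ j, b j ∈ A)
    (hab : (⋃ i, a i) ⊆ ⋃ j, b j) :
    (((⋃ j, b j) \ ⋃ i, a i).indicator (1 : T → ℝ), unionIncrement X b - unionIncrement X a) ∈
      incrGraph A X := by
  have h := Submodule.sub_mem _ (unionIncrement_mem (X := X) hinter hb)
    (unionIncrement_mem (X := X) hinter ha)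
  rwa [Prod.mk_sub_mk, ← Set.indicator_sdiff hab] at h

variable [MeasurableSpace Ω] {P : Measure Ω} [IsProbabilityMeasure P]

/-- A process with independent increments whose increments have the laws prescribed by a spatially
homogeneous transition system is Markov for this system. -/
lemma isQMarkov_of_hasIndependentIncrements (hXm : ∀ U ∈ A, Measurable (X U))
    (hX : HasDefiniteIncrements A P X) (hind : HasIndependentIncrements A P X)
    (hinter : ∀ S ∈ A, ∀ R ∈ A, S ∩ R ∈ A) (hempty : ∅ ∈ A) (hQ : IsTransitionSystem A Q)
    (hs : IsSpatiallyHomogeneous A Q)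
    (hlaw : ∀ (k l : ℕ) (a : Fin k → Set T) (b : Fin l → Set T), (∀ i, a i ∈ A) → (∀ j, b j ∈ A) →
      (⋃ i, a i) ⊆ (⋃ j, b j) →
      P.map (unionIncrement X b - unionIncrement X a) = Q (⋃ i, a i) (⋃ j, b j) 0) :
    IsQMarkov A P X Q := by
  intro k l a b ha hb hab B hB
  have hU := iUnion_mem_finUnions hempty ha
  have hV := iUnion_mem_finUnions hempty hb
  have hmem := unionIncrement_sub_mem (X := X) hinter ha hb hab
  have hK := hQ.markov _ hU _ hV hab
  have h := condExp_preimage_add_of_indep (P := P) (minimalFiltration_le hXm (⋃ i, a i))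
    (measurable_unionIncrement_minimalFiltration hinter ha)
    (measurable_of_mem_incrGraph hXm hmem)
    (indep_minimalFiltration hXm hX hind hinter hempty hmem
      fun t ht => Set.indicator_of_notMem (fun h => h.2 ht) _) hB (K := Q (⋃ i, a i) (⋃ j, b j))
    fun x => by rw [hlaw k l a b ha hb hab, hs.apply hQ hU hV hab x B hB]
  rwa [add_sub_cancel] at h

/-- The increments of a Markov process for a spatially homogeneous transition system are
independent of the past. -/
lemma IsQMarkov.measure_inter_preimage (h : IsQMarkov A P X Q) (hXm : ∀ U ∈ A, Measurable (X U))
    (hinter : ∀ S ∈ A, ∀ R ∈ A, S ∩ R ∈ A) (hempty : ∅ ∈ A) (hQ : IsTransitionSystem A Q)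
    (hs : IsSpatiallyHomogeneous A Q) {k l : ℕ} {a : Fin k → Set T} {b : Fin l → Set T}
    (ha : ∀ i, a i ∈ A) (hb : ∀ j, b j ∈ A) (hab : (⋃ i, a i) ⊆ ⋃ j, b j) {s : Set Ω}
    (hsm : MeasurableSet[minimalFiltration A X (⋃ i, a i)] s) {B : Set ℝ} (hB : MeasurableSet B) :
    P (s ∩ (unionIncrement X b - unionIncrement X a) ⁻¹' B) =
      P s * Q (⋃ i, a i) (⋃ j, b j) 0 B := by
  have hU := iUnion_mem_finUnions hempty ha
  have hV := iUnion_mem_finUnions hempty hb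
  have hK := hQ.markov _ hU _ hV hab
  exact measure_inter_preimage_sub_of_condExp (minimalFiltration_le hXm _)
    (measurable_unionIncrement_minimalFiltration hinter ha)
    (measurable_of_mem_incrGraph hXm (unionIncrement_mem hinter hb))
    (hs.apply hQ hU hV hab) (h k l a b ha hb hab) hsm hB

lemma IsQMarkov.map_sub (h : IsQMarkov A P X Q) (hXm : ∀ U ∈ A, Measurable (X U))
    (hinter : ∀ S ∈ A, ∀ R ∈ A, S ∩ R ∈ A) (hempty : ∅ ∈ A) (hQ : IsTransitionSystem A Q)
    (hs : IsSpatiallyHomogeneous A Q) {k l : ℕ} {a : Fin k → Set T} {b : Fin l → Set T}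
    (ha : ∀ i, a i ∈ A) (hb : ∀ j, b j ∈ A) (hab : (⋃ i, a i) ⊆ ⋃ j, b j) :
    P.map (unionIncrement X b - unionIncrement X a) = Q (⋃ i, a i) (⋃ j, b j) 0 := by
  ext B hB
  rw [Measure.map_apply (measurable_of_mem_incrGraph hXm
    (unionIncrement_sub_mem hinter ha hb hab)) hB]
  have h1 := h.measure_inter_preimage hXm hinter hempty hQ hs ha hb hab MeasurableSet.univ hB
  rwa [univ_inter, measure_univ, one_mul] at h1

lemma IsQMarkov.indepFun (h : IsQMarkov A P X Q) (hXm : ∀ U ∈ A, Measurable (X U))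
    (hinter : ∀ S ∈ A, ∀ R ∈ A, S ∩ R ∈ A) (hempty : ∅ ∈ A) (hQ : IsTransitionSystem A Q)
    (hs : IsSpatiallyHomogeneous A Q) {k l : ℕ} {a : Fin k → Set T} {b : Fin l → Set T}
    (ha : ∀ i, a i ∈ A) (hb : ∀ j, b j ∈ A) (hab : (⋃ i, a i) ⊆ ⋃ j, b j) {Z : Ω → ℝ}
    (hZ : Measurable[minimalFiltration A X (⋃ i, a i)] Z) :
    IndepFun Z (unionIncrement X b - unionIncrement X a) P := by
  rw [indepFun_iff_measure_inter_preimage_eq_mul]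
  intro s t hs' ht
  rw [h.measure_inter_preimage hXm hinter hempty hQ hs ha hb hab (hZ hs') ht,
    ← h.map_sub hXm hinter hempty hQ hs ha hb hab, Measure.map_apply (measurable_of_mem_incrGraph
      hXm (unionIncrement_sub_mem hinter ha hb hab)) ht]

end Markov

end SetIndexed

namespace SetIndexed

/-! ### Construction of a process from the laws of its increments -/

section Construction

variable {T : Type u} {A : Set (Set T)} {ν : Set T → Measure ℝ}

open Classical in
/-- The joint law of the values on a finite family `W` of a process whose increments over the atoms
of the family are independent with laws `ν`. -/
def familyLaw (ν : Set T → Measure ℝ) {ι : Type*} [Fintype ι] (W : ι → Set T) :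
    Measure (ι → ℝ) :=
  (Measure.pi fun s : AtomIdx W => ν (atom W s)).map
    fun y i => ∑ s : AtomIdx W, if i ∈ s.1 then y s else 0

lemma measurable_sum_atoms {ι : Type*} [Fintype ι] [DecidableEq ι] (W : ι → Set T) :
    Measurable fun (y : AtomIdx W → ℝ) (i : ι) => ∑ s : AtomIdx W, if i ∈ s.1 then y s else 0 := by
  refine measurable_pi_lambda _ fun i => Finset.measurable_fun_sum _ fun s _ => ?_
  split_ifs
  · exact measurable_pi_apply s
  · exact measurable_const

variable [hν : ∀ C, IsProbabilityMeasure (ν C)]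

instance {ι : Type*} [Fintype ι] (W : ι → Set T) : IsProbabilityMeasure (familyLaw ν W) := by
  classical
  exact Measure.isProbabilityMeasure_map (measurable_sum_atoms W).aemeasurable

/-- The characteristic function of a linear combination of the values on a subfamily. -/
lemma integral_familyLaw (hκ : IsChainMul A fun C => charFun (ν C))
    (hinter : ∀ S ∈ A, ∀ R ∈ A, S ∩ R ∈ A) (hempty : ∅ ∈ A) {ι ι' : Type*} [Fintype ι]
    [DecidableEq ι] [Fintype ι'] [DecidableEq ι'] {W : ι → Set T} {W' : ι' → Set T}
    (hW' : ∀ i, W' i ∈ A) (e : ι → ι') (he : ∀ i, W i = W' (e i)) (c : ι → ℝ) :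
    ∫ x, Complex.exp (((∑ i, c i * x (e i) : ℝ) : ℂ) * Complex.I) ∂(familyLaw ν W') =
      ∏ s : AtomIdx W,
        charFun (ν (atom W s)) ((∑ i, c i • (W i).indicator (1 : T → ℝ)) (pt s)) := by
  rw [hκ.prod_atoms_eq hinter hempty hW' e he c]
  have hmeas : ∀ y : AtomIdx W' → ℝ,
      Complex.exp (((∑ i, c i * ∑ s : AtomIdx W', (if e i ∈ s.1 then y s else 0) : ℝ) : ℂ) *
        Complex.I) = ∏ s : AtomIdx W', Complex.exp
          (((∑ i, c i • (W i).indicator (1 : T → ℝ)) (pt s) : ℝ) * y s * Complex.I) := by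
    intro y
    rw [← Complex.exp_sum]
    congr 1
    rw [← Finset.sum_mul]
    congr 1
    simp_rw [Finset.mul_sum]
    rw [Finset.sum_comm]
    push_cast
    refine Finset.sum_congr rfl fun s _ => ?_
    rw [Finset.sum_apply]
    push_cast
    rw [Finset.sum_mul]
    refine Finset.sum_congr rfl fun i _ => ?_
    have hi : pt s ∈ W i ↔ e i ∈ s.1 := by rw [he]; exact pt_mem s (e i)
    by_cases h : e i ∈ s.1
    · simp [h, hi.2 h]
    · simp [h, mt hi.1 h]
  have hdec : familyLaw ν W' = (Measure.pi fun s : AtomIdx W' => ν (atom W' s)).map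
      fun y i => ∑ s : AtomIdx W', if i ∈ s.1 then y s else 0 := by
    rw [familyLaw]
    congr!
  have hm : Measurable fun x : ι' → ℝ =>
      Complex.exp (((∑ i, c i * x (e i) : ℝ) : ℂ) * Complex.I) := by fun_prop
  rw [hdec, integral_map (measurable_sum_atoms W').aemeasurable hm.aestronglyMeasurable]
  simp_rw [hmeas]
  rw [integral_fintype_prod_eq_prod (fun (s : AtomIdx W') (y : ℝ) => Complex.exp
    (((∑ i, c i • (W i).indicator (1 : T → ℝ)) (pt s) : ℝ) * y * Complex.I))]
  refine Finset.prod_congr rfl fun s _ => ?_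
  rw [charFun_apply_real]

/-- The laws of finite families are consistent. -/
lemma isProjectiveMeasureFamily_familyLaw (hκ : IsChainMul A fun C => charFun (ν C))
    (hinter : ∀ S ∈ A, ∀ R ∈ A, S ∩ R ∈ A) (hempty : ∅ ∈ A) :
    IsProjectiveMeasureFamily (α := fun _ : A => ℝ)
      fun J => familyLaw ν fun i : J => (i.1 : Set T) := by
  classical
  intro I J hJI
  have hr : Measurable (Finset.restrict₂ (π := fun _ : A => ℝ) hJI) :=
    Finset.measurable_restrict₂ hJI
  have := Measure.isProbabilityMeasure_map (μ := familyLaw ν fun i : I => (i.1 : Set T))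
    hr.aemeasurable
  refine Measure.ext_of_charFunDual ?_
  ext L
  obtain ⟨c, hc⟩ : ∃ c : J → ℝ, ∀ x : J → ℝ, L x = ∑ i, c i * x i := by
    refine ⟨fun i => L (Pi.single i 1), fun x => ?_⟩
    conv_lhs => rw [← Finset.univ_sum_single x]
    rw [map_sum]
    refine Finset.sum_congr rfl fun i _ => ?_
    have : Pi.single i (x i) = x i • (Pi.single i (1 : ℝ) : J → ℝ) := by
      rw [← Pi.single_smul, smul_eq_mul, mul_one]
    rw [this, map_smul, smul_eq_mul, mul_comm]
  rw [charFunDual_apply, charFunDual_apply, integral_map hr.aemeasurable (by fun_prop)]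
  simp_rw [hc]
  exact (integral_familyLaw hκ hinter hempty (W := fun i : J => (i.1 : Set T)) (fun i => i.1.2) id
    (fun i => rfl) c).trans (integral_familyLaw hκ hinter hempty (W := fun i : J => (i.1 : Set T))
    (fun i : I => i.1.2) (fun i => ⟨i.1, hJI i.2⟩) (fun i => rfl) _).symm

/-- For every family of laws whose characteristic functions are multiplicative along chains of
finite unions there is a process with independent increments of these laws. -/
lemma exists_hasAtomFormula (hκ : IsChainMul A fun C => charFun (ν C))
    (hinter : ∀ S ∈ A, ∀ R ∈ A, S ∩ R ∈ A) (hempty : ∅ ∈ A) :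
    ∃ (Ω : Type u) (_ : MeasurableSpace Ω) (P : Measure Ω) (_ : IsProbabilityMeasure P)
      (X : Set T → Ω → ℝ), (∀ U ∈ A, Measurable (X U)) ∧
      HasAtomFormula A P X fun C => charFun (ν C) := by
  classical
  obtain ⟨μ, hμ⟩ := exists_isProjectiveLimit
    (isProjectiveMeasureFamily_familyLaw hκ hinter hempty)
  have hprob : IsProbabilityMeasure μ := by
    have h : _ = familyLaw ν (fun i : (∅ : Finset A) => (i.1 : Set T)) := hμ ∅
    have h1 : μ univ = familyLaw ν (fun i : (∅ : Finset A) => (i.1 : Set T)) univ := by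
      rw [← h, Measure.map_apply (Finset.measurable_restrict _) MeasurableSet.univ, preimage_univ]
    exact ⟨by rw [h1, measure_univ]⟩
  let X : Set T → (A → ℝ) → ℝ := fun U ω => if h : U ∈ A then ω ⟨U, h⟩ else 0
  have hXU : ∀ U (h : U ∈ A), X U = fun ω => ω ⟨U, h⟩ := fun U h => funext fun ω => dif_pos h
  have hXm : ∀ U ∈ A, Measurable (X U) := fun U h => by
    rw [hXU U h]
    exact measurable_pi_apply _
  refine ⟨A → ℝ, inferInstance, μ, hprob, X, hXm, fun ι _ _ W hW c => ?_⟩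
  let J : Finset A := Finset.univ.image fun i => ⟨W i, hW i⟩
  let e : ι → J := fun i => ⟨⟨W i, hW i⟩, Finset.mem_image_of_mem _ (Finset.mem_univ i)⟩
  have hJ : _ = familyLaw ν (fun i : J => (i.1 : Set T)) := hμ J
  rw [← integral_familyLaw hκ hinter hempty (W := W) (W' := fun i : J => (i.1 : Set T))
    (fun i => i.1.2) e (fun i => rfl) c, ← hJ,
    integral_map (Finset.measurable_restrict _).aemeasurable
      (Measurable.aestronglyMeasurable (by fun_prop)), charFun_apply_real,
    integral_map (Measurable.aemeasurable ?_) (by fun_prop)]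
  · congr 1
    ext ω
    have hsum : (∑ i, c i • X (W i)) ω = ∑ i, c i * J.restrict ω (e i) := by
      rw [Finset.sum_apply]
      refine Finset.sum_congr rfl fun i _ => ?_
      rw [hXU _ (hW i)]
      rfl
    rw [hsum, Complex.ofReal_one, one_mul]
  · rw [Finset.sum_fn]
    exact Finset.measurable_fun_sum _ fun i _ => (hXm _ (hW i)).const_smul (c i)

variable [MeasurableSpace T] {m : Measure T}

/-- Every homogeneous transition system has a Markov process: the laws of its increments are
multiplicative along chains of finite unions, so they are those of a process with independent
increments. -/
theorem exists_isQMarkov (hinter : ∀ S ∈ A, ∀ R ∈ A, S ∩ R ∈ A) (hempty : ∅ ∈ A)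
    {Q : Set T → Set T → Kernel ℝ ℝ} (hQ : IsTransitionSystem A Q)
    (hs : IsSpatiallyHomogeneous A Q) (hm : IsMHomogeneous A m Q) :
    ∃ (Ω : Type u) (_ : MeasurableSpace Ω) (P : Measure Ω) (_ : IsProbabilityMeasure P)
      (X : Set T → Ω → ℝ), (∀ U ∈ A, Measurable (X U)) ∧
      HasDefiniteIncrements A P X ∧ IsQMarkov A P X Q := by
  have := hQ.isProbabilityMeasure_kernelLaw
  have hκ := isChainMul_kernelLaw hempty hQ hs hm
  obtain ⟨Ω, _, P, _, X, hXm, hform⟩ := exists_hasAtomFormula hκ hinter hempty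
  have hX := hform.hasDefiniteIncrements hκ.zero hXm hinter hempty
  refine ⟨Ω, _, P, inferInstance, X, hXm, hX, isQMarkov_of_hasIndependentIncrements hXm hX
    (hform.hasIndependentIncrements hκ.zero hXm hinter) hinter hempty hQ hs
    fun k l a b ha hb hab => ?_⟩
  have hU := iUnion_mem_finUnions hempty ha
  have hV := iUnion_mem_finUnions hempty hb
  have hmem := unionIncrement_sub_mem (X := X) hinter ha hb hab
  have h1 := hQ.markov _ hU _ hV hab
  have h2 : IsProbabilityMeasure (P.map (unionIncrement X b - unionIncrement X a)) :=
    Measure.isProbabilityMeasure_map (measurable_of_mem_incrGraph hXm hmem).aemeasurable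
  refine Measure.ext_of_charFun ?_
  ext z
  rw [hform.charFun_diff hκ hXm hinter hempty hU hV hab hmem, kernelLaw_diff hQ hm hU hV hab]

end Construction

end SetIndexed

namespace SetIndexed

/-! ### Flows in an indexing collection -/

section Flow

lemma minimalSet_subset {T : Type u} {A : Set (Set T)} {U : Set T} (hU : U ∈ A) (hne : U.Nonempty) :
    minimalSet A ⊆ U :=
  sInter_subset_of_mem ⟨hU, hne.ne_empty⟩

variable {T : Type u} [MetricSpace T] {A : Set (Set T)}

lemma IsIndexingCollection.inter_mem (hA : IsIndexingCollection A) :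
    ∀ S ∈ A, ∀ R ∈ A, S ∩ R ∈ A := by
  intro S hS R hR
  rw [← sInter_pair]
  exact hA.sInter_mem _ (by rintro _ (rfl | rfl) <;> assumption) (insert_nonempty _ _)

lemma IsIndexingCollection.isClosed (hA : IsIndexingCollection A) {S : Set T} (hS : S ∈ A) :
    IsClosed S := (hA.isCompact S hS).isClosed

lemma IsIndexingCollection.minimalSet_mem (hA : IsIndexingCollection A) {U : Set T} (hU : U ∈ A)
    (hne : U.Nonempty) : minimalSet A ∈ A :=
  hA.sInter_mem _ (fun _ h => h.1) ⟨U, hU, hne.ne_empty⟩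

/-- The minimal set is nonempty, by compactness. -/
lemma IsIndexingCollection.minimalSet_nonempty (hA : IsIndexingCollection A) {U : Set T}
    (hU : U ∈ A) (hne : U.Nonempty) : (minimalSet A).Nonempty := by
  have : Nonempty {U : Set T // U ∈ A ∧ U ≠ ∅} := ⟨⟨U, hU, hne.ne_empty⟩⟩
  have h := IsCompact.nonempty_iInter_of_directed_nonempty_isCompact_isClosed
    (fun S : {U : Set T // U ∈ A ∧ U ≠ ∅} => S.1)
    (fun S R => ⟨⟨S.1 ∩ R.1, hA.inter_mem _ S.2.1 _ R.2.1, (hA.inter_nonempty _ S.2.1 _ R.2.1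
      (nonempty_iff_ne_empty.2 S.2.2) (nonempty_iff_ne_empty.2 R.2.2)).ne_empty⟩,
      inter_subset_left, inter_subset_right⟩)
    (fun S => nonempty_iff_ne_empty.2 S.2.2) (fun S => hA.isCompact _ S.2.1)
    (fun S => hA.isClosed S.2.1)
  rwa [minimalSet, sInter_eq_iInter]

/-- The closure of a bounded increasing union belongs to the collection. -/
lemma IsIndexingCollection.closure_iUnion_mem (hA : IsIndexingCollection A) {U : Set T}
    (hU : U ∈ A) {S : ℕ → Set T} (hmono : Monotone S) (hS : ∀ i, S i ∈ A) (hSU : ∀ i, S i ⊆ U) :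
    closure (⋃ i, S i) ∈ A := by
  obtain ⟨B, hB, -, hcov, hcl, -⟩ := hA.exists_exhaustion
  obtain ⟨n, hn⟩ := (hA.isCompact U hU).elim_directed_cover (fun n => interior (B n))
    (fun n => isOpen_interior) (by rw [hcov]; exact subset_univ U)
    (monotone_nat_of_le_succ fun n => interior_mono (hB n.le_succ)).directed_le
  exact hcl S hmono hS ⟨n, fun i => (hSU i).trans (hn.trans interior_subset)⟩

/-- If only the two endpoints of an interval of the collection belong to it, the interval is
trivial: a discretization of the lower endpoint separates it from the rest of the upper endpoint,
which is connected. -/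
lemma IsIndexingCollection.eq_of_forall_between (hA : IsIndexingCollection A) {L R : Set T}
    (hL : L ∈ A) (hR : R ∈ A) (hne : L.Nonempty) (hLR : L ⊆ R)
    (h : ∀ S ∈ A, L ⊆ S → S ⊆ R → S = L ∨ S = R) : L = R := by
  obtain ⟨B, -, -, -, -, D, g, -, -, -, -, -, -, -, hint, -, hinter, hgA, -, -⟩ :=
    hA.exists_exhaustion
  refine hLR.antisymm ?_
  by_contra hRL
  obtain ⟨x, hxR, hxL⟩ := not_subset.1 hRL
  have hex : ∃ n, x ∉ g n L := by
    by_contra hcon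
    push Not at hcon
    exact hxL (by rw [hinter L hL]; exact mem_iInter.2 hcon)
  obtain ⟨n, hn⟩ := hex
  have hgL : g n L ∩ R = L := by
    refine (h _ (hgA n L hL R hR) (subset_inter ((hint n L hL).trans interior_subset) hLR)
      inter_subset_right).resolve_right fun heq => hn ?_
    rw [← heq] at hxR
    exact hxR.1
  obtain ⟨y, hy⟩ := hne
  obtain ⟨z, hzR, hzi, hzL⟩ := hA.isPreconnected R hR (interior (g n L)) Lᶜ isOpen_interior
    (hA.isClosed hL).isOpen_compl
    (fun z _ => (em (z ∈ L)).imp (fun hz => hint n L hL hz) id) ⟨y, hLR hy, hint n L hL hy⟩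
    ⟨x, hxR, hxL⟩
  exact hzL (by rw [← hgL]; exact ⟨interior_subset hzi, hzR⟩)

variable [MeasurableSpace T] {m : Measure T}

lemma IsIndexingCollection.measurableSet [BorelSpace T] (hA : IsIndexingCollection A)
    {S : Set T} (hS : S ∈ A) : MeasurableSet S := (hA.isClosed hS).measurableSet

/-- A chain in the collection below a given set has a supremum in the collection, which is the
closure of the union of a sequence; hence bounds on the measure pass to the supremum. -/
lemma IsIndexingCollection.exists_sup_of_isChain (hA : IsIndexingCollection A)
    (hin : IsInnerContinuous A m) {U : Set T} (hU : U ∈ A) {t : ENNReal} {c : Set (Set T)}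
    (hc : IsChain (· ⊆ ·) c) (hcne : c.Nonempty)
    (hcA : ∀ S ∈ c, S ∈ A ∧ S.Nonempty ∧ S ⊆ U ∧ m S ≤ t) :
    closure (⋃₀ c) ∈ A ∧ m (closure (⋃₀ c)) ≤ t := by
  have hcU : ⋃₀ c ⊆ U := sUnion_subset fun S hS => (hcA S hS).2.2.1
  obtain ⟨D, hDc, hDcount, hDdense⟩ :=
    ((hA.isCompact U hU).isSeparable.mono hcU).exists_countable_dense_subset
  have hDne : D.Nonempty := by
    obtain ⟨S, hS⟩ := hcne
    obtain ⟨x, hx⟩ := (hcA S hS).2.1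
    exact closure_nonempty_iff.1 ⟨x, hDdense ⟨S, hS, hx⟩⟩
  obtain ⟨d, rfl⟩ := hDcount.exists_eq_range hDne
  choose C hCc hdC using fun i => hDc (mem_range_self i)
  let S : ℕ → Set T := fun n => ⋃ i ∈ Finset.range (n + 1), C i
  have hSc : ∀ n, S n ∈ c := by
    intro n
    induction n with
    | zero => simpa [S] using hCc 0
    | succ n ih =>
      have h : S (n + 1) = C (n + 1) ∪ S n := by
        simp only [S]
        rw [Finset.range_add_one, Finset.set_biUnion_insert]
      rw [h]
      rcases hc.total (hCc (n + 1)) ih with h' | h'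
      · rwa [union_eq_self_of_subset_left h']
      · rw [union_eq_self_of_subset_right h']
        exact hCc _
  have hmono : Monotone S := fun i j hij =>
    biUnion_subset_biUnion_left fun k hk => by
      simp only [Finset.mem_coe, Finset.mem_range] at hk ⊢
      omega
  have hcl : closure (⋃ n, S n) = closure (⋃₀ c) := by
    refine (closure_mono (iUnion_subset fun n => subset_sUnion_of_mem (hSc n))).antisymm ?_
    refine closure_minimal (hDdense.trans (closure_mono ?_)) isClosed_closure
    rintro _ ⟨i, rfl⟩
    exact mem_iUnion.2 ⟨i, mem_biUnion (Finset.mem_coe.2 (Finset.self_mem_range_succ i)) (hdC i)⟩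
  have hmem := hA.closure_iUnion_mem hU hmono (fun i => (hcA _ (hSc i)).1)
    fun i => (hcA _ (hSc i)).2.2.1
  rw [← hcl]
  exact ⟨hmem, le_of_tendsto' (hin S hmono (fun i => (hcA _ (hSc i)).1) hmem)
    fun i => (hcA _ (hSc i)).2.2.2⟩

/-- Every value below the measure of an element of the collection is the measure of a smaller
element: a maximal element of measure at most `t` and a minimal larger one of measure at least `t`
must coincide. -/
theorem IsIndexingCollection.exists_measure_eq [BorelSpace T] [m.OuterRegular]
    (hA : IsIndexingCollection A)
    (hin : IsInnerContinuous A m) (hm : m (minimalSet A) = 0) {U : Set T} (hU : U ∈ A)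
    {t : ENNReal} (ht : t ≤ m U) : ∃ S ∈ A, S ⊆ U ∧ m S = t := by
  rcases eq_or_ne t 0 with rfl | ht0
  · exact ⟨∅, hA.empty_mem, empty_subset _, measure_empty⟩
  have hUne : U.Nonempty := by
    rw [nonempty_iff_ne_empty]
    rintro rfl
    rw [measure_empty] at ht
    exact ht0 (le_zero_iff.1 ht)
  have hMne := hA.minimalSet_nonempty hU hUne
  obtain ⟨L, hML, hLmax⟩ := zorn_subset_nonempty
    {S | S ∈ A ∧ S.Nonempty ∧ S ⊆ U ∧ m S ≤ t} (fun c hc hchain hne => by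
      obtain ⟨h1, h2⟩ := hA.exists_sup_of_isChain hin hU hchain hne hc
      refine ⟨_, ⟨h1, ?_, closure_minimal (sUnion_subset fun S hS => (hc hS).2.2.1)
        (hA.isClosed hU), h2⟩, fun S hS => (subset_sUnion_of_mem hS).trans subset_closure⟩
      obtain ⟨S, hS⟩ := hne
      exact ((hc hS).2.1.mono (subset_sUnion_of_mem hS)).mono subset_closure)
    (minimalSet A) ⟨hA.minimalSet_mem hU hUne, hMne, minimalSet_subset hU hUne, by simp [hm]⟩
  obtain ⟨hLA, hLne, hLU, hLt⟩ := hLmax.prop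
  obtain ⟨R, hRU, hRmin⟩ := zorn_superset_nonempty
    {S | S ∈ A ∧ L ⊆ S ∧ S ⊆ U ∧ t ≤ m S} (fun c hc hchain hne => by
      refine ⟨⋂₀ c, ⟨hA.sInter_mem c (fun S hS => (hc hS).1) hne,
        subset_sInter fun S hS => (hc hS).2.1, ?_, ?_⟩, fun S hS => sInter_subset_of_mem hS⟩
      · obtain ⟨S, hS⟩ := hne
        exact (sInter_subset_of_mem hS).trans (hc hS).2.2.1
      · by_contra! hlt
        obtain ⟨O, hO, hOopen, hOt⟩ := Set.exists_isOpen_lt_of_lt _ _ hlt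
        have : Nonempty c := hne.to_subtype
        obtain ⟨S, hS⟩ := exists_subset_nhds_of_isCompact' (V := fun S : c => S.1)
          (fun S R => (hchain.total S.2 R.2).elim (fun h => ⟨S, subset_rfl, h⟩)
            fun h => ⟨R, h, subset_rfl⟩)
          (fun S => hA.isCompact _ (hc S.2).1) (fun S => hA.isClosed (hc S.2).1) (U := O)
          fun x hx => hOopen.mem_nhds (hO (by rwa [sInter_eq_iInter]))
        exact absurd ((hc S.2).2.2.2.trans (measure_mono hS)) (not_le.2 hOt))
    U ⟨hU, hLU, subset_rfl, ht⟩
  obtain ⟨hRA, hLR, -, hRt⟩ := hRmin.prop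
  have heq : L = R := by
    refine hA.eq_of_forall_between hLA hRA hLne hLR fun S hS hLS hSR => ?_
    rcases le_total (m S) t with h | h
    · exact Or.inl (hLmax.eq_of_subset ⟨hS, hLne.mono hLS, hSR.trans hRU, h⟩ hLS).symm
    · exact Or.inr (hRmin.eq_of_superset ⟨hS, hLS, hSR.trans hRU, h⟩ hSR).symm
  exact ⟨L, hLA, hLU, hLt.antisymm (heq ▸ hRt)⟩

end Flow

/-! ### Convergence in an indexing collection -/

section Convergence

variable {T : Type u} [MetricSpace T] {A : Set (Set T)}

lemma IsIndexingCollection.biInter_ge_mem (hA : IsIndexingCollection A) {U : ℕ → Set T}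
    (hU : ∀ n, U n ∈ A) (n : ℕ) : (⋂ k ≥ n, U k) ∈ A := by
  have h : (⋂ k ≥ n, U k) = ⋂₀ (U '' Ici n) := (sInter_image U (Ici n)).symm
  rw [h]
  exact hA.sInter_mem _ (by rintro _ ⟨k, -, rfl⟩; exact hU k) ⟨U n, n, self_mem_Ici, rfl⟩

variable {U : ℕ → Set T} {S : Set T}

lemma IsIndexingCollection.eventually_eq_empty (hA : IsIndexingCollection A) (hU : ∀ n, U n ∈ A)
    (hsup : (⋂ n, closure (⋃ k ≥ n, U k)) = ∅) : ∀ᶠ n in atTop, U n = ∅ := by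
  by_contra hcon
  rw [not_eventually] at hcon
  obtain ⟨n, hn⟩ := hcon.exists
  have hne := nonempty_iff_ne_empty.2 hn
  obtain ⟨x, hx⟩ := hA.minimalSet_nonempty (hU n) hne
  have : x ∈ ⋂ n, closure (⋃ k ≥ n, U k) := by
    refine mem_iInter.2 fun n => subset_closure ?_
    obtain ⟨k, hk, hk'⟩ := frequently_atTop.1 hcon n
    exact mem_iUnion₂.2 ⟨k, hk, minimalSet_subset (hU k) (nonempty_iff_ne_empty.2 hk') hx⟩
  rw [hsup] at this
  exact this

/-- Connected sets whose upper limit is compact and whose lower limit is nonempty are eventually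
contained in each open relatively compact neighbourhood of the limit, because they cannot cross its
boundary. -/
lemma IsIndexingCollection.eventually_subset (hA : IsIndexingCollection A) (hU : ∀ n, U n ∈ A)
    (hinf : closure (⋃ n, ⋂ k ≥ n, U k) = S) (hsup : (⋂ n, closure (⋃ k ≥ n, U k)) = S)
    (hne : S.Nonempty) {O : Set T} (hO : IsOpen O) (hOc : IsCompact (closure O)) (hSO : S ⊆ O) :
    ∀ᶠ n in atTop, U n ⊆ O := by
  have hanti : Antitone fun n => closure (⋃ k ≥ n, U k) := fun i j hij =>
    closure_mono (biUnion_subset_biUnion_left fun k (hk : j ≤ k) => hij.trans hk)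
  have hfr : IsCompact (frontier O) := hOc.of_isClosed_subset isClosed_frontier frontier_subset_closure
  obtain ⟨n, hn⟩ := hfr.elim_directed_family_closed
    (fun n => closure (⋃ k ≥ n, U k)) (fun n => isClosed_closure)
    (by
      rw [hsup, inter_comm]
      exact subset_empty_iff.1 (hO.inter_frontier_eq ▸ inter_subset_inter_left _ hSO)) hanti.directed_ge
  obtain ⟨x, hx⟩ := closure_nonempty_iff.1 (hinf ▸ hne)
  obtain ⟨n', hn'⟩ := mem_iUnion.1 hx
  filter_upwards [eventually_ge_atTop n, eventually_ge_atTop n'] with k hk hk'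
  have hxk : x ∈ U k := mem_iInter₂.1 hn' k hk'
  have hxS : x ∈ S := hinf ▸ subset_closure hx
  have hcov : ∀ z ∈ U k, z ∉ O → z ∈ (closure O)ᶜ := by
    intro z hz hzO hzc
    have hzf : z ∈ frontier O := by
      rw [hO.frontier_eq]
      exact ⟨hzc, hzO⟩
    have hmem : z ∈ frontier O ∩ closure (⋃ k ≥ n, U k) :=
      ⟨hzf, subset_closure (mem_iUnion₂.2 ⟨k, hk, hz⟩)⟩
    rw [hn] at hmem
    exact hmem
  intro y hy
  by_contra hyO
  obtain ⟨z, -, hzO, hzc⟩ := hA.isPreconnected _ (hU k) O (closure O)ᶜ hO isClosed_closure.isOpen_compl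
    (fun z hz => (em (z ∈ O)).imp id (hcov z hz)) ⟨x, hxk, hSO hxS⟩ ⟨y, hy, hcov y hy hyO⟩
  exact hzc (subset_closure hzO)

variable [LocallyCompactSpace T] [MeasurableSpace T] [BorelSpace T] {m : Measure T}
  [IsFiniteMeasureOnCompacts m]

/-- Convergence of sets in the index class implies convergence in measure. Continuity along
increasing sequences controls the lower limit, while the upper limit is a decreasing intersection of
closed sets which are eventually contained in a compact neighbourhood of the limit. -/
lemma IsIndexingCollection.tendsto_measure_diff (hA : IsIndexingCollection A)
    (hin : IsInnerContinuous A m) (hU : ∀ n, U n ∈ A) (hS : S ∈ A)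
    (hinf : closure (⋃ n, ⋂ k ≥ n, U k) = S) (hsup : (⋂ n, closure (⋃ k ≥ n, U k)) = S) :
    Tendsto (fun n => m (S \ U n)) atTop (𝓝 0) ∧ Tendsto (fun n => m (U n \ S)) atTop (𝓝 0) := by
  rcases S.eq_empty_or_nonempty with rfl | hne
  · have h := hA.eventually_eq_empty hU hsup
    refine ⟨by simp, tendsto_const_nhds.congr' ?_⟩
    filter_upwards [h] with n hn
    simp [hn]
  have hfin : m S ≠ ⊤ := (hA.isCompact S hS).measure_ne_top
  constructor
  · have hmono : Monotone fun n => ⋂ k ≥ n, U k := fun i j hij =>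
      biInter_subset_biInter_left fun k (hk : j ≤ k) => hij.trans hk
    have h1 := hin _ hmono (hA.biInter_ge_mem hU) (by rwa [hinf])
    rw [hinf] at h1
    have h2 : Tendsto (fun n => m S - m (⋂ k ≥ n, U k)) atTop (𝓝 (m S - m S)) :=
      ENNReal.Tendsto.sub tendsto_const_nhds h1 (Or.inl hfin)
    rw [tsub_self] at h2
    refine tendsto_of_tendsto_of_tendsto_of_le_of_le tendsto_const_nhds h2 (fun n => zero_le)
      fun n => ?_
    have hsub : (⋂ k ≥ n, U k) ⊆ S := by
      rw [← hinf]
      exact (subset_iUnion (fun n => ⋂ k ≥ n, U k) n).trans subset_closure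
    have hmem := hA.biInter_ge_mem hU n
    change m (S \ U n) ≤ m S - m (⋂ k ≥ n, U k)
    rw [← measure_sdiff hsub (hA.measurableSet hmem).nullMeasurableSet
      (hA.isCompact _ hmem).measure_ne_top]
    exact measure_mono (sdiff_subset_sdiff_right (biInter_subset_of_mem (le_refl n)))
  · obtain ⟨K, hK, hSK⟩ := exists_compact_superset (hA.isCompact S hS)
    have hcK : closure (interior K) ⊆ K := closure_minimal interior_subset hK.isClosed
    have hev := hA.eventually_subset hU hinf hsup hne isOpen_interior
      (hK.of_isClosed_subset isClosed_closure hcK) hSK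
    obtain ⟨N, hN⟩ := eventually_atTop.1 hev
    have hanti : Antitone fun n => closure (⋃ k ≥ n, U k) := fun i j hij =>
      closure_mono (biUnion_subset_biUnion_left fun k (hk : j ≤ k) => hij.trans hk)
    have hNK : closure (⋃ k ≥ N, U k) ⊆ K := closure_minimal
      (iUnion₂_subset fun k hk => (hN k hk).trans interior_subset) hK.isClosed
    have h1 := tendsto_measure_iInter_atTop (μ := m)
      (fun n => (isClosed_closure (s := ⋃ k ≥ n, U k)).measurableSet.nullMeasurableSet) hanti
      ⟨N, ((measure_mono hNK).trans_lt hK.measure_lt_top).ne⟩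
    rw [hsup] at h1
    have h2 : Tendsto (fun n => m (closure (⋃ k ≥ n, U k)) - m S) atTop (𝓝 (m S - m S)) :=
      ENNReal.Tendsto.sub h1 tendsto_const_nhds (Or.inl hfin)
    rw [tsub_self] at h2
    refine tendsto_of_tendsto_of_tendsto_of_le_of_le tendsto_const_nhds h2 (fun n => zero_le)
      fun n => ?_
    have hsub : S ⊆ closure (⋃ k ≥ n, U k) := by
      conv_lhs => rw [← hsup]
      exact iInter_subset _ n
    change m (U n \ S) ≤ m (closure (⋃ k ≥ n, U k)) - m S
    rw [← measure_sdiff hsub (hA.measurableSet hS).nullMeasurableSet hfin]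
    exact measure_mono (sdiff_subset_sdiff_left
      ((subset_biUnion_of_mem (u := U) (le_refl n)).trans subset_closure))

end Convergence

end SetIndexed

namespace SetIndexed

/-! ### Homogeneous Markov processes are Lévy processes -/

section MarkovToLevy

variable {T : Type u} {Ω : Type v} [MeasurableSpace Ω] {A : Set (Set T)} {P : Measure Ω}
  {X : Set T → Ω → ℝ} {Q : Set T → Set T → Kernel ℝ ℝ}

/-- The law of an increment of a Markov process over a difference of finite unions. -/
lemma IsQMarkov.map_of_mem [IsProbabilityMeasure P] (h : IsQMarkov A P X Q)
    (hXm : ∀ U ∈ A, Measurable (X U)) (hX : HasDefiniteIncrements A P X)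
    (hinter : ∀ S ∈ A, ∀ R ∈ A, S ∩ R ∈ A) (hempty : ∅ ∈ A) (hQ : IsTransitionSystem A Q)
    (hs : IsSpatiallyHomogeneous A Q) {U V : Set T} (hU : U ∈ finUnions A) (hV : V ∈ finUnions A)
    (hUV : U ⊆ V) {Y : Ω → ℝ} (hY : ((V \ U).indicator (1 : T → ℝ), Y) ∈ incrGraph A X) :
    P.map Y = Q U V 0 := by
  obtain ⟨k, a, ha, rfl⟩ := hU
  obtain ⟨l, b, hb, rfl⟩ := hV
  rw [← h.map_sub hXm hinter hempty hQ hs ha hb hUV]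
  exact Measure.map_congr (hX.ae_eq_of_mem hinter hempty hY
    (unionIncrement_sub_mem hinter ha hb hUV))

/-- The increments over the atoms of a finite family are independent: the atoms are added one by
one, those with large labels first, and each increment is independent of the past. -/
lemma IsQMarkov.hasAtomFormula [MeasurableSpace T] {m : Measure T} [IsProbabilityMeasure P]
    (h : IsQMarkov A P X Q) (hXm : ∀ U ∈ A, Measurable (X U)) (hX : HasDefiniteIncrements A P X)
    (hinter : ∀ S ∈ A, ∀ R ∈ A, S ∩ R ∈ A) (hempty : ∅ ∈ A) (hQ : IsTransitionSystem A Q)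
    (hs : IsSpatiallyHomogeneous A Q) (hm : IsMHomogeneous A m Q) :
    HasAtomFormula A P X fun C => charFun (kernelLaw A Q C) := by
  intro ι _ _ W hW c
  set f : T → ℝ := ∑ i, c i • (W i).indicator (1 : T → ℝ) with hf
  have key : ∀ S : Finset (AtomIdx W), IsUpperLabels S →
      charFun (P.map (∑ s ∈ S, f (pt s) • atomIncr X W s)) 1 =
        ∏ s ∈ S, charFun (kernelLaw A Q (atom W s)) (f (pt s)) := by
    intro S
    induction S using Finset.induction_on_min_value (fun s : AtomIdx W => s.1.card) with
    | empty =>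
      intro _
      rw [Finset.sum_empty, Finset.prod_empty]
      have h0 : P.map (0 : Ω → ℝ) = Measure.dirac 0 := by
        have := Measure.map_const P (0 : ℝ)
        rw [measure_univ, one_smul] at this
        exact this
      rw [h0, charFun_dirac]
      simp
    | insert a S ha hmin ih =>
      intro hup
      have hupS : IsUpperLabels S := hup.of_insert ha fun s hs _ => hmin s hs
      obtain ⟨k, u, hu, hKu⟩ := hupS.atomUnion_mem hinter hempty hW
      obtain ⟨l, v, hv, hKv⟩ := hup.atomUnion_mem hinter hempty hW
      have hsub : (⋃ i, u i) ⊆ ⋃ j, v j := by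
        rw [← hKu, ← hKv]
        exact atomUnion_mono (Finset.subset_insert _ _)
      have hdiff : (⋃ j, v j) \ (⋃ i, u i) = atom W a := by
        rw [← hKu, ← hKv, atomUnion_insert_diff ha]
      have hmem := unionIncrement_sub_mem (X := X) hinter hu hv hsub
      have hae : atomIncr X W a =ᵐ[P] unionIncrement X v - unionIncrement X u := by
        refine hX.ae_eq_of_mem hinter hempty (atomIncr_mem hinter hW a.2.1) ?_
        rwa [hdiff] at hmem
      have hpast : Measurable[minimalFiltration A X (⋃ i, u i)]
          (∑ s ∈ S, f (pt s) • atomIncr X W s) := by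
        rw [Finset.sum_fn]
        refine Finset.measurable_fun_sum _ fun s hsS => Measurable.const_smul ?_ _
        rw [atomIncr_eq_sum, Finset.sum_fn]
        refine Finset.measurable_fun_sum _ fun r hr => Measurable.const_smul ?_ _
        have hsr := (Finset.mem_filter.1 hr).2
        refine measurable_minimalFiltration (biInter_mem hinter hW (s.2.1.mono hsr)) ?_
        rw [← hKu, hupS.atomUnion_eq]
        exact (biInter_subset_biInter_left hsr).trans
          (subset_biUnion_of_mem (u := fun s : AtomIdx W => ⋂ i ∈ s.1, W i) hsS)
      have hind : IndepFun (f (pt a) • (unionIncrement X v - unionIncrement X u))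
          (∑ s ∈ S, f (pt s) • atomIncr X W s) P :=
        (h.indepFun hXm hinter hempty hQ hs hu hv hsub hpast).symm.comp
          (measurable_const_smul (f (pt a))) measurable_id
      have hIm : Measurable (unionIncrement X v - unionIncrement X u) :=
        measurable_of_mem_incrGraph hXm hmem
      have hae' : f (pt a) • atomIncr X W a + ∑ s ∈ S, f (pt s) • atomIncr X W s =ᵐ[P]
          f (pt a) • (unionIncrement X v - unionIncrement X u) +
            ∑ s ∈ S, f (pt s) • atomIncr X W s :=
        (hae.const_smul _).add (EventuallyEq.refl _ _)
      rw [Finset.sum_insert ha, Finset.prod_insert ha, Measure.map_congr hae',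
        hind.charFun_map_add_eq_mul (hIm.const_smul _).aemeasurable
          (hpast.mono (minimalFiltration_le hXm _) le_rfl).aemeasurable, Pi.mul_apply, ih hupS,
        ← charFun_map_eq_charFun_smul hIm, h.map_sub hXm hinter hempty hQ hs hu hv hsub,
        ← kernelLaw_diff hQ hm (iUnion_mem_finUnions hempty hu) (iUnion_mem_finUnions hempty hv)
          hsub, hdiff]
  rw [Measure.map_congr (sum_smul_ae_eq_sum_atomIncr hX hinter hempty hW c)]
  exact key Finset.univ fun s _ s' _ => Finset.mem_univ s'

/-- The values along two chains have the same law if their successive increments have. -/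
lemma HasAtomFormula.identDistrib_of_chain [IsProbabilityMeasure P] {κ : Set T → ℝ → ℂ}
    (h : HasAtomFormula A P X κ) (hκ : ∀ C, κ C 0 = 1) (hXm : ∀ U ∈ A, Measurable (X U)) (n : ℕ)
    {K K' : ℕ → Set T} (hK : Monotone K) (hK' : Monotone K') {Y Y' : ℕ → Ω → ℝ} (hY0 : Y 0 = 0)
    (hY'0 : Y' 0 = 0) (hY : ∀ j, ((K j \ K 0).indicator 1, Y j) ∈ incrGraph A X)
    (hY' : ∀ j, ((K' j \ K' 0).indicator 1, Y' j) ∈ incrGraph A X)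
    (hlaw : ∀ j, ∀ Z Z' : Ω → ℝ, ((K (j + 1) \ K j).indicator 1, Z) ∈ incrGraph A X →
      ((K' (j + 1) \ K' j).indicator 1, Z') ∈ incrGraph A X → P.map Z = P.map Z') :
    IdentDistrib (fun ω (i : Fin n) => Y (i + 1) ω) (fun ω (i : Fin n) => Y' (i + 1) ω) P P := by
  have hstep : ∀ {K : ℕ → Set T} (_ : Monotone K) {Y : ℕ → Ω → ℝ}
      (_ : ∀ j, ((K j \ K 0).indicator 1, Y j) ∈ incrGraph A X) (j : ℕ),
      ((K (j + 1) \ K j).indicator 1, Y (j + 1) - Y j) ∈ incrGraph A X := by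
    intro K hK Y hY j
    have h1 := Submodule.sub_mem _ (hY (j + 1)) (hY j)
    rw [Prod.mk_sub_mk,
      ← Set.indicator_sdiff (sdiff_subset_sdiff_left (hK j.le_succ))] at h1
    have h2 : (K (j + 1) \ K 0) \ (K j \ K 0) = K (j + 1) \ K j := by
      ext t
      have := @hK 0 j j.zero_le t
      simp only [Set.mem_sdiff]
      tauto
    rwa [h2] at h1
  have hindep : ∀ {K : ℕ → Set T} (_ : Monotone K) {Y : ℕ → Ω → ℝ}
      (_ : ∀ j, ((K j \ K 0).indicator 1, Y j) ∈ incrGraph A X),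
      ProbabilityTheory.iIndepFun (fun (j : Fin n) => Y (j.1 + 1) - Y j.1) P := by
    intro K hK Y hY
    refine h.iIndepFun hκ hXm (fun j => hstep hK hY j) fun k l hkl t ht => ?_
    have htk : t ∈ K (k + 1) \ K k := by
      by_contra hcon
      exact ht (Set.indicator_of_notMem hcon _)
    refine Set.indicator_of_notMem (fun htl => ?_) _
    rcases lt_or_gt_of_ne (fun h => hkl (Fin.ext h) : k.1 ≠ l.1) with hlt | hlt
    · exact htl.2 (hK hlt htk.1)
    · exact htk.2 (hK hlt htl.1)
  have hsum : ∀ {Y : ℕ → Ω → ℝ} (_ : Y 0 = 0), (fun ω (i : Fin n) => Y (i + 1) ω) =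
      (fun (x : Fin n → ℝ) (i : Fin n) => ∑ j : Fin n, if j.1 ≤ i.1 then x j else 0) ∘
        fun ω (j : Fin n) => Y (j.1 + 1) ω - Y j.1 ω := by
    intro Y hY0
    ext ω i
    simp only [Function.comp_apply]
    rw [← Finset.sum_range (f := fun j => if j ≤ i.1 then Y (j + 1) ω - Y j ω else 0),
      ← Finset.sum_filter]
    have hfil : (Finset.range n).filter (fun j => j ≤ i.1) = Finset.range (i.1 + 1) := by
      ext j
      simp only [Finset.mem_filter, Finset.mem_range]
      have := i.2
      omega
    rw [hfil, Finset.sum_range_sub (fun j => Y j ω), hY0]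
    simp
  have hmeas : Measurable fun (x : Fin n → ℝ) (i : Fin n) =>
      ∑ j : Fin n, if j.1 ≤ i.1 then x j else 0 := by
    refine measurable_pi_lambda _ fun i => Finset.measurable_fun_sum _ fun j _ => ?_
    split_ifs
    · exact measurable_pi_apply j
    · exact measurable_const
  rw [hsum hY0, hsum hY'0]
  refine IdentDistrib.comp ?_ hmeas
  exact IdentDistrib.pi (fun j => ⟨(measurable_of_mem_incrGraph hXm (hstep hK hY j)).aemeasurable,
    (measurable_of_mem_incrGraph hXm (hstep hK' hY' j)).aemeasurable,
    hlaw j _ _ (hstep hK hY j) (hstep hK' hY' j)⟩) (hindep hK hY) (hindep hK' hY')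

end MarkovToLevy

end SetIndexed

namespace SetIndexed

section Stationarity

variable {T : Type u} [MeasurableSpace T] {m : Measure T} {Ω : Type v} [MeasurableSpace Ω]
  {A : Set (Set T)} {P : Measure Ω} {X : Set T → Ω → ℝ}

/-- If the laws of the increments over differences of finite unions depend only on the measure of
the difference, then independence of the increments implies stationarity. -/
lemma HasAtomFormula.hasStationaryIncrements [IsProbabilityMeasure P] {κ : Set T → ℝ → ℂ}
    (h : HasAtomFormula A P X κ) (hκ : ∀ C, κ C 0 = 1) (hXm : ∀ U ∈ A, Measurable (X U))
    (hinter : ∀ S ∈ A, ∀ R ∈ A, S ∩ R ∈ A) (hempty : ∅ ∈ A) (hmeas : ∀ U ∈ A, MeasurableSet U)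
    (hfin : ∀ U ∈ A, m U ≠ ⊤)
    (hlaw : ∀ U ∈ finUnions A, ∀ V ∈ finUnions A, ∀ U' ∈ finUnions A, ∀ V' ∈ finUnions A,
      U ⊆ V → U' ⊆ V' → m (V \ U) = m (V' \ U') → ∀ Z Z' : Ω → ℝ,
      ((V \ U).indicator 1, Z) ∈ incrGraph A X → ((V' \ U').indicator 1, Z') ∈ incrGraph A X →
      P.map Z = P.map Z') : HasStationaryIncrements A m P X := by
  intro n V U W hV hU hW hUmono hWmono hUW
  cases n with
  | zero =>
    have : (fun ω (i : Fin 0) => X (U i) ω - X (U i ∩ V) ω) = fun ω i => X (W i) ω :=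
      funext fun ω => Subsingleton.elim _ _
    rw [this]
    exact IdentDistrib.refl (measurable_pi_lambda _ fun i => i.elim0).aemeasurable
  | succ n =>
    -- The chains `V ⊆ V ∪ U 0 ⊆ V ∪ U 1 ⊆ ⋯` and `∅ ⊆ W 0 ⊆ W 1 ⊆ ⋯`, constant from index `n` on,
    -- have consecutive differences of equal measures.
    let idx : ℕ → Fin (n + 1) := fun j => ⟨min j n, by omega⟩
    have hidx : Monotone idx := fun i j hij => Fin.mk_le_mk.2 (min_le_min_right n hij)
    have hidx' : ∀ i : Fin (n + 1), idx i = i := fun i => Fin.ext (min_eq_left (by omega))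
    let K : ℕ → Set T := fun j => Nat.casesOn j V fun j => V ∪ U (idx j)
    let K' : ℕ → Set T := fun j => Nat.casesOn j ∅ fun j => W (idx j)
    let Y : ℕ → Ω → ℝ := fun j => Nat.casesOn j 0 fun j => X (U (idx j)) - X (U (idx j) ∩ V)
    let Y' : ℕ → Ω → ℝ := fun j => Nat.casesOn j 0 fun j => X (W (idx j))
    have hKdiff : ∀ j, K (j + 1) \ K 0 = U (idx j) \ V := fun j => by
      change (V ∪ U (idx j)) \ V = _
      rw [union_sdiff_left]
    have hK : Monotone K := by
      refine monotone_nat_of_le_succ fun j => ?_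
      cases j with
      | zero => exact subset_union_left
      | succ j => exact union_subset_union_right _ (hUmono (hidx j.le_succ))
    have hK' : Monotone K' := by
      refine monotone_nat_of_le_succ fun j => ?_
      cases j with
      | zero => exact empty_subset _
      | succ j => exact hWmono (hidx j.le_succ)
    have hKA : ∀ j, K j ∈ finUnions A := by
      rintro (_ | j)
      · exact mem_finUnions_of_mem hV
      · exact union_mem_finUnions (mem_finUnions_of_mem hV) (mem_finUnions_of_mem (hU _))
    have hK'A : ∀ j, K' j ∈ A := by
      rintro (_ | j)
      exacts [hempty, hW _]
    have hKm : ∀ j, MeasurableSet (K j) := by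
      rintro (_ | j)
      exacts [hmeas V hV, (hmeas V hV).union (hmeas _ (hU _))]
    have hKfin : ∀ j, m (K j) ≠ ⊤ := by
      rintro (_ | j)
      exacts [hfin V hV, (measure_union_lt_top (hfin V hV).lt_top (hfin _ (hU _)).lt_top).ne]
    have hmeq : ∀ j, m (K j) = m V + m (K' j) := by
      rintro (_ | j)
      · change m V = m V + m ∅
        rw [measure_empty, add_zero]
      · change m (V ∪ U (idx j)) = m V + m (W (idx j))
        rw [← hUW, ← measure_union disjoint_sdiff_right ((hmeas _ (hU _)).diff (hmeas V hV)),
          union_sdiff_self]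
    have hstep : ∀ j, m (K (j + 1) \ K j) = m (K' (j + 1) \ K' j) := by
      intro j
      rw [measure_sdiff (hK j.le_succ) (hKm j).nullMeasurableSet (hKfin j),
        measure_sdiff (hK' j.le_succ) (hmeas _ (hK'A j)).nullMeasurableSet (hfin _ (hK'A j)),
        hmeq j, hmeq j.succ, ENNReal.add_sub_add_eq_sub_left (hfin V hV)]
    have hY : ∀ j, ((K j \ K 0).indicator 1, Y j) ∈ incrGraph A X := by
      rintro (_ | j)
      · rw [Set.sdiff_self, Set.indicator_empty']
        exact Submodule.zero_mem _
      · have h1 := Submodule.sub_mem _ (mem_incrGraph (X := X) (hU (idx j)))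
          (mem_incrGraph (X := X) (hinter _ (hU (idx j)) V hV))
        rw [Prod.mk_sub_mk, ← Set.indicator_sdiff inter_subset_left, sdiff_self_inter] at h1
        rw [hKdiff]
        exact h1
    have hY' : ∀ j, ((K' j \ K' 0).indicator 1, Y' j) ∈ incrGraph A X := by
      rintro (_ | j)
      · rw [Set.sdiff_self, Set.indicator_empty']
        exact Submodule.zero_mem _
      · have h1 : K' (j + 1) \ K' 0 = W (idx j) := sdiff_empty
        rw [h1]
        exact mem_incrGraph (hW _)
    have hid := h.identDistrib_of_chain hκ hXm (n + 1) hK hK' (Y := Y) (Y' := Y') rfl rfl hY hY'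
      fun j => hlaw _ (hKA j) _ (hKA _) _ (mem_finUnions_of_mem (hK'A j)) _
        (mem_finUnions_of_mem (hK'A _)) (hK j.le_succ) (hK' j.le_succ) (hstep j)
    have h1 : (fun ω (i : Fin (n + 1)) => X (U i) ω - X (U i ∩ V) ω) =
        fun ω (i : Fin (n + 1)) => Y (i + 1) ω := by
      ext ω i
      change _ = X (U (idx i)) ω - X (U (idx i) ∩ V) ω
      rw [hidx']
    have h2 : (fun ω (i : Fin (n + 1)) => X (W i) ω) =
        fun ω (i : Fin (n + 1)) => Y' (i + 1) ω := by
      ext ω i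
      change _ = X (W (idx i)) ω
      rw [hidx']
    rw [h1, h2]
    exact hid

end Stationarity

section Continuity

variable {T : Type u} [MeasurableSpace T] {m : Measure T} {A : Set (Set T)}
  {Q : Set T → Set T → Kernel ℝ ℝ}

/-- If the laws of the increments depend measurably on the measure of the sets, they tend to the
Dirac mass at `0` as the measure tends to `0`: their characteristic functions form a measurable
multiplicative function of the measure. -/
lemma IsMMeasurable.tendsto_charFun_kernelLaw (hmm : IsMMeasurable A m Q)
    (hQ : IsTransitionSystem A Q) (hs : IsSpatiallyHomogeneous A Q) (hm : IsMHomogeneous A m Q)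
    (hempty : ∅ ∈ A) (hmeas : ∀ U ∈ A, MeasurableSet U) (hfin : ∀ U ∈ A, m U ≠ ⊤)
    (hflow : ∀ U ∈ A, ∀ t ≤ m U, ∃ S ∈ A, S ⊆ U ∧ m S = t)
    (hcong : ∀ U ∈ finUnions A, ∀ V ∈ finUnions A, ∀ U' ∈ finUnions A, ∀ V' ∈ finUnions A,
      U ⊆ V → U' ⊆ V' → m (V \ U) = m (V' \ U') → kernelLaw A Q (V \ U) = kernelLaw A Q (V' \ U'))
    {U V : ℕ → Set T} (hU : ∀ n, U n ∈ finUnions A) (hV : ∀ n, V n ∈ finUnions A)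
    (hUV : ∀ n, U n ⊆ V n) (hlim : Tendsto (fun n => m (V n \ U n)) atTop (𝓝 0)) (z : ℝ) :
    Tendsto (fun n => charFun (kernelLaw A Q (V n \ U n)) z) atTop (𝓝 1) := by
  have hprob := hQ.isProbabilityMeasure_kernelLaw
  have hκ := isChainMul_kernelLaw hempty hQ hs hm
  have hemptyU := mem_finUnions_of_mem hempty
  have hnull : ∀ U ∈ finUnions A, ∀ V ∈ finUnions A, U ⊆ V → m (V \ U) = 0 →
      kernelLaw A Q (V \ U) = Measure.dirac 0 := by
    intro U hU V hV hUV h0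
    rw [hcong U hU V hV ∅ hemptyU ∅ hemptyU hUV subset_rfl (by simp [h0]),
      kernelLaw_diff hQ hm hemptyU hemptyU subset_rfl, hQ.refl _ hemptyU]
  by_cases hpos : ∃ R ∈ A, m R ≠ 0
  swap
  · push Not at hpos
    have h0 : ∀ n, m (V n \ U n) = 0 := by
      intro n
      obtain ⟨k, b, hb, hVb⟩ := hV n
      refine measure_mono_null sdiff_subset ?_
      rw [hVb]
      exact measure_iUnion_null fun i => hpos _ (hb i)
    simp_rw [fun n => hnull _ (hU n) _ (hV n) (hUV n) (h0 n), charFun_dirac]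
    simp
  obtain ⟨R, hR, hR0⟩ := hpos
  set s₀ : ℝ := (m R).toReal with hs₀def
  have hs₀ : 0 < s₀ := ENNReal.toReal_pos hR0 (hfin R hR)
  have hex : ∀ t : ℝ, t ≤ s₀ → ∃ S ∈ A, m S = ENNReal.ofReal t := fun t ht => by
    obtain ⟨S, hS, -, h⟩ := hflow R hR (ENNReal.ofReal t)
      ((ENNReal.ofReal_le_iff_le_toReal (hfin R hR)).2 ht)
    exact ⟨S, hS, h⟩
  choose! S hSA hSm using hex
  -- The increment law as a function of the measure of the set.
  let μ : ℝ → Measure ℝ := fun t => if 0 < t ∧ t ≤ s₀ then kernelLaw A Q (S t) else Measure.dirac 0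
  have hμ : ∀ t, IsProbabilityMeasure (μ t) := fun t => by
    simp only [μ]
    split_ifs <;> infer_instance
  have hκμ : ∀ U ∈ finUnions A, ∀ V ∈ finUnions A, U ⊆ V → ∀ t, 0 ≤ t → t ≤ s₀ →
      m (V \ U) = ENNReal.ofReal t → kernelLaw A Q (V \ U) = μ t := by
    intro U hU V hV hUV t ht ht' hmt
    rcases ht.eq_or_lt with rfl | ht
    · rw [hnull U hU V hV hUV (by simpa using hmt)]
      simp [μ]
    · simp only [μ]
      rw [if_pos ⟨ht, ht'⟩, hcong U hU V hV ∅ hemptyU (S t) (mem_finUnions_of_mem (hSA t ht')) hUV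
        (empty_subset _) (by rw [sdiff_empty, hmt, hSm t ht']), sdiff_empty]
  have hμmeas : Measurable μ := by
    refine Measure.measurable_of_measurable_coe μ fun B hB => ?_
    obtain ⟨q, hq, hqQ⟩ := hmm 0 B hB
    have heq : (fun t => μ t B) = fun t =>
        if 0 < t ∧ t ≤ s₀ then q (ENNReal.ofReal t) else Measure.dirac 0 B := by
      ext t
      simp only [μ]
      split_ifs with h
      · have hss : ∅ ⊂ S t := by
          rw [Set.empty_ssubset, nonempty_iff_ne_empty]
          intro h0
          have := hSm t h.2
          rw [h0, measure_empty] at this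
          exact absurd (ENNReal.ofReal_eq_zero.1 this.symm) (not_le.2 h.1)
        have hSt := mem_finUnions_of_mem (hSA t h.2)
        have h1 := kernelLaw_diff hQ hm hemptyU hSt (empty_subset _)
        rw [sdiff_empty] at h1
        rw [h1, hqQ _ hemptyU _ hSt hss, sdiff_empty, hSm t h.2]
      · rfl
    rw [heq]
    exact Measurable.ite ((measurableSet_lt measurable_const measurable_id).inter
      (measurableSet_le measurable_id measurable_const)) (hq.comp ENNReal.measurable_ofReal)
      measurable_const
  have hφmeas : ∀ z, Measurable fun t => charFun (μ t) z := by
    intro z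
    simp_rw [charFun_apply_real]
    have hf : StronglyMeasurable fun y : ℝ => Complex.exp (z * y * Complex.I) :=
      Measurable.stronglyMeasurable (by fun_prop)
    exact (hf.integral_kernel (κ := (⟨μ, hμmeas⟩ : Kernel ℝ ℝ))).measurable
  have hmul : ∀ z s t, 0 ≤ s → 0 ≤ t → s + t ≤ s₀ →
      charFun (μ (s + t)) z = charFun (μ s) z * charFun (μ t) z := by
    intro z s t hs ht hst
    obtain ⟨L, hL, hLS, hLm⟩ := hflow (S (s + t)) (hSA _ hst) (ENNReal.ofReal s)
      (by rw [hSm _ hst]; exact ENNReal.ofReal_le_ofReal (by linarith))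
    have hLU := mem_finUnions_of_mem hL
    have hSU := mem_finUnions_of_mem (hSA _ hst)
    have h1 := hκ.mul ∅ hemptyU L hLU _ hSU (empty_subset _) hLS z
    rw [hκμ ∅ hemptyU _ hSU (empty_subset _) (s + t) (by linarith) hst
        (by rw [sdiff_empty, hSm _ hst]),
      hκμ ∅ hemptyU _ hLU (empty_subset _) s hs (by linarith) (by rw [sdiff_empty, hLm]),
      hκμ L hLU _ hSU hLS t ht (by linarith)] at h1
    · exact h1
    · rw [measure_sdiff hLS (hmeas L hL).nullMeasurableSet (hfin L hL), hSm _ hst, hLm,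
        ← ENNReal.ofReal_sub _ hs]
      congr 1
      ring
  -- Near `z = 0` the characteristic function of `μ s₀`, hence each of them, does not vanish.
  obtain ⟨r, hr, hrne⟩ : ∃ r > 0, ∀ z : ℝ, |z| < r → charFun (μ s₀) z ≠ 0 := by
    have hc : ContinuousAt (charFun (μ s₀)) 0 := continuous_charFun.continuousAt
    have hne : charFun (μ s₀) 0 ≠ 0 := by simp
    obtain ⟨r, hr, hball⟩ := Metric.eventually_nhds_iff.1 (hc.eventually_ne hne)
    exact ⟨r, hr, fun z hz => hball (by simpa [Real.dist_eq] using hz)⟩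
  refine tendsto_charFun_one_of_near_zero hr (fun z hz => ?_) z
  have hφ0 : charFun (μ 0) z = 1 := by simp [μ, charFun_dirac]
  have hlim0 : Tendsto (fun t => charFun (μ t) z) (𝓝[>] 0) (𝓝 1) := by
    refine tendsto_one_of_multiplicative_of_measurable hs₀ (hφmeas z)
      (fun t => norm_charFun_le_one _) (hmul z) fun t ht ht' h0 => hrne z hz ?_
    have := hmul z t (s₀ - t) ht (by linarith) (by linarith)
    rw [add_sub_cancel, h0, zero_mul] at this
    exact this
  have hlim1 : Tendsto (fun t => charFun (μ t) z) (𝓝[≥] 0) (𝓝 1) := by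
    have hIci : (Ici 0 : Set ℝ) = insert 0 (Ioi 0) := Ioi_insert.symm
    rw [hIci, nhdsWithin_insert, tendsto_sup]
    exact ⟨tendsto_pure_left.2 fun s hs => hφ0 ▸ mem_of_mem_nhds hs, hlim0⟩
  have htoReal : Tendsto (fun n => (m (V n \ U n)).toReal) atTop (𝓝[≥] 0) := by
    refine tendsto_nhdsWithin_iff.2 ⟨?_, Eventually.of_forall fun n => ENNReal.toReal_nonneg⟩
    exact (ENNReal.tendsto_toReal ENNReal.zero_ne_top).comp hlim
  refine (hlim1.comp htoReal).congr' ?_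
  have hlt : ∀ᶠ n in atTop, m (V n \ U n) < ENNReal.ofReal s₀ :=
    hlim.eventually_lt_const (ENNReal.ofReal_pos.2 hs₀)
  filter_upwards [hlt] with n hn
  simp only [Function.comp_apply]
  rw [hκμ _ (hU n) _ (hV n) (hUV n) (m (V n \ U n)).toReal ENNReal.toReal_nonneg
    (ENNReal.toReal_le_of_le_ofReal hs₀.le hn.le) (ENNReal.ofReal_toReal hn.ne_top).symm]

end Continuity

end SetIndexed

namespace SetIndexed

section IsLevy

lemma tendstoInMeasure_of_sub {Ω : Type*} [MeasurableSpace Ω] {P : Measure Ω} {D E Z : ℕ → Ω → ℝ}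
    {Z₀ : Ω → ℝ} (hD : TendstoInMeasure P D atTop 0) (hE : TendstoInMeasure P E atTop 0)
    (h : ∀ n, Z n - Z₀ = D n - E n) : TendstoInMeasure P Z atTop Z₀ := by
  rw [tendstoInMeasure_iff_norm] at hD hE ⊢
  intro ε hε
  have hsum := (hD (ε / 2) (half_pos hε)).add (hE (ε / 2) (half_pos hε))
  rw [add_zero] at hsum
  refine tendsto_of_tendsto_of_tendsto_of_le_of_le tendsto_const_nhds hsum (fun n => zero_le)
    fun n => (measure_mono fun ω hω => ?_).trans (measure_union_le _ _)
  have h1 : Z n ω - Z₀ ω = D n ω - E n ω := congrFun (h n) ω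
  simp only [mem_union, mem_ofPred_eq, Pi.zero_apply, sub_zero] at hω ⊢
  rw [h1] at hω
  by_contra! hcon
  linarith [norm_sub_le (D n ω) (E n ω)]

variable {T : Type u} [MetricSpace T] [MeasurableSpace T] {m : Measure T} {Ω : Type v}
  [MeasurableSpace Ω] {A : Set (Set T)} {P : Measure Ω}
  [IsProbabilityMeasure P] {X : Set T → Ω → ℝ} {Q : Set T → Set T → Kernel ℝ ℝ}

/-- Increments over null sets vanish: otherwise the increment over the minimal set, which is also
a null set, would not vanish. Hence the laws of the increments only depend on the measure. -/
lemma IsQMarkov.kernelLaw_eq_of_measure_eq (h : IsQMarkov A P X Q) (hA : IsIndexingCollection A)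
    (hmin : m (minimalSet A) = 0) (hX0 : X (minimalSet A) =ᵐ[P] 0)
    (hXm : ∀ U ∈ A, Measurable (X U)) (hX : HasDefiniteIncrements A P X)
    (hQ : IsTransitionSystem A Q) (hs : IsSpatiallyHomogeneous A Q) (hm : IsMHomogeneous A m Q)
    {U V U' V' : Set T} (hU : U ∈ finUnions A) (hV : V ∈ finUnions A) (hU' : U' ∈ finUnions A)
    (hV' : V' ∈ finUnions A) (hUV : U ⊆ V) (hUV' : U' ⊆ V') (heq : m (V \ U) = m (V' \ U')) :
    kernelLaw A Q (V \ U) = kernelLaw A Q (V' \ U') := by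
  have hnull : ∀ U ∈ finUnions A, ∀ V ∈ finUnions A, U ⊆ V → m (V \ U) = 0 →
      kernelLaw A Q (V \ U) = Measure.dirac 0 := by
    intro U hU V hV hUV h0
    rw [kernelLaw_diff hQ hm hU hV hUV]
    rcases hUV.eq_or_ssubset with rfl | hss
    · exact hQ.refl U hU 0
    · obtain ⟨x, hxV, -⟩ := exists_of_ssubset hss
      obtain ⟨k, b, hb, hVb⟩ := hV
      rw [hVb] at hxV
      obtain ⟨i, hxi⟩ := mem_iUnion.1 hxV
      have hM := hA.minimalSet_mem (hb i) ⟨x, hxi⟩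
      have hMss : ∅ ⊂ minimalSet A :=
        Set.empty_ssubset.2 (hA.minimalSet_nonempty (hb i) ⟨x, hxi⟩)
      have hemptyU := mem_finUnions_of_mem hA.empty_mem
      rw [hm U hU V ⟨k, b, hb, hVb⟩ ∅ hemptyU _ (mem_finUnions_of_mem hM) hss hMss
        (by rw [h0, sdiff_empty, hmin]), ← h.map_of_mem hXm hX hA.inter_mem hA.empty_mem hQ hs
        hemptyU (mem_finUnions_of_mem hM) (empty_subset _) (Y := X (minimalSet A))
        (by rw [sdiff_empty]; exact mem_incrGraph hM), Measure.map_congr hX0]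
      have := Measure.map_const P (0 : ℝ)
      rw [measure_univ, one_smul] at this
      exact this
  rcases eq_or_ne (m (V \ U)) 0 with h0 | h0
  · rw [hnull U hU V hV hUV h0, hnull U' hU' V' hV' hUV' (heq ▸ h0)]
  · have hss : ∀ {U V : Set T}, U ⊆ V → m (V \ U) ≠ 0 → U ⊂ V := fun hUV h0 =>
      hUV.ssubset_of_ne fun he => h0 (by rw [he, Set.sdiff_self, measure_empty])
    rw [kernelLaw_diff hQ hm hU hV hUV, kernelLaw_diff hQ hm hU' hV' hUV',
      hm U hU V hV U' hU' V' hV' (hss hUV h0) (hss hUV' (heq ▸ h0)) heq]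

/-- A Markov process with a homogeneous transition system depending measurably on the measure is a
Lévy process. For the continuity in probability of `X` along `U n → S`, both `X (U n)` and `X S` are
compared with `X (U n ∩ S)`. -/
theorem IsQMarkov.isLevy [LocallyCompactSpace T] [BorelSpace T] [m.Regular]
    (h : IsQMarkov A P X Q) (hA : IsIndexingCollection A)
    (hin : IsInnerContinuous A m) (hmin : m (minimalSet A) = 0) (hX0 : X (minimalSet A) =ᵐ[P] 0)
    (hXm : ∀ U ∈ A, Measurable (X U)) (hX : HasDefiniteIncrements A P X)
    (hQ : IsTransitionSystem A Q) (hs : IsSpatiallyHomogeneous A Q) (hm : IsMHomogeneous A m Q)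
    (hmm : IsMMeasurable A m Q) : IsLevy A m P X := by
  have hκ := isChainMul_kernelLaw hA.empty_mem hQ hs hm
  have hform := h.hasAtomFormula hXm hX hA.inter_mem hA.empty_mem hQ hs hm
  have hmeas : ∀ U ∈ A, MeasurableSet U := fun U hU => hA.measurableSet hU
  have hfin : ∀ U ∈ A, m U ≠ ⊤ := fun U hU => (hA.isCompact U hU).measure_ne_top
  have hmap : ∀ U ∈ finUnions A, ∀ V ∈ finUnions A, U ⊆ V → ∀ Y : Ω → ℝ,
      ((V \ U).indicator 1, Y) ∈ incrGraph A X → P.map Y = kernelLaw A Q (V \ U) := by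
    intro U hU V hV hUV Y hY
    rw [kernelLaw_diff hQ hm hU hV hUV]
    exact h.map_of_mem hXm hX hA.inter_mem hA.empty_mem hQ hs hU hV hUV hY
  refine ⟨hX0, hform.hasIndependentIncrements hκ.zero hXm hA.inter_mem,
    hform.hasStationaryIncrements hκ.zero hXm hA.inter_mem hA.empty_mem hmeas hfin ?_, ?_⟩
  · intro U hU V hV U' hU' V' hV' hUV hUV' heq Z Z' hZ hZ'
    rw [hmap U hU V hV hUV Z hZ, hmap U' hU' V' hV' hUV' Z' hZ']
    exact h.kernelLaw_eq_of_measure_eq hA hmin hX0 hXm hX hQ hs hm hU hV hU' hV' hUV hUV' heq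
  · intro U S hU hS hinf hsup
    obtain ⟨h1, h2⟩ := hA.tendsto_measure_diff hin hU hS hinf hsup
    have hcap : ∀ n, U n ∩ S ∈ A := fun n => hA.inter_mem _ (hU n) S hS
    have hpart : ∀ V : ℕ → Set T, (∀ n, V n ∈ A) → (∀ n, U n ∩ S ⊆ V n) →
        Tendsto (fun n => m (V n \ (U n ∩ S))) atTop (𝓝 0) →
        TendstoInMeasure P (fun n => X (V n) - X (U n ∩ S)) atTop 0 := by
      intro V hV hUV hlim
      have hmem : ∀ n, ((V n \ (U n ∩ S)).indicator 1, X (V n) - X (U n ∩ S)) ∈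
          incrGraph A X := by
        intro n
        have h3 := Submodule.sub_mem _ (mem_incrGraph (X := X) (hV n))
          (mem_incrGraph (X := X) (hcap n))
        rwa [Prod.mk_sub_mk, ← Set.indicator_sdiff (hUV n)] at h3
      refine tendstoInMeasure_zero_of_charFun
        (fun n => measurable_of_mem_incrGraph hXm (hmem n)) fun z => ?_
      simp_rw [fun n => hmap _ (mem_finUnions_of_mem (hcap n)) _ (mem_finUnions_of_mem (hV n))
        (hUV n) _ (hmem n)]
      exact hmm.tendsto_charFun_kernelLaw hQ hs hm hA.empty_mem hmeas hfin
        (fun R hR t ht => hA.exists_measure_eq hin hmin hR ht)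
        (fun U hU V hV U' hU' V' hV' hUV hUV' heq =>
          h.kernelLaw_eq_of_measure_eq hA hmin hX0 hXm hX hQ hs hm hU hV hU' hV' hUV hUV' heq)
        (fun n => mem_finUnions_of_mem (hcap n)) (fun n => mem_finUnions_of_mem (hV n)) hUV hlim z
    refine tendstoInMeasure_of_sub
      (hpart U hU (fun n => inter_subset_left) (by simpa only [Set.sdiff_self_inter] using h2))
      (hpart (fun _ => S) (fun _ => hS) (fun n => inter_subset_right)
        (by simpa only [inter_comm, Set.sdiff_self_inter] using h1)) fun n => ?_
    ring

end IsLevy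

end SetIndexed

namespace SetIndexed

/-! ### One-dimensional laws of Lévy processes -/

section Exponent

/-- Laws with characteristic functions `exp (τ w)` depend measurably on `τ`, by Lévy's continuity
theorem. -/
lemma exists_measurable_of_charFun_eq_exp {ι : Type*} {τ : ι → ℝ} {ρ : ι → Measure ℝ}
    [∀ i, IsProbabilityMeasure (ρ i)] {w : ℝ → ℂ}
    (h : ∀ i z, charFun (ρ i) z = Complex.exp (τ i * w z)) {B : Set ℝ} (hB : MeasurableSet B) :
    ∃ q : ℝ → ENNReal, Measurable q ∧ ∀ i, ρ i B = q (τ i) := by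
  let _ : TopologicalSpace ι := TopologicalSpace.induced τ inferInstance
  let _ : MeasurableSpace ι := MeasurableSpace.comap τ inferInstance
  have hbor : BorelSpace ι := ⟨by rw [borel_comap, ← BorelSpace.measurable_eq]⟩
  have hfc : FirstCountableTopology ι := TopologicalSpace.firstCountableTopology_induced ι ℝ τ
  let F : ι → ProbabilityMeasure ℝ := fun i => ⟨ρ i, inferInstance⟩
  have hF : Continuous F := by
    refine SeqContinuous.continuous fun x p hx => ?_
    refine ProbabilityMeasure.tendsto_iff_tendsto_charFun.2 fun z => ?_
    have hτ : Tendsto (fun n => τ (x n)) atTop (𝓝 (τ p)) :=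
      (continuous_induced_dom.tendsto p).comp hx
    have h1 : Tendsto (fun n => Complex.exp (τ (x n) * w z)) atTop
        (𝓝 (Complex.exp (τ p * w z))) :=
      (Complex.continuous_exp.tendsto _).comp
        (((Complex.continuous_ofReal.tendsto _).comp hτ).mul_const _)
    have h2 : charFun (F p : Measure ℝ) z = Complex.exp (τ p * w z) := h p z
    rw [h2]
    exact h1.congr fun n => (h (x n) z).symm
  have hρ : Measurable ρ := by
    refine Measurable.measure_of_isPiSystem_of_isProbabilityMeasure
      ((BorelSpace.measurable_eq (α := ℝ)).trans borel_eq_generateFrom_isClosed)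
      isPiSystem_isClosed fun C hC => ?_
    refine measurable_of_tendsto_metrizable (fun n => ?_)
      (tendsto_pi_nhds.2 fun i => HasOuterApproxClosed.tendsto_lintegral_apprSeq hC (ρ i))
    refine (continuous_iff_continuousAt.2 fun i => ?_).measurable
    exact ProbabilityMeasure.tendsto_iff_forall_lintegral_tendsto.1 (hF.tendsto i) _
  have hρB : Measurable[MeasurableSpace.comap τ inferInstance] fun i => ρ i B :=
    (Measure.measurable_coe hB).comp hρ
  obtain ⟨q, hq, hqρ⟩ := hρB.exists_eq_measurable_comp
  exact ⟨q, hq, fun i => congrFun hqρ i⟩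

/-- A complex number is determined by the exponentials of its small real multiples, since the
exponential function takes the value `1` only at `0` near the origin. -/
lemma eq_of_forall_exp_eq {w w' : ℂ} {δ : ℝ} (hδ : 0 < δ)
    (h : ∀ t : ℝ, 0 ≤ t → t ≤ δ → Complex.exp (t * w) = Complex.exp (t * w')) : w = w' := by
  set c := w - w' with hc
  have hpos : 0 < ‖c‖ + 1 := by positivity
  set t := min δ (1 / (‖c‖ + 1)) with ht
  have ht0 : 0 < t := lt_min hδ (by positivity)
  have h1 : Complex.exp (t * c) = 1 := by
    rw [hc, mul_sub, Complex.exp_sub, h t ht0.le (min_le_left _ _), div_self (Complex.exp_ne_zero _)]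
  obtain ⟨n, hn⟩ := Complex.exp_eq_one_iff.1 h1
  have hlt : ‖(t : ℂ) * c‖ < 1 := by
    rw [norm_mul, Complex.norm_real, Real.norm_of_nonneg ht0.le]
    calc t * ‖c‖ ≤ 1 / (‖c‖ + 1) * ‖c‖ :=
          mul_le_mul_of_nonneg_right (min_le_right _ _) (norm_nonneg _)
      _ < 1 := by
          rw [one_div, inv_mul_lt_iff₀ hpos]
          linarith
  have hn0 : n = 0 := by
    by_contra hne
    have h2 : (1 : ℝ) ≤ |(n : ℝ)| := by exact_mod_cast Int.one_le_abs hne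
    rw [hn, norm_mul, norm_mul, norm_mul, Complex.norm_intCast, Complex.norm_I, Complex.norm_real,
      Real.norm_of_nonneg Real.pi_pos.le, Complex.norm_ofNat] at hlt
    nlinarith [Real.pi_gt_three]
  rw [hn0, Int.cast_zero, zero_mul, mul_eq_zero] at hn
  exact sub_eq_zero.1 (hn.resolve_left (by exact_mod_cast ht0.ne'))

end Exponent

section Increments

variable {T : Type u} {Ω : Type v} [MeasurableSpace Ω] {A : Set (Set T)} {P : Measure Ω}
  [IsProbabilityMeasure P] {X : Set T → Ω → ℝ}

lemma charFun_map_of_ae_eq_zero {Y : Ω → ℝ} (h : Y =ᵐ[P] 0) (z : ℝ) :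
    charFun (P.map Y) z = 1 := by
  have h0 : P.map (0 : Ω → ℝ) = Measure.dirac 0 := by
    have := Measure.map_const P (0 : ℝ)
    rw [measure_univ, one_smul] at this
    exact this
  rw [Measure.map_congr h, h0, charFun_dirac]
  simp

/-- The increment over `V \ U` is independent of the past of `U`; characteristic functions
multiply. -/
lemma charFun_map_of_disjoint (hXm : ∀ U ∈ A, Measurable (X U))
    (hX : HasDefiniteIncrements A P X)
    (hind : HasIndependentIncrements A P X) (hinter : ∀ S ∈ A, ∀ R ∈ A, S ∩ R ∈ A)
    (hempty : ∅ ∈ A) {U : Set T} {f g : T → ℝ} {Y Z I : Ω → ℝ} (hY : (f + g, Y) ∈ incrGraph A X)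
    (hZ : (f, Z) ∈ incrGraph A X) (hZm : Measurable[minimalFiltration A X U] Z)
    (hI : (g, I) ∈ incrGraph A X) (hg : ∀ t ∈ U, g t = 0) (z : ℝ) :
    charFun (P.map Y) z = charFun (P.map Z) z * charFun (P.map I) z := by
  have hind' : IndepFun Z I P := by
    rw [IndepFun_iff_Indep]
    exact indep_of_indep_of_le_left (indep_minimalFiltration hXm hX hind hinter hempty hI hg)
      hZm.comap_le
  rw [Measure.map_congr (hX.ae_eq_of_mem hinter hempty hY (Submodule.add_mem _ hZ hI)),
    hind'.charFun_map_add_eq_mul (measurable_of_mem_incrGraph hXm hZ).aemeasurable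
      (measurable_of_mem_incrGraph hXm hI).aemeasurable, Pi.mul_apply]

end Increments

section OneDimensional

variable {T : Type u} [MeasurableSpace T] {m : Measure T} {Ω : Type v} [MeasurableSpace Ω]
  {A : Set (Set T)} {P : Measure Ω} {X : Set T → Ω → ℝ}

lemma HasStationaryIncrements.map_sub_eq (h : HasStationaryIncrements A m P X) {U V W : Set T}
    (hU : U ∈ A) (hV : V ∈ A) (hW : W ∈ A) (hm : m (U \ V) = m W) :
    P.map (X U - X (U ∩ V)) = P.map (X W) := by
  have h1 := h 1 V (fun _ => U) (fun _ => W) hV (fun _ => hU) (fun _ => hW) monotone_const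
    monotone_const fun _ => hm
  exact (h1.comp (measurable_pi_apply (0 : Fin 1))).map_eq

lemma HasStationaryIncrements.map_eq (h : HasStationaryIncrements A m P X) (hempty : ∅ ∈ A)
    (hX : X ∅ =ᵐ[P] 0) {U W : Set T} (hU : U ∈ A) (hW : W ∈ A) (hm : m U = m W) :
    P.map (X U) = P.map (X W) := by
  rw [← h.map_sub_eq hU hempty hW (by rwa [sdiff_empty])]
  refine Measure.map_congr ?_
  filter_upwards [hX] with ω hω
  simp [hω]

end OneDimensional

section Semigroup

variable {T : Type u} [MetricSpace T] [MeasurableSpace T] {m : Measure T} {Ω : Type v}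
  [MeasurableSpace Ω] {A : Set (Set T)} {P : Measure Ω}
  [IsProbabilityMeasure P] {X : Set T → Ω → ℝ}

/-- Along decreasing sequences of sets with measures tending to `0`, the process tends to `0` in
law. -/
lemma IsLevy.tendsto_charFun_of_antitone (h : IsLevy A m P X) (hA : IsIndexingCollection A)
    (hXm : ∀ U ∈ A, Measurable (X U)) (hX : X ∅ =ᵐ[P] 0) {R : ℕ → Set T} (hR : ∀ n, R n ∈ A)
    (hanti : Antitone R) (hlim : Tendsto (fun n => m (R n)) atTop (𝓝 0)) (z : ℝ) :
    Tendsto (fun n => charFun (P.map (X (R n))) z) atTop (𝓝 1) := by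
  have hS : (⋂ n, R n) ∈ A := by
    rw [← sInter_range]
    exact hA.sInter_mem _ (by rintro _ ⟨n, rfl⟩; exact hR n) (range_nonempty R)
  have hinf : ∀ n, (⋂ k ≥ n, R k) = ⋂ k, R k := fun n =>
    (iInter_mono fun k => subset_iInter fun _ => subset_rfl).antisymm' <|
      subset_iInter fun k => (biInter_subset_of_mem (le_max_right k n)).trans
        (hanti (le_max_left k n))
  have hsup : ∀ n, (⋃ k ≥ n, R k) = R n := fun n =>
    (iUnion₂_subset fun k (hk : n ≤ k) => hanti hk).antisymm (subset_biUnion_of_mem (u := R) (le_refl n))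
  have hcont := h.continuous R (⋂ n, R n) hR hS
    (by simp_rw [hinf]; rw [iUnion_const, (hA.isClosed hS).closure_eq])
    (by simp_rw [hsup, fun n => (hA.isClosed (hR n)).closure_eq])
  have hm0 : m (⋂ n, R n) = m ∅ := by
    rw [measure_empty]
    exact le_zero_iff.1 (ge_of_tendsto' hlim fun n => measure_mono (iInter_subset R n))
  have hchar := ProbabilityMeasure.tendsto_iff_tendsto_charFun.1
    (hcont.tendstoInDistribution fun n => (hXm _ (hR n)).aemeasurable).tendsto z
  simp only [ProbabilityMeasure.coe_mk] at hchar
  rwa [h.stationary.map_eq hA.empty_mem hX hS hA.empty_mem hm0, charFun_map_of_ae_eq_zero hX]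
    at hchar

variable [BorelSpace T] [IsFiniteMeasureOnCompacts m]

/-- The characteristic functions of the values of a Lévy process are exponentials in the measure
of the index set, up to a given level. -/
lemma IsLevy.exists_exponent_of_le (h : IsLevy A m P X) (hA : IsIndexingCollection A)
    (hXm : ∀ U ∈ A, Measurable (X U)) (hX : HasDefiniteIncrements A P X)
    (hflow : ∀ U ∈ A, ∀ t ≤ m U, ∃ S ∈ A, S ⊆ U ∧ m S = t) {R : Set T} (hR : R ∈ A)
    (hR0 : m R ≠ 0) (z : ℝ) :
    ∃ w : ℂ, ∀ U ∈ A, m U ≤ m R → charFun (P.map (X U)) z = Complex.exp ((m U).toReal * w) := by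
  have hfin : ∀ U ∈ A, m U ≠ ⊤ := fun U hU => (hA.isCompact U hU).measure_ne_top
  set s₀ : ℝ := (m R).toReal with hs₀def
  have hs₀ : 0 < s₀ := ENNReal.toReal_pos hR0 (hfin R hR)
  have hex : ∀ t : ℝ, t ≤ s₀ → ∃ S ∈ A, m S = ENNReal.ofReal t := fun t ht => by
    obtain ⟨S, hS, -, h⟩ := hflow R hR (ENNReal.ofReal t)
      ((ENNReal.ofReal_le_iff_le_toReal (hfin R hR)).2 ht)
    exact ⟨S, hS, h⟩
  choose! S hSA hSm using hex
  let φ : ℝ → ℂ := fun t => charFun (P.map (X (S t))) z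
  have hφ : ∀ U ∈ A, ∀ t ≤ s₀, m U = ENNReal.ofReal t → charFun (P.map (X U)) z = φ t := by
    intro U hU t ht hUt
    simp only [φ]
    rw [h.stationary.map_eq hA.empty_mem hX.1 hU (hSA t ht) (by rw [hUt, hSm t ht])]
  have hφ0 : φ 0 = 1 := by
    rw [← hφ ∅ hA.empty_mem 0 hs₀.le (by simp), charFun_map_of_ae_eq_zero hX.1]
  have hmul : ∀ s t, 0 ≤ s → 0 ≤ t → s + t ≤ s₀ → φ (s + t) = φ s * φ t := by
    intro s t hs ht hst
    have hSst := hSA _ hst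
    obtain ⟨L, hL, hLS, hLm⟩ := hflow (S (s + t)) hSst (ENNReal.ofReal s)
      (by rw [hSm _ hst]; exact ENNReal.ofReal_le_ofReal (by linarith))
    have hdiff : m (S (s + t) \ L) = ENNReal.ofReal t := by
      rw [measure_sdiff hLS (hA.measurableSet hL).nullMeasurableSet (hfin L hL), hSm _ hst, hLm,
        ← ENNReal.ofReal_sub _ hs]
      congr 1
      ring
    have hI := Submodule.sub_mem _ (mem_incrGraph (X := X) hSst) (mem_incrGraph (X := X) hL)
    rw [Prod.mk_sub_mk] at hI
    have h1 := charFun_map_of_disjoint hXm hX h.independent hA.inter_mem hA.empty_mem (U := L)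
      (by rw [add_sub_cancel]; exact mem_incrGraph hSst) (mem_incrGraph hL)
      (measurable_minimalFiltration hL subset_rfl) hI
      (fun t ht => by simp [Set.indicator_of_mem ht, Set.indicator_of_mem (hLS ht)]) z
    have h2 := h.stationary.map_sub_eq hSst hL (hSA t (by linarith))
      (by rw [hdiff, hSm t (by linarith)])
    rw [inter_eq_right.2 hLS] at h2
    rw [← hφ _ hSst (s + t) hst (hSm _ hst), h1, hφ L hL s (by linarith) hLm, h2]
  have hlim : Tendsto φ (𝓝[>] 0) (𝓝 1) := by
    -- It suffices to treat decreasing sequences of measures, along which the sets can be chosen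
    -- decreasing as well.
    refine tendsto_of_subseq_tendsto fun t ht => ?_
    obtain ⟨ψ, hψ, hψmono⟩ := strictMono_subseq_of_tendsto_atTop (tendsto_inv_nhdsGT_zero.comp ht)
    have hev : ∀ᶠ n in atTop, t (ψ n) ∈ Ioc 0 s₀ :=
      (ht.comp hψ.tendsto_atTop).eventually (Ioc_mem_nhdsGT hs₀)
    obtain ⟨N, hN⟩ := eventually_atTop.1 hev
    let r : ℕ → ℝ := fun n => t (ψ (N + n))
    have hr : ∀ n, r n ∈ Ioc 0 s₀ := fun n => hN _ (Nat.le_add_right N n)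
    have hranti : ∀ n, r (n + 1) ≤ r n := fun n => by
      have := hψmono (Nat.lt_succ_self (N + n))
      simp only [Function.comp_apply] at this
      exact ((inv_lt_inv₀ (hr n).1 (hr (n + 1)).1).1 this).le
    have hshift : Tendsto (fun n => ψ (N + n)) atTop atTop :=
      hψ.tendsto_atTop.comp (tendsto_atTop_mono (fun n => Nat.le_add_left n N) tendsto_id)
    have hrlim : Tendsto r atTop (𝓝 0) :=
      (tendsto_nhdsWithin_iff.1 ht).1.comp hshift
    -- A decreasing sequence of sets with measures `r n`.
    have hstep : ∀ n (V : {V // V ∈ A ∧ m V = ENNReal.ofReal (r n)}),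
        ∃ V' : {V // V ∈ A ∧ m V = ENNReal.ofReal (r (n + 1))}, V'.1 ⊆ V.1 := by
      intro n V
      obtain ⟨V', hV', hsub, hVm⟩ := hflow V.1 V.2.1 (ENNReal.ofReal (r (n + 1)))
        (by rw [V.2.2]; exact ENNReal.ofReal_le_ofReal (hranti n))
      exact ⟨⟨V', hV', hVm⟩, hsub⟩
    choose next hnext using hstep
    let K : ∀ n, {V // V ∈ A ∧ m V = ENNReal.ofReal (r n)} := fun n =>
      Nat.rec ⟨S (r 0), hSA _ (hr 0).2, hSm _ (hr 0).2⟩ (fun n V => next n V) n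
    have hK : Antitone fun n => (K n).1 := antitone_nat_of_succ_le fun n => hnext n (K n)
    refine ⟨fun n => ψ (N + n), ?_⟩
    have hmlim : Tendsto (fun n => m (K n).1) atTop (𝓝 0) := by
      simp_rw [fun n => (K n).2.2]
      have := (ENNReal.continuous_ofReal.tendsto 0).comp hrlim
      rwa [ENNReal.ofReal_zero] at this
    refine (h.tendsto_charFun_of_antitone hA hXm hX.1 (fun n => (K n).2.1) hK hmlim z).congr
      fun n => hφ _ (K n).2.1 _ (hr n).2 (K n).2.2
  obtain ⟨w, hw⟩ := exists_eq_exp_of_multiplicative hs₀ hφ0 hmul hlim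
  refine ⟨w, fun U hU hUR => ?_⟩
  have hle : (m U).toReal ≤ s₀ := ENNReal.toReal_mono (hfin R hR) hUR
  rw [hφ U hU _ hle (ENNReal.ofReal_toReal (hfin U hU)).symm, hw _ ENNReal.toReal_nonneg hle]

/-- The characteristic functions of the values of a Lévy process are exponentials in the measure
of the index set. -/
lemma IsLevy.exists_exponent (h : IsLevy A m P X) (hA : IsIndexingCollection A)
    (hXm : ∀ U ∈ A, Measurable (X U)) (hX : HasDefiniteIncrements A P X)
    (hflow : ∀ U ∈ A, ∀ t ≤ m U, ∃ S ∈ A, S ⊆ U ∧ m S = t) :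
    ∃ w : ℝ → ℂ, ∀ U ∈ A, ∀ z, charFun (P.map (X U)) z = Complex.exp ((m U).toReal * w z) := by
  have hfin : ∀ U ∈ A, m U ≠ ⊤ := fun U hU => (hA.isCompact U hU).measure_ne_top
  have hzero : ∀ U ∈ A, m U = 0 → ∀ z, charFun (P.map (X U)) z = 1 := by
    intro U hU h0 z
    rw [h.stationary.map_eq hA.empty_mem hX.1 hU hA.empty_mem (by rw [h0, measure_empty]),
      charFun_map_of_ae_eq_zero hX.1]
  by_cases hpos : ∃ R ∈ A, m R ≠ 0
  · obtain ⟨R, hR, hR0⟩ := hpos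
    choose w hw using h.exists_exponent_of_le hA hXm hX hflow hR hR0
    refine ⟨w, fun U hU z => ?_⟩
    rcases le_total (m U) (m R) with hUR | hRU
    · exact hw z U hU hUR
    · have hU0 : m U ≠ 0 := fun h0 => hR0 (le_zero_iff.1 (h0 ▸ hRU))
      obtain ⟨w', hw'⟩ := h.exists_exponent_of_le hA hXm hX hflow hU hU0 z
      -- The exponents belonging to `R` and `U` agree on small sets.
      have hww : w' = w z := by
        refine eq_of_forall_exp_eq (ENNReal.toReal_pos hR0 (hfin R hR)) fun t ht htR => ?_
        have hle : ENNReal.ofReal t ≤ m R := (ENNReal.ofReal_le_iff_le_toReal (hfin R hR)).2 htR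
        obtain ⟨V, hV, -, hVm⟩ := hflow R hR _ hle
        have h1 := hw z V hV (hVm.trans_le hle)
        have h2 := hw' V hV ((hVm.trans_le hle).trans hRU)
        rw [hVm, ENNReal.toReal_ofReal ht] at h1 h2
        rw [← h1, ← h2]
      rw [hw' U hU le_rfl, hww]
  · push Not at hpos
    exact ⟨0, fun U hU z => by rw [hzero U hU (hpos U hU)]; simp⟩

end Semigroup

end SetIndexed

namespace SetIndexed

/-! ### Lévy processes are homogeneous Markov processes -/

section FiniteIncrements

variable {T : Type u} {Ω : Type v} {A : Set (Set T)} {X : Set T → Ω → ℝ}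

lemma exists_increment_measurable (hinter : ∀ S ∈ A, ∀ R ∈ A, S ∩ R ∈ A) {ι : Type*}
    (s : Finset ι) {U₀ : Set T} {U : ι → Set T} (hU₀ : U₀ ∈ A) (hU : ∀ i, U i ∈ A) :
    ∃ Z : Ω → ℝ, ((U₀ \ ⋃ i ∈ s, U i).indicator 1, Z) ∈ incrGraph A X ∧
      Measurable[minimalFiltration A X U₀] Z := by
  refine ⟨increment X U₀ fun j : Fin s.card => U (s.equivFin.symm j), ?_, ?_⟩
  · have h : (⋃ j : Fin s.card, U (s.equivFin.symm j)) = ⋃ i ∈ s, U i := by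
      rw [s.equivFin.symm.surjective.iUnion_comp fun i : s => U i, iUnion_subtype]
    rw [← h]
    exact increment_mem hinter hU₀ fun j => hU _
  · rw [increment_eq_sum, Finset.sum_fn]
    exact Finset.measurable_fun_sum _ fun r _ => (measurable_minimalFiltration
      (inter_biInter_mem hinter hU₀ (fun j => hU _) r) inter_subset_left).const_smul _

variable [MeasurableSpace T] {m : Measure T} [MeasurableSpace Ω] {P : Measure Ω}
  [IsProbabilityMeasure P] {w : ℝ → ℂ}

/-- If the characteristic functions of the values are exponentials in the measure, so are those of
the increments over differences with finite unions: the subtracted sets are added one by one, and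
the exponentials divided. -/
lemma charFun_increment_eq_exp (hXm : ∀ U ∈ A, Measurable (X U))
    (hX : HasDefiniteIncrements A P X) (hind : HasIndependentIncrements A P X)
    (hinter : ∀ S ∈ A, ∀ R ∈ A, S ∩ R ∈ A) (hempty : ∅ ∈ A) (hmeas : ∀ U ∈ A, MeasurableSet U)
    (hfin : ∀ U ∈ A, m U ≠ ⊤)
    (hw : ∀ U ∈ A, ∀ z, charFun (P.map (X U)) z = Complex.exp (m.real U * w z)) {ι : Type*}
    (s : Finset ι) {U : ι → Set T} (hU : ∀ i, U i ∈ A) (z : ℝ) :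
    ∀ U₀ ∈ A, ∀ Y : Ω → ℝ, ((U₀ \ ⋃ i ∈ s, U i).indicator 1, Y) ∈ incrGraph A X →
      charFun (P.map Y) z = Complex.exp (m.real (U₀ \ ⋃ i ∈ s, U i) * w z) := by
  classical
  induction s using Finset.induction_on with
  | empty =>
    intro U₀ hU₀ Y hY
    simp only [Finset.notMem_empty, iUnion_false, iUnion_empty, sdiff_empty] at hY ⊢
    rw [Measure.map_congr (hX.ae_eq_of_mem hinter hempty hY (mem_incrGraph hU₀)), hw U₀ hU₀]
  | insert a s ha ih =>
    intro U₀ hU₀ Y hY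
    have hcap := hinter U₀ hU₀ (U a) (hU a)
    obtain ⟨Z, hZ, hZm⟩ := exists_increment_measurable (X := X) hinter s hcap hU
    have hsm : MeasurableSet (⋃ i ∈ s, U i) :=
      s.measurableSet_biUnion fun i _ => hmeas _ (hU i)
    have hunion : ((U₀ ∩ U a) \ ⋃ i ∈ s, U i) ∪ (U₀ \ ⋃ i ∈ insert a s, U i) =
        U₀ \ ⋃ i ∈ s, U i := by
      rw [Finset.set_biUnion_insert]
      ext t
      simp only [mem_union, Set.mem_sdiff, mem_inter_iff]
      tauto
    have hdisj : Disjoint ((U₀ ∩ U a) \ ⋃ i ∈ s, U i) (U₀ \ ⋃ i ∈ insert a s, U i) := by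
      rw [Finset.set_biUnion_insert, Set.disjoint_left]
      exact fun t ht ht' => ht'.2 (Or.inl ht.1.2)
    have hsum := Submodule.add_mem _ hZ hY
    rw [Prod.mk_add_mk] at hsum
    have hadd : ((U₀ ∩ U a) \ ⋃ i ∈ s, U i).indicator (1 : T → ℝ) +
        (U₀ \ ⋃ i ∈ insert a s, U i).indicator 1 = (U₀ \ ⋃ i ∈ s, U i).indicator 1 := by
      rw [← hunion, Set.indicator_union_of_disjoint hdisj]
      rfl
    have hsum' := hsum
    rw [hadd] at hsum'
    have h1 := charFun_map_of_disjoint hXm hX hind hinter hempty (U := U₀ ∩ U a) hsum hZ hZm hY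
      (fun t ht => Set.indicator_of_notMem (fun h => h.2 (by
        rw [Finset.set_biUnion_insert]
        exact Or.inl ht.2)) _) z
    rw [ih U₀ hU₀ _ hsum', ih _ hcap Z hZ] at h1
    have hreal : m.real (U₀ \ ⋃ i ∈ s, U i) = m.real ((U₀ ∩ U a) \ ⋃ i ∈ s, U i) +
        m.real (U₀ \ ⋃ i ∈ insert a s, U i) := by
      rw [← hunion]
      refine measureReal_union hdisj ((hmeas _ hU₀).diff
        (Finset.measurableSet_biUnion _ fun i _ => hmeas _ (hU i)))
        (measure_ne_top_of_subset sdiff_subset (hfin _ hcap))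
        (measure_ne_top_of_subset sdiff_subset (hfin _ hU₀))
    rw [hreal, Complex.ofReal_add, add_mul, Complex.exp_add] at h1
    exact (mul_left_cancel₀ (Complex.exp_ne_zero _) h1).symm

/-- The characteristic functions of the increments over differences of finite unions. -/
lemma charFun_diff_eq_exp (hXm : ∀ U ∈ A, Measurable (X U))
    (hX : HasDefiniteIncrements A P X) (hind : HasIndependentIncrements A P X)
    (hinter : ∀ S ∈ A, ∀ R ∈ A, S ∩ R ∈ A) (hempty : ∅ ∈ A) (hmeas : ∀ U ∈ A, MeasurableSet U)
    (hfin : ∀ U ∈ A, m U ≠ ⊤)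
    (hw : ∀ U ∈ A, ∀ z, charFun (P.map (X U)) z = Complex.exp (m.real U * w z)) {U V : Set T}
    (hU : U ∈ finUnions A) (hV : V ∈ finUnions A) (hUV : U ⊆ V) {Y : Ω → ℝ}
    (hY : ((V \ U).indicator 1, Y) ∈ incrGraph A X) (z : ℝ) :
    charFun (P.map Y) z = Complex.exp (m.real (V \ U) * w z) := by
  classical
  have hmeasU : ∀ R ∈ finUnions A, MeasurableSet R := by
    rintro _ ⟨n, a, ha, rfl⟩
    exact MeasurableSet.iUnion fun i => hmeas _ (ha i)
  have hfinU : ∀ R ∈ finUnions A, m R ≠ ⊤ := by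
    rintro _ ⟨n, a, ha, rfl⟩
    exact ((measure_iUnion_le _).trans_lt (by
      rw [tsum_fintype]
      exact ENNReal.sum_lt_top.2 fun i _ => (hfin _ (ha i)).lt_top)).ne
  obtain ⟨l, b, hb, rfl⟩ := hV
  have key : ∀ s : Finset (Fin (l + 1)), ∀ Y : Ω → ℝ,
      (((U ∪ ⋃ i ∈ s, b i) \ U).indicator 1, Y) ∈ incrGraph A X →
      charFun (P.map Y) z = Complex.exp (m.real ((U ∪ ⋃ i ∈ s, b i) \ U) * w z) := by
    intro s
    induction s using Finset.induction_on with
    | empty =>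
      intro Y hY
      have h0 : (U ∪ ⋃ i ∈ (∅ : Finset (Fin (l + 1))), b i) \ U = ∅ := by simp
      rw [h0] at hY ⊢
      rw [Set.indicator_empty'] at hY
      rw [charFun_map_of_ae_eq_zero
        (hX.ae_eq_of_mem hinter hempty hY (Submodule.zero_mem (incrGraph A X)))]
      simp
    | insert a s ha ih =>
      intro Y hY
      have hW : (U ∪ ⋃ i ∈ s, b i) ∈ finUnions A := union_mem_finUnions hU
        (biUnion_mem_finUnions hempty s fun i _ => mem_finUnions_of_mem (hb i))
      set W := U ∪ ⋃ i ∈ s, b i with hWdef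
      have hUW : U ⊆ W := subset_union_left
      obtain ⟨k, c, hc, hUc⟩ := id hU
      obtain ⟨n, d, hd, hWd⟩ := id hW
      have hZ : ((W \ U).indicator 1, unionIncrement X d - unionIncrement X c) ∈
          incrGraph A X := by
        rw [hUc, hWd]
        exact unionIncrement_sub_mem hinter hc hd (by rw [← hUc, ← hWd]; exact hUW)
      have hZm : Measurable[minimalFiltration A X W]
          (unionIncrement X d - unionIncrement X c) := by
        have hle : minimalFiltration A X U ≤ minimalFiltration A X W :=
          biSup_mono fun R hR => ⟨hR.1, hR.2.trans hUW⟩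
        refine Measurable.sub ?_ (Measurable.mono ?_ hle le_rfl)
        · rw [hWd]
          exact measurable_unionIncrement_minimalFiltration hinter hd
        · rw [hUc]
          exact measurable_unionIncrement_minimalFiltration hinter hc
      have hdW : b a \ W = b a \ ⋃ i ∈ (Finset.univ : Finset (Fin (n + 1))), d i := by
        rw [hWd]
        simp
      obtain ⟨I, hI, -⟩ := exists_increment_measurable (X := X) hinter Finset.univ (hb a) hd
      have hIexp := charFun_increment_eq_exp hXm hX hind hinter hempty hmeas hfin hw
        Finset.univ hd z (b a) (hb a) I hI
      rw [← hdW] at hI hIexp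
      have hunion : (U ∪ ⋃ i ∈ insert a s, b i) \ U = (W \ U) ∪ (b a \ W) := by
        rw [Finset.set_biUnion_insert]
        ext t
        simp only [mem_union, Set.mem_sdiff, hWdef]
        tauto
      have hdisj : Disjoint (W \ U) (b a \ W) :=
        disjoint_sdiff_right.mono_left sdiff_subset
      rw [hunion] at hY ⊢
      rw [Set.indicator_union_of_disjoint hdisj] at hY
      rw [charFun_map_of_disjoint hXm hX hind hinter hempty (U := W) hY hZ hZm hI
        (fun t ht => Set.indicator_of_notMem (fun h => h.2 ht) _) z, ih _ hZ, hIexp,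
        measureReal_union hdisj ((hmeas _ (hb a)).diff (hmeasU _ hW))
          (measure_ne_top_of_subset sdiff_subset (hfinU _ hW))
          (measure_ne_top_of_subset sdiff_subset (hfin _ (hb a))),
        Complex.ofReal_add, add_mul, Complex.exp_add]
  have hall : U ∪ ⋃ i ∈ (Finset.univ : Finset (Fin (l + 1))), b i = ⋃ i, b i := by
    simpa using hUV
  have h := key Finset.univ Y
  rw [hall] at h
  exact h hY

end FiniteIncrements

section Kernel

/-- The kernel of translations of a probability measure. -/
def translationKernel (μ : Measure ℝ) : Kernel ℝ ℝ :=
  (Kernel.id ×ₖ Kernel.const ℝ μ).map fun p => p.1 + p.2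

instance (μ : Measure ℝ) [IsProbabilityMeasure μ] : IsMarkovKernel (translationKernel μ) :=
  Kernel.IsMarkovKernel.map _ (measurable_fst.add measurable_snd)

lemma translationKernel_apply (μ : Measure ℝ) [IsProbabilityMeasure μ] (x : ℝ) {B : Set ℝ}
    (hB : MeasurableSet B) : translationKernel μ x B = μ {y | y + x ∈ B} := by
  have hadd : Measurable fun p : ℝ × ℝ => p.1 + p.2 := measurable_fst.add measurable_snd
  rw [translationKernel, Kernel.map_apply' _ hadd _ hB, Kernel.prod_apply, Kernel.id_apply,
    Kernel.const_apply, Measure.dirac_prod, Measure.map_apply (by fun_prop) (hadd hB)]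
  congr 1
  ext y
  simp [add_comm]

variable {T : Type u} {Ω : Type v} [MeasurableSpace Ω] {A : Set (Set T)} {P : Measure Ω}
  {X : Set T → Ω → ℝ}

open Classical in
/-- The law of the increment of `X` over `C` (the Dirac mass at `0` if `C` does not support an
increment). -/
def incrLaw (A : Set (Set T)) (P : Measure Ω) (X : Set T → Ω → ℝ) (C : Set T) : Measure ℝ :=
  if h : ∃ Y : Ω → ℝ, (C.indicator 1, Y) ∈ incrGraph A X then P.map h.choose else Measure.dirac 0

lemma isProbabilityMeasure_incrLaw [IsProbabilityMeasure P] (hXm : ∀ U ∈ A, Measurable (X U))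
    (C : Set T) : IsProbabilityMeasure (incrLaw A P X C) := by
  rw [incrLaw]
  split_ifs with h
  · exact Measure.isProbabilityMeasure_map
      (measurable_of_mem_incrGraph hXm h.choose_spec).aemeasurable
  · infer_instance

lemma HasDefiniteIncrements.map_eq_incrLaw (hX : HasDefiniteIncrements A P X)
    (hinter : ∀ S ∈ A, ∀ R ∈ A, S ∩ R ∈ A) (hempty : ∅ ∈ A) {C : Set T} {Y : Ω → ℝ}
    (hY : (C.indicator 1, Y) ∈ incrGraph A X) : P.map Y = incrLaw A P X C := by
  have h : ∃ Y : Ω → ℝ, (C.indicator 1, Y) ∈ incrGraph A X := ⟨Y, hY⟩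
  rw [incrLaw, dif_pos h]
  exact Measure.map_congr (hX.ae_eq_of_mem hinter hempty hY h.choose_spec)

variable [IsProbabilityMeasure P] [MeasurableSpace T] {m : Measure T} {w : ℝ → ℂ}

/-- A process with independent increments whose characteristic functions are exponentials in the
measure is a homogeneous Markov process. -/
lemma exists_transitionSystem_of_charFun_eq_exp (hXm : ∀ U ∈ A, Measurable (X U))
    (hX : HasDefiniteIncrements A P X) (hind : HasIndependentIncrements A P X)
    (hinter : ∀ S ∈ A, ∀ R ∈ A, S ∩ R ∈ A) (hempty : ∅ ∈ A) (hmeas : ∀ U ∈ A, MeasurableSet U)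
    (hfin : ∀ U ∈ A, m U ≠ ⊤)
    (hw : ∀ U ∈ A, ∀ z, charFun (P.map (X U)) z = Complex.exp (m.real U * w z)) :
    ∃ Q : Set T → Set T → Kernel ℝ ℝ, IsTransitionSystem A Q ∧ IsSpatiallyHomogeneous A Q ∧
      IsMHomogeneous A m Q ∧ IsMMeasurable A m Q ∧ IsQMarkov A P X Q := by
  have hprob := isProbabilityMeasure_incrLaw (P := P) hXm
  have hmeasU : ∀ R ∈ finUnions A, MeasurableSet R := by
    rintro _ ⟨n, a, ha, rfl⟩
    exact MeasurableSet.iUnion fun i => hmeas _ (ha i)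
  have hfinU : ∀ R ∈ finUnions A, m R ≠ ⊤ := by
    rintro _ ⟨n, a, ha, rfl⟩
    exact ((measure_iUnion_le _).trans_lt (by
      rw [tsum_fintype]
      exact ENNReal.sum_lt_top.2 fun i _ => (hfin _ (ha i)).lt_top)).ne
  have hchar : ∀ U ∈ finUnions A, ∀ V ∈ finUnions A, U ⊆ V → ∀ z,
      charFun (incrLaw A P X (V \ U)) z = Complex.exp (m.real (V \ U) * w z) := by
    intro U hU V hV hUV z
    obtain ⟨k, a, ha, hUa⟩ := id hU
    obtain ⟨l, b, hb, hVb⟩ := id hV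
    have hmem : ((V \ U).indicator 1, unionIncrement X b - unionIncrement X a) ∈
        incrGraph A X := by
      rw [hUa, hVb]
      exact unionIncrement_sub_mem hinter ha hb (by rw [← hUa, ← hVb]; exact hUV)
    rw [← hX.map_eq_incrLaw hinter hempty hmem]
    exact charFun_diff_eq_exp hXm hX hind hinter hempty hmeas hfin hw hU hV hUV hmem z
  let Q : Set T → Set T → Kernel ℝ ℝ := fun U V => translationKernel (incrLaw A P X (V \ U))
  have hQ0 : ∀ U V, Q U V 0 = incrLaw A P X (V \ U) := by
    intro U V
    ext B hB
    simp only [Q]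
    rw [translationKernel_apply _ _ hB]
    simp
  have hsh : ∀ μ : Measure ℝ, IsProbabilityMeasure μ → ∀ (x : ℝ) {B : Set ℝ}, MeasurableSet B →
      translationKernel μ x B = translationKernel μ 0 {y | y + x ∈ B} := by
    intro μ hμ x B hB
    have hB' : MeasurableSet {y | y + x ∈ B} := (measurable_id.add_const x) hB
    rw [translationKernel_apply μ x hB, translationKernel_apply μ 0 hB']
    simp
  have hspat : IsSpatiallyHomogeneous A Q := fun U _ V _ _ x B hB => hsh _ inferInstance x hB
  have hmhom : IsMHomogeneous A m Q := by
    intro U hU V hV U' hU' V' hV' hUV hUV' heq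
    have h : incrLaw A P X (V \ U) = incrLaw A P X (V' \ U') := by
      refine Measure.ext_of_charFun ?_
      ext z
      rw [hchar U hU V hV hUV.subset, hchar U' hU' V' hV' hUV'.subset, measureReal_def,
        measureReal_def, heq]
    simp only [Q, h]
  have hQ : IsTransitionSystem A Q := by
    refine ⟨fun U _ V _ _ => inferInstance, fun U hU x => ?_,
      fun U hU V hV W hW hUV hVW x B hB => ?_⟩
    · have h0 : incrLaw A P X (U \ U) = Measure.dirac 0 := by
        refine Measure.ext_of_charFun ?_
        ext z
        rw [hchar U hU U hU subset_rfl, charFun_dirac]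
        simp
      ext B hB
      have hB' : MeasurableSet {y | y + x ∈ B} := (measurable_id.add_const x) hB
      simp only [Q]
      rw [translationKernel_apply _ x hB, h0, Measure.dirac_apply' _ hB',
        Measure.dirac_apply' _ hB]
      by_cases hx : x ∈ B <;> simp [hx]
    · have hconv : incrLaw A P X (W \ U) =
          (incrLaw A P X (V \ U)).conv (incrLaw A P X (W \ V)) := by
        refine Measure.ext_of_charFun ?_
        ext z
        have hdisj : Disjoint (V \ U) (W \ V) := disjoint_sdiff_right.mono_left sdiff_subset
        have hun : W \ U = (V \ U) ∪ (W \ V) := by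
          ext t
          have h1 := @hUV t
          have h2 := @hVW t
          simp only [mem_union, Set.mem_sdiff]
          tauto
        rw [charFun_conv, hchar U hU W hW (hUV.trans hVW), hchar U hU V hV hUV,
          hchar V hV W hW hVW, hun, measureReal_union hdisj ((hmeasU W hW).diff (hmeasU V hV))
            (measure_ne_top_of_subset sdiff_subset (hfinU V hV))
            (measure_ne_top_of_subset sdiff_subset (hfinU W hW)),
          Complex.ofReal_add, add_mul, Complex.exp_add]
      have hB' : MeasurableSet {y | y + x ∈ B} := (measurable_id.add_const x) hB
      have hadd : Measurable fun p : ℝ × ℝ => p.1 + p.2 := measurable_fst.add measurable_snd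
      have hx : Measurable fun y : ℝ => y + x := measurable_id.add_const x
      have hUVx : Q U V x = (incrLaw A P X (V \ U)).map (· + x) := by
        ext C hC
        simp only [Q]
        rw [translationKernel_apply _ x hC, Measure.map_apply hx hC]
        rfl
      rw [hUVx, lintegral_map ((Q V W).measurable_coe hB) hx]
      simp only [Q]
      rw [translationKernel_apply _ x hB, hconv, Measure.conv, Measure.map_apply hadd hB',
        Measure.prod_apply (hadd hB')]
      refine lintegral_congr fun y => ?_
      rw [translationKernel_apply _ _ hB]
      congr 1
      ext v
      simp only [mem_ofPred_eq, mem_preimage]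
      rw [show v + (y + x) = y + v + x by ring]
  refine ⟨Q, hQ, hspat, hmhom, fun x B hB => ?_,
    isQMarkov_of_hasIndependentIncrements hXm hX hind hinter hempty hQ hspat
      fun k l a b ha hb hab => ?_⟩
  · let ι := {p : Set T × Set T // p.1 ∈ finUnions A ∧ p.2 ∈ finUnions A ∧ p.1 ⊆ p.2}
    have hB' : MeasurableSet {y | y + x ∈ B} := (measurable_id.add_const x) hB
    obtain ⟨q, hq, hqρ⟩ := exists_measurable_of_charFun_eq_exp (ι := ι)
      (τ := fun p => m.real (p.1.2 \ p.1.1)) (ρ := fun p => incrLaw A P X (p.1.2 \ p.1.1))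
      (fun p z => hchar _ p.2.1 _ p.2.2.1 p.2.2.2 z) hB'
    refine ⟨fun t => q t.toReal, hq.comp ENNReal.measurable_toReal, fun U hU V hV hUV => ?_⟩
    simp only [Q]
    rw [translationKernel_apply _ x hB]
    exact hqρ ⟨(U, V), hU, hV, hUV.subset⟩
  · rw [hQ0]
    exact hX.map_eq_incrLaw hinter hempty (unionIncrement_sub_mem hinter ha hb hab)

end Kernel

end SetIndexed

end

theorem mainTheorem2 {T : Type u} [MetricSpace T] [LocallyCompactSpace T] [MeasurableSpace T]
    [BorelSpace T] (A : Set (Set T)) (hA : SetIndexed.IsIndexingCollection A)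
    (m : Measure T) [m.Regular] (hm : m (SetIndexed.minimalSet A) = 0) :
    (SetIndexed.IsInnerContinuous A m →
      ∀ (Ω : Type v) [MeasurableSpace Ω] (P : Measure Ω) [IsProbabilityMeasure P]
        (X : Set T → Ω → ℝ), (∀ U ∈ A, Measurable (X U)) →
        SetIndexed.HasDefiniteIncrements A P X →
        (SetIndexed.IsLevy A m P X ↔
          X (SetIndexed.minimalSet A) =ᵐ[P] 0 ∧
          ∃ Q : Set T → Set T → Kernel ℝ ℝ,
            SetIndexed.IsTransitionSystem A Q ∧ SetIndexed.IsSpatiallyHomogeneous A Q ∧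
            SetIndexed.IsMHomogeneous A m Q ∧ SetIndexed.IsMMeasurable A m Q ∧
            SetIndexed.IsQMarkov A P X Q)) ∧
    (∀ Q : Set T → Set T → Kernel ℝ ℝ,
      SetIndexed.IsTransitionSystem A Q → SetIndexed.IsSpatiallyHomogeneous A Q →
      SetIndexed.IsMHomogeneous A m Q →
      ∃ (Ω : Type u) (_ : MeasurableSpace Ω) (P : Measure Ω) (_ : IsProbabilityMeasure P)
        (X : Set T → Ω → ℝ), (∀ U ∈ A, Measurable (X U)) ∧
        SetIndexed.HasDefiniteIncrements A P X ∧ SetIndexed.IsQMarkov A P X Q) := by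
  refine ⟨fun hin Ω _ P _ X hXm hX => ⟨fun h => ⟨h.minimal, ?_⟩, ?_⟩, fun Q hQ hs hmh =>
    SetIndexed.exists_isQMarkov hA.inter_mem hA.empty_mem hQ hs hmh⟩
  · obtain ⟨w, hw⟩ := h.exists_exponent hA hXm hX
      fun U hU t ht => hA.exists_measure_eq hin hm hU ht
    exact SetIndexed.exists_transitionSystem_of_charFun_eq_exp hXm hX h.independent hA.inter_mem
      hA.empty_mem (fun U hU => hA.measurableSet hU)
      (fun U hU => (hA.isCompact U hU).measure_ne_top) hw
  · rintro ⟨hX0, Q, hQ, hs, hmh, hmm, hmarkov⟩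
    exact hmarkov.isLevy hA hin hm hX0 hXm hX hQ hs hmh hmm
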